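/- Let $d\ge 2$ be an integer. For a finite set $X\subset\mathbb R^d$ let $\mathrm{TSP}(X)$ be the minimum Euclidean length of a closed tour visiting every point of $X$ exactly once, let $\mathrm{MST}(X)$ be the minimum Euclidean length of a spanning tree of $X$, and, for $k\ge 2$, let $\mathrm{MST}_k(X)$ be the minimum Euclidean length of a spanning tree of $X$ all of whose vertices have degree at most $k$. Let $x_1,x_2,\dots$ be independent uniformly random points of $[0,1]^d$ and $\mathcal X_n=\{x_1,\dots,x_n\}$. For each functional $L\in\{\mathrm{TSP},\mathrm{MST},\mathrm{MST}_2,\mathrm{MST}_3,\dots\}$ let $\beta_L^d$ denote the constant (which exists) such that $$L(\mathcal X_n)/n^{\frac{d-1}{d}}\to\beta_L^d\quad\text{almost surely as } n\to\infty .$$ Let the strict kissing number $\tau'(d)$ be the maximum $K$ such that, for some $\varepsilon>0$, there are $K$ pairwise disjoint (solid) spheres of radius $1+\varepsilon$ in $\mathbb R^d$, each externally tangent to a common unit sphere. Then $$\beta_{\mathrm{TSP}}^d=\beta_{\mathrm{MST}_2}^d>\beta_{\mathrm{MST}_3}^d>\cdots>\beta_{\mathrm{MST}_{\tau'(d)}}^d=\beta_{\mathrm{MST}}^d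 .$$ In particular $\beta_{\mathrm{MST}}^d<\beta_{\mathrm{TSP}}^d$. -/

import Mathlib

open Filter Topology MeasureTheory

noncomputable section

namespace EuclideanFunctional

/-- `d`-dimensional Euclidean space. -/
abbrev Pt (d : ℕ) : Type := EuclideanSpace ℝ (Fin d)

/-- The total edge length of a graph whose vertices are points of a finite metric space. -/
def graphLength {V : Type*} [Fintype V] [MetricSpace V] (G : SimpleGraph V) : ℝ :=
  open scoped Classical in
  ∑ e ∈ G.edgeFinset, Sym2.lift ⟨fun x y : V => dist x y, fun x y => dist_comm x y⟩ e

/-- The minimum length of a spanning tree of the finite point set `X`. -/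
def mst {d : ℕ} (X : Finset (Pt d)) : ℝ :=
  sInf {l : ℝ | ∃ T : SimpleGraph X, T.IsTree ∧ l = graphLength T}

open scoped Classical in
/-- The minimum length of a spanning tree of the finite point set `X`
whose vertices all have degree at most `k`. -/
def mstDeg (k : ℕ) {d : ℕ} (X : Finset (Pt d)) : ℝ :=
  sInf {l : ℝ | ∃ T : SimpleGraph X, T.IsTree ∧ (∀ v, T.degree v ≤ k) ∧ l = graphLength T}

/-- The minimum length of a (closed) tour through the finite point set `X`: the points are
visited in the cyclic order given by the enumeration `e`, each exactly once
(`finRotate` is the cyclic successor `i ↦ i + 1`). -/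
def tsp {d : ℕ} (X : Finset (Pt d)) : ℝ :=
  sInf {l : ℝ | ∃ e : Fin X.card ≃ X,
    l = ∑ i, dist (e i : Pt d) (e (finRotate X.card i) : Pt d)}

/-- The unit hypercube `[0,1]^d`. -/
def cube (d : ℕ) : Set (Pt d) := {x | ∀ i, x i ∈ Set.Icc (0 : ℝ) 1}

/-- The uniform distribution on the unit hypercube. -/
def uniformCube (d : ℕ) : Measure (Pt d) := volume.restrict (cube d)

theorem volume_cube (d : ℕ) : volume (cube d) = 1 := by
  have h := (PiLp.volume_preserving_ofLp (Fin d)).measure_preimage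
    (s := Set.univ.pi fun _ => Set.Icc (0 : ℝ) 1)
    (MeasurableSet.univ_pi fun _ => measurableSet_Icc).nullMeasurableSet
  have hc : cube d = @WithLp.ofLp 2 (Fin d → ℝ) ⁻¹' Set.univ.pi fun _ => Set.Icc (0 : ℝ) 1 := by
    ext x
    simp only [cube, Set.mem_ofPred_eq, Set.mem_preimage, Set.mem_univ_pi]
  rw [hc, h, volume_pi_pi]
  simp

instance (d : ℕ) : IsProbabilityMeasure (uniformCube d) :=
  ⟨by rw [uniformCube, Measure.restrict_apply_univ, volume_cube]⟩

open scoped Classical in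
/-- `β` is the asymptotic constant of the functional `L` in dimension `d`: for a sequence
`x 0, x 1, …` of independent uniformly random points of `[0,1]^d`,
`L {x 0, …, x (n-1)} / n ^ ((d-1)/d) → β` almost surely. -/
def IsAsymptoticConstant (d : ℕ) (L : Finset (Pt d) → ℝ) (β : ℝ) : Prop :=
  ∀ᵐ x : ℕ → Pt d ∂(Measure.infinitePi fun _ : ℕ => uniformCube d),
    Tendsto (fun n : ℕ => L ((Finset.range n).image x) / (n : ℝ) ^ (((d : ℝ) - 1) / d))
      atTop (𝓝 β)

/-- There are, in dimension `d` and for some `ε > 0`, `K` pairwise disjoint (solid) spheres of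
radius `1 + ε`, each externally tangent to the unit sphere about the origin. -/
def HasStrictKissingConfiguration (d K : ℕ) : Prop :=
  ∃ ε : ℝ, 0 < ε ∧ ∃ c : Fin K → Pt d, (∀ i, dist (c i) 0 = 1 + (1 + ε)) ∧
    Pairwise fun i j => Disjoint (Metric.closedBall (c i) (1 + ε)) (Metric.closedBall (c j) (1 + ε))

/-- The strict kissing number: the maximum `K` admitting a strict kissing configuration. -/
def strictKissingNumber (d : ℕ) : ℕ := sSup {K | HasStrictKissingConfiguration d K}

theorem bddAbove_strictKissing (d : ℕ) : BddAbove {K | HasStrictKissingConfiguration d K} := by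
  obtain ⟨t, -, htf, ht⟩ := (isCompact_sphere (0 : Pt d) 1).finite_cover_balls
    (show (0 : ℝ) < 1 / 2 by norm_num)
  refine ⟨htf.toFinset.card, ?_⟩
  rintro K ⟨ε, hε, c, hc, hdis⟩
  have hu : ∀ i, ∃ p ∈ t, dist ((2 + ε)⁻¹ • c i) p < 1 / 2 := by
    intro i
    have hi : (2 + ε)⁻¹ • c i ∈ Metric.sphere (0 : Pt d) 1 := by
      have h := hc i
      rw [dist_zero_right] at h
      rw [mem_sphere_zero_iff_norm, norm_smul, h, Real.norm_of_nonneg (by positivity)]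
      field_simp
      ring
    simpa using ht hi
  choose p hpt hp using hu
  have hinj : Function.Injective p := by
    intro i j hij
    by_contra hne
    have h1 : dist ((2 + ε)⁻¹ • c i) ((2 + ε)⁻¹ • c j) < 1 := by
      have h2 := hp i
      have h3 := hp j
      rw [← hij] at h3
      linarith [dist_triangle_right ((2 + ε)⁻¹ • c i) ((2 + ε)⁻¹ • c j) (p i)]
    rw [dist_smul₀, Real.norm_of_nonneg (by positivity), inv_mul_lt_iff₀ (by positivity)] at h1
    refine Set.disjoint_left.1 (hdis hne) (?_ : midpoint ℝ (c i) (c j) ∈ _) ?_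
    · rw [Metric.mem_closedBall, dist_midpoint_left, Real.norm_of_nonneg (by norm_num)]
      linarith
    · rw [Metric.mem_closedBall, dist_midpoint_right, Real.norm_of_nonneg (by norm_num)]
      linarith
  calc K = (Finset.univ : Finset (Fin K)).card := by simp
    _ ≤ htf.toFinset.card :=
      Finset.card_le_card_of_injOn p (fun i _ => by simpa using hpt i) hinj.injOn

/-- The maximum in the definition of the strict kissing number exists and is attained. -/
theorem isGreatest_strictKissingNumber (d : ℕ) :
    IsGreatest {K | HasStrictKissingConfiguration d K} (strictKissingNumber d) :=
  ⟨Nat.sSup_mem ⟨0, 1, one_pos, Fin.elim0, fun i => i.elim0, fun i => i.elim0⟩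
    (bddAbove_strictKissing d), fun _ hK => le_csSup (bddAbove_strictKissing d) hK⟩

end EuclideanFunctional

end

open EuclideanFunctional

/-! Everything is compared with `spanLength k x B`, the least length of a connected graph with
degrees at most `k` on points indexed by `B`. A connected graph contains a spanning tree that is no
longer and has no larger degrees, so for distinct points this is `mstDeg k`. For `k = 2` a connected
graph contains a Hamiltonian path; closing it up costs at most the diameter `√d` of the cube, which
is negligible against `n ^ ((d-1)/d)`. Hence TSP and MST₂ share their constant.

Existence of the constants rests on `IsDegreeBounded.exists_isSpanning`: a graph of degrees at most
`k` whose components are represented by `r` vertices can be connected at cost `O(r ^ ((d-1)/d))`.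
One passes to a spanning forest and joins two close leaves of different components; a leaf has
degree at most 1, so the bound `k ≥ 2` survives, and pigeonhole makes the new edge of length `O(r ^
(-1/d))`. This yields smoothness (adding or deleting `j` points changes the length by `O(j ^
((d-1)/d))`) and subadditivity over cells. Subadditivity gives convergence of the means
(`meanLength_le_of_cells`, `exists_tendsto_meanLength`). Smoothness gives exponential concentration
(`exists_concentration`: McDiarmid applied to a Lipschitz regularization), and Borel–Cantelli then
gives the strong law.

At the upper end of the chain, almost surely no point is equidistant from two others. Exchanging
edges then shows that two edges of a minimum spanning tree at a common vertex make an angle larger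
than 60°, so all degrees are at most the strict kissing number and the degree bound is vacuous
(`spanLength_strictKissingNumber_le`).

For strictness let `k` be below the strict kissing number, so that a strict kissing configuration of
`k + 1` spheres exists. Scale it to size of order `n ^ (-1/d)`: a centre with `k + 1` satellites
that are closer to the centre than to each other or to any remaining point, robustly under small
perturbations. In a graph with degrees at most `k` some satellite is not adjacent to the centre, and
exchanging one of its edges for the edge to the centre saves length while raising only the degree of
the centre, to at most `k + 1` (`IsSpanning.exists_swap`). The expected number of isolated copies is
at least a constant times `n`, so the expected saving has the full order `n ^ ((d-1)/d)`
(`IsGadget.meanLength_succ_add_le`). -/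

noncomputable section

namespace EuclideanFunctional

/-! ### Graphs as finite edge sets: reachability, forests, leaves; close pairs in the cube -/

section

variable {ι κ : Type*} {d : ℕ}

/-- Reachability in the graph with edge set `E`. -/
def Joined (E : Finset (Sym2 ι)) (u v : ι) : Prop :=
  (SimpleGraph.fromEdgeSet (E : Set (Sym2 ι))).Reachable u v

/-- The number of edges of `E` incident to `v`. -/
def edgeDegree [DecidableEq ι] (E : Finset (Sym2 ι)) (v : ι) : ℕ := (E.filter (v ∈ ·)).card

/-- The length of the edge `e` when its ends are placed by `x`. -/
def edgeLength (x : ι → Pt d) (e : Sym2 ι) : ℝ :=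
  Sym2.lift ⟨fun a b : ι => dist (x a) (x b), fun a b => dist_comm (x a) (x b)⟩ e

/-- The total length of the edges of `E`. -/
def totalLength (x : ι → Pt d) (E : Finset (Sym2 ι)) : ℝ := ∑ e ∈ E, edgeLength x e

@[simp] theorem edgeLength_mk (x : ι → Pt d) (a b : ι) : edgeLength x s(a, b) = dist (x a) (x b) :=
  rfl

theorem edgeLength_nonneg (x : ι → Pt d) (e : Sym2 ι) : 0 ≤ edgeLength x e := by
  induction e with | _ a b => rw [edgeLength_mk]; exact dist_nonneg

theorem totalLength_nonneg (x : ι → Pt d) (E : Finset (Sym2 ι)) : 0 ≤ totalLength x E :=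
  Finset.sum_nonneg fun e _ => edgeLength_nonneg x e

theorem totalLength_mono (x : ι → Pt d) {E F : Finset (Sym2 ι)} (h : E ⊆ F) :
    totalLength x E ≤ totalLength x F :=
  Finset.sum_le_sum_of_subset_of_nonneg h fun e _ _ => edgeLength_nonneg x e

theorem totalLength_insert_le [DecidableEq ι] (x : ι → Pt d) (E : Finset (Sym2 ι)) (e : Sym2 ι) :
    totalLength x (insert e E) ≤ edgeLength x e + totalLength x E := by
  by_cases h : e ∈ E
  · rw [Finset.insert_eq_of_mem h]
    linarith [edgeLength_nonneg x e]
  · rw [totalLength, Finset.sum_insert h, totalLength]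

theorem totalLength_erase [DecidableEq ι] (x : ι → Pt d)
    {E : Finset (Sym2 ι)} {e : Sym2 ι} (h : e ∈ E) :
    totalLength x (E.erase e) = totalLength x E - edgeLength x e := by
  rw [totalLength, totalLength, ← Finset.add_sum_erase _ _ h]
  ring

theorem edgeDegree_mono [DecidableEq ι] {E F : Finset (Sym2 ι)} (h : E ⊆ F) (v : ι) :
    edgeDegree E v ≤ edgeDegree F v :=
  Finset.card_le_card (Finset.filter_subset_filter _ h)

theorem edgeDegree_insert_of_notMem [DecidableEq ι] {E : Finset (Sym2 ι)} {e : Sym2 ι} {v : ι}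
    (h : v ∉ e) :
    edgeDegree (insert e E) v = edgeDegree E v := by
  rw [edgeDegree, Finset.filter_insert, if_neg h, edgeDegree]

theorem edgeDegree_insert_le [DecidableEq ι] (E : Finset (Sym2 ι)) (e : Sym2 ι) (v : ι) :
    edgeDegree (insert e E) v ≤ edgeDegree E v + 1 := by
  rw [edgeDegree, Finset.filter_insert]
  split_ifs
  · exact Finset.card_insert_le _ _
  · exact Nat.le_succ _

theorem edgeDegree_erase_of_mem [DecidableEq ι] {E : Finset (Sym2 ι)} {e : Sym2 ι} {v : ι}
    (h : e ∈ E) (hv : v ∈ e) : edgeDegree (E.erase e) v + 1 = edgeDegree E v := by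
  have : (E.erase e).filter (v ∈ ·) = (E.filter (v ∈ ·)).erase e := Finset.filter_erase _ _ _
  rw [edgeDegree, this, Finset.card_erase_add_one (Finset.mem_filter.2 ⟨h, hv⟩), edgeDegree]

namespace Joined

@[refl] theorem refl (E : Finset (Sym2 ι)) (u : ι) : Joined E u u := SimpleGraph.Reachable.refl u

theorem symm {E : Finset (Sym2 ι)} {u v : ι} (h : Joined E u v) : Joined E v u :=
  SimpleGraph.Reachable.symm h

theorem trans {E : Finset (Sym2 ι)} {u v w : ι} (h : Joined E u v) (h' : Joined E v w) :
    Joined E u w :=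
  SimpleGraph.Reachable.trans h h'

theorem of_mem {E : Finset (Sym2 ι)} {u v : ι} (h : s(u, v) ∈ E) : Joined E u v := by
  by_cases huv : u = v
  · subst huv; exact refl E u
  · exact SimpleGraph.Adj.reachable (by simp [h, huv])

/-- If the ends of each edge of `E` are joined in `F`, then joined in `E` implies joined in `F`. -/
theorem of_forall_edge {E F : Finset (Sym2 ι)} (h : ∀ a b, s(a, b) ∈ E → Joined F a b) {u v : ι}
    (huv : Joined E u v) : Joined F u v := by
  obtain ⟨p⟩ := huv
  induction p with
  | nil => exact refl _ _
  | cons hadj _ ih =>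
    rw [SimpleGraph.fromEdgeSet_adj] at hadj
    exact (h _ _ (by simpa using hadj.1)).trans ih

theorem mono {E F : Finset (Sym2 ι)} (h : E ⊆ F) {u v : ι} (huv : Joined E u v) : Joined F u v :=
  of_forall_edge (fun _ _ hab => of_mem (h hab)) huv

end Joined

/-- A walk that avoids `v` uses no edge at `v`. -/
theorem joined_erase_of_walk [DecidableEq ι] {E : Finset (Sym2 ι)} {a b v w : ι}
    (p : (SimpleGraph.fromEdgeSet (E : Set (Sym2 ι))).Walk a b) (hv : v ∉ p.support) :
    Joined (E.erase s(v, w)) a b := by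
  induction p with
  | nil => exact Joined.refl _ _
  | @cons a c b hadj q ih =>
    rw [SimpleGraph.Walk.support_cons, List.mem_cons, not_or] at hv
    refine Joined.trans (Joined.of_mem ?_) (ih hv.2)
    rw [SimpleGraph.fromEdgeSet_adj] at hadj
    rw [Finset.mem_erase]
    refine ⟨fun h => ?_, by simpa using hadj.1⟩
    have : v ∈ s(a, c) := by rw [h]; simp
    rw [Sym2.mem_iff] at this
    rcases this with h1 | h1
    · exact hv.1 h1
    · exact hv.2 (h1 ▸ q.start_mem_support)

/-- Every edge of `E` is a bridge. -/
def IsForest [DecidableEq ι] (E : Finset (Sym2 ι)) : Prop :=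
  ∀ a b, s(a, b) ∈ E → ¬ Joined (E.erase s(a, b)) a b

/-- An edge that is not a bridge can be deleted without changing reachability; repeat until only
bridges remain. -/
theorem exists_isForest_subset [DecidableEq ι] (E : Finset (Sym2 ι)) :
    ∃ F ⊆ E, IsForest F ∧ ∀ u v, Joined E u v → Joined F u v := by
  induction h : E.card using Nat.strong_induction_on generalizing E with
  | _ n ih =>
    by_cases hE : IsForest E
    · exact ⟨E, subset_rfl, hE, fun _ _ h => h⟩
    · simp only [IsForest, not_forall, not_not] at hE
      obtain ⟨a, b, hab, hj⟩ := hE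
      obtain ⟨F, hF, hFf, hFj⟩ := ih _ (by rw [← h]; exact Finset.card_erase_lt_of_mem hab)
        (E.erase s(a, b)) rfl
      refine ⟨F, hF.trans (Finset.erase_subset _ _), hFf, fun u v huv => hFj _ _ ?_⟩
      refine huv.of_forall_edge fun p q hpq => ?_
      by_cases hq : s(p, q) = s(a, b)
      · rw [Sym2.eq_iff] at hq
        rcases hq with ⟨rfl, rfl⟩ | ⟨rfl, rfl⟩
        · exact hj
        · exact hj.symm
      · exact Joined.of_mem (Finset.mem_erase.2 ⟨hq, hpq⟩)

/-- Every component of a finite forest has a vertex of degree at most one. -/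
theorem IsForest.exists_edgeDegree_le_one [DecidableEq ι] {E : Finset (Sym2 ι)}
    (hE : IsForest E) (r : ι) :
    ∃ v, Joined E r v ∧ edgeDegree E v ≤ 1 := by
  classical
  set G := SimpleGraph.fromEdgeSet (E : Set (Sym2 ι)) with hG
  let S : Finset ι := (insert r (E.biUnion Sym2.toFinset)).filter (Joined E r)
  have hrS : r ∈ S := by simp [S, Joined.refl]
  -- A vertex farthest from the root is a leaf: shortest paths from `r` to its neighbours avoid it,
  -- so two neighbours would close a cycle through it.
  obtain ⟨v, hvS, hmax⟩ := S.exists_max_image (G.dist r) ⟨r, hrS⟩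
  have hrv : Joined E r v := (Finset.mem_filter.1 hvS).2
  refine ⟨v, hrv, ?_⟩
  by_contra hdeg
  rw [not_le, edgeDegree, Finset.one_lt_card] at hdeg
  obtain ⟨e, he, f, hf, hef⟩ := hdeg
  rw [Finset.mem_filter] at he hf
  obtain ⟨heE, u, rfl⟩ := he
  obtain ⟨hfE, w, rfl⟩ := hf
  have huw : u ≠ w := fun h => hef (by rw [h])
  have key : ∀ y, s(v, y) ∈ E → v ≠ y ∧ ∃ p : G.Walk r y, v ∉ p.support := by
    intro y hy
    have hvy : v ≠ y := fun h => hE _ _ hy (h ▸ Joined.refl _ _)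
    refine ⟨hvy, ?_⟩
    have hry : Joined E r y := hrv.trans (Joined.of_mem hy)
    have hyS : y ∈ S := by
      refine Finset.mem_filter.2 ⟨Finset.mem_insert_of_mem (Finset.mem_biUnion.2 ⟨_, hy, ?_⟩), hry⟩
      simp
    obtain ⟨p, hp⟩ := SimpleGraph.Reachable.exists_walk_length_eq_dist hry
    refine ⟨p, fun hvp => ?_⟩
    have h1 := SimpleGraph.Walk.length_takeUntil_lt_length hvp hvy
    have h2 := SimpleGraph.dist_le (p.takeUntil v hvp)
    have h3 := hmax y hyS
    change G.dist r v ≤ _ at h2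
    change _ = G.dist r y at hp
    omega
  obtain ⟨-, p, hp⟩ := key u heE
  obtain ⟨hvw, q, hq⟩ := key w hfE
  refine hE v u heE ?_
  have h1 : Joined (E.erase s(v, u)) r u := joined_erase_of_walk p hp
  have h2 : Joined (E.erase s(v, u)) r w := joined_erase_of_walk q hq
  have h3 : Joined (E.erase s(v, u)) v w := Joined.of_mem (Finset.mem_erase.2 ⟨hef.symm, hfE⟩)
  exact h3.trans (h2.symm.trans h1)

/-- Among `n` points of the unit cube some two are within `2 √d n ^ (-1/d)`. -/
theorem exists_dist_le_of_cube (hd : 1 ≤ d) (s : Finset ι) (hs : 2 ≤ s.card) (x : ι → Pt d)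
    (hx : ∀ i ∈ s, x i ∈ cube d) :
    ∃ i ∈ s, ∃ j ∈ s, i ≠ j ∧ dist (x i) (x j) ≤ 2 * √d * (s.card : ℝ) ^ (-(1 / d : ℝ)) := by
  set n := s.card
  have hd0 : (0 : ℝ) < d := by exact_mod_cast hd
  have hn0 : (0 : ℝ) < n := by exact_mod_cast (by omega : 0 < n)
  set t : ℝ := (n : ℝ) ^ (1 / d : ℝ)
  have ht1 : 1 < t := Real.one_lt_rpow (by exact_mod_cast (by omega : 1 < n)) (by positivity)
  have htd : t ^ d = n := by
    rw [← Real.rpow_natCast, ← Real.rpow_mul hn0.le, one_div_mul_cancel hd0.ne', Real.rpow_one]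
  -- Taking `m = ⌈t⌉ - 1` gives `m < t ≤ m + 1`: there are strictly fewer than `n` cells, and still
  -- `1 / m ≤ 2 / t`.
  obtain ⟨m, hm⟩ : ∃ m, ⌈t⌉₊ = m + 1 :=
    Nat.exists_eq_succ_of_ne_zero (by rw [Ne, Nat.ceil_eq_zero]; linarith)
  have hmt : (m : ℝ) < t := by
    have := Nat.ceil_lt_add_one (show 0 ≤ t by linarith)
    rw [hm] at this; push_cast at this; linarith
  have htm : t ≤ m + 1 := by
    have := Nat.le_ceil t
    rw [hm] at this; exact_mod_cast this
  have hm1 : 1 ≤ m := by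
    by_contra h
    have : m = 0 := by omega
    subst this; norm_num at htm; linarith
  have hm1' : (1 : ℝ) ≤ m := by exact_mod_cast hm1
  have hmd : m ^ d < n := by
    have : (m : ℝ) ^ d < t ^ d := pow_lt_pow_left₀ hmt (by positivity) (by omega)
    rw [htd] at this; exact_mod_cast this
  -- The minimum with `m - 1` puts the face where the coordinate is 1 into the last cell.
  let q : ι → (Fin d → Fin m) := fun i l => ⟨min ⌊m * x i l⌋₊ (m - 1), by omega⟩
  obtain ⟨i, hi, j, hj, hij, hq⟩ := Finset.exists_ne_map_eq_of_card_lt_of_maps_to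
    (s := s) (t := Finset.univ) (f := q) (by simpa using hmd)
    (fun _ _ => Finset.mem_coe.2 (Finset.mem_univ _))
  refine ⟨i, hi, j, hj, hij, ?_⟩
  have hcoord : ∀ l, |x i l - x j l| ≤ 1 / m := by
    intro l
    have h1 := congrArg Fin.val (congrFun hq l)
    simp only [q] at h1
    have bound : ∀ i ∈ s, ((min ⌊m * x i l⌋₊ (m - 1) : ℕ) : ℝ) ≤ m * x i l ∧
        m * x i l ≤ ((min ⌊m * x i l⌋₊ (m - 1) : ℕ) : ℝ) + 1 := by
      intro i hi
      obtain ⟨h0, h1⟩ := hx i hi l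
      have h2 : (0 : ℝ) ≤ m * x i l := by positivity
      constructor
      · exact (Nat.cast_le.2 (min_le_left _ _)).trans (Nat.floor_le h2)
      · rcases le_total ⌊m * x i l⌋₊ (m - 1) with h | h
        · rw [min_eq_left h]; exact (Nat.lt_floor_add_one _).le
        · rw [min_eq_right h]; push_cast [hm1]; nlinarith
    have b1 := bound i hi
    have b2 := bound j hj
    rw [h1] at b1
    rw [le_div_iff₀ (by linarith), ← abs_of_pos (show (0 : ℝ) < m by linarith), ← abs_mul, abs_le]
    constructor <;> nlinarith [b1.1, b1.2, b2.1, b2.2]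
  have hdist : dist (x i) (x j) ≤ √d * (1 / m) := by
    rw [EuclideanSpace.dist_eq]
    rw [show √(d : ℝ) * (1 / m) = √(d * (1 / m) ^ 2) by
      rw [Real.sqrt_mul (by positivity), Real.sqrt_sq (by positivity)]]
    refine Real.sqrt_le_sqrt ?_
    calc ∑ l, dist (x i l) (x j l) ^ 2 ≤ ∑ _l : Fin d, (1 / m : ℝ) ^ 2 := by
          refine Finset.sum_le_sum fun l _ => ?_
          rw [Real.dist_eq]
          exact pow_le_pow_left₀ (abs_nonneg _) (hcoord l) 2
      _ = d * (1 / m : ℝ) ^ 2 := by simp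
  refine hdist.trans ?_
  rw [Real.rpow_neg hn0.le, mul_comm 2, mul_assoc]
  refine mul_le_mul_of_nonneg_left ?_ (Real.sqrt_nonneg _)
  change 1 / (m : ℝ) ≤ 2 * t⁻¹
  rw [← div_eq_mul_inv, div_le_div_iff₀ (by linarith) (by linarith)]
  linarith

end

/-! ### Completing a degree-bounded graph to a connected one; the functional `spanLength` -/

section

variable {ι κ : Type*} [DecidableEq ι] [DecidableEq κ] {d : ℕ}

/-- The exponent `(d - 1) / d`. -/
def expo (d : ℕ) : ℝ := ((d : ℝ) - 1) / d

theorem expo_pos (hd : 2 ≤ d) : 0 < expo d := by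
  have : (2 : ℝ) ≤ d := by exact_mod_cast hd
  exact div_pos (by linarith) (by linarith)

theorem half_le_expo (hd : 2 ≤ d) : 1 / 2 ≤ expo d := by
  have : (2 : ℝ) ≤ d := by exact_mod_cast hd
  rw [expo, div_le_div_iff₀ (by linarith) (by linarith)]
  linarith

theorem expo_lt_one (hd : 2 ≤ d) : expo d < 1 := by
  have : (2 : ℝ) ≤ d := by exact_mod_cast hd
  rw [expo, div_lt_one (by linarith)]
  linarith

theorem expo_sub_one (hd : 2 ≤ d) : expo d - 1 = -(1 / d : ℝ) := by
  have : (2 : ℝ) ≤ d := by exact_mod_cast hd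
  rw [expo]
  field_simp
  ring

/-- `E` is a graph without loops on the vertex set `B` with all degrees at most `k`. -/
structure IsDegreeBounded (k : ℕ) (B : Finset ι) (E : Finset (Sym2 ι)) : Prop where
  mem : ∀ a b, s(a, b) ∈ E → a ∈ B
  ne : ∀ a b, s(a, b) ∈ E → a ≠ b
  degree_le : ∀ v, edgeDegree E v ≤ k

/-- `E` is a connected graph with vertex set `B` and all degrees at most `k`. -/
structure IsSpanning (k : ℕ) (B : Finset ι) (E : Finset (Sym2 ι)) : Prop
    extends IsDegreeBounded k B E where
  joined : ∀ u ∈ B, ∀ v ∈ B, Joined E u v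

theorem IsDegreeBounded.subset {k : ℕ} {B : Finset ι} {E F : Finset (Sym2 ι)}
    (h : IsDegreeBounded k B E) (hF : F ⊆ E) : IsDegreeBounded k B F :=
  ⟨fun a b hab => h.mem a b (hF hab), fun a b hab => h.ne a b (hF hab),
    fun v => (edgeDegree_mono hF v).trans (h.degree_le v)⟩

theorem IsDegreeBounded.mem_of_joined {k : ℕ} {B : Finset ι} {E : Finset (Sym2 ι)}
    (h : IsDegreeBounded k B E) {u v : ι} (hu : u ∈ B) (huv : Joined E u v) : v ∈ B := by
  obtain ⟨p⟩ := huv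
  induction p with
  | nil => exact hu
  | @cons a b _ hadj _ ih =>
    rw [SimpleGraph.fromEdgeSet_adj] at hadj
    exact ih (h.mem b a (by rw [Sym2.eq_swap]; simpa using hadj.1))

/-- The budget for one merge of components: by Bernoulli's inequality the increment of `4 n ^ p` is
at least `4 p n ^ (p - 1)`, and `p ≥ 1/2` because `d ≥ 2`. -/
theorem two_mul_rpow_add_le (hd : 2 ≤ d) {n : ℕ} (hn : 1 ≤ n) :
    2 * (n : ℝ) ^ (-(1 / d : ℝ)) + 4 * ((n - 1 : ℕ) : ℝ) ^ expo d ≤ 4 * (n : ℝ) ^ expo d := by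
  have hn0 : (0 : ℝ) < n := by exact_mod_cast hn
  have hn1 : (1 : ℝ) ≤ n := by exact_mod_cast hn
  have h1 : ((n - 1 : ℕ) : ℝ) = n * (1 + -(1 / n : ℝ)) := by
    push_cast [hn]
    field_simp
    ring
  have h2 : (1 + -(1 / n : ℝ)) ^ expo d ≤ 1 + expo d * -(1 / n : ℝ) := by
    refine rpow_one_add_le_one_add_mul_self ?_ (expo_pos hd).le (expo_lt_one hd).le
    rw [neg_le_neg_iff, div_le_one hn0]
    exact hn1
  have h3 : (n : ℝ) ^ (-(1 / d : ℝ)) = n ^ expo d / n := by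
    rw [← expo_sub_one hd, Real.rpow_sub_one hn0.ne']
  have h4 : 0 ≤ (1 + -(1 / n : ℝ)) := by
    have : 1 / (n : ℝ) ≤ 1 := by rw [div_le_one hn0]; exact hn1
    linarith
  rw [h1, Real.mul_rpow hn0.le h4, h3]
  have h5 : 0 < (n : ℝ) ^ expo d := Real.rpow_pos_of_pos hn0 _
  have h6 : (n : ℝ) ^ expo d * (1 + -(1 / n : ℝ)) ^ expo d ≤
      n ^ expo d * (1 + expo d * -(1 / n : ℝ)) := mul_le_mul_of_nonneg_left h2 h5.le
  have h7 : 1 / 2 * ((n : ℝ) ^ expo d / n) ≤ expo d * ((n : ℝ) ^ expo d / n) :=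
    mul_le_mul_of_nonneg_right (half_le_expo hd) (by positivity)
  have h8 : (n : ℝ) ^ expo d * (1 + expo d * -(1 / n : ℝ)) =
    (n : ℝ) ^ expo d - expo d * ((n : ℝ) ^ expo d / n) := by ring
  linarith

/-- A graph with degrees at most `k` whose components all meet `R` can be completed to a connected
one with degrees at most `k` at cost `O(|R| ^ ((d-1)/d))`. -/
theorem IsDegreeBounded.exists_isSpanning (hd : 2 ≤ d) {k : ℕ} (hk : 2 ≤ k) {B : Finset ι}
    {x : ι → Pt d} (hx : ∀ i ∈ B, x i ∈ cube d) {E : Finset (Sym2 ι)}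
    (hE : IsDegreeBounded k B E) {R : Finset ι} (hRB : R ⊆ B)
    (hR : ∀ v ∈ B, ∃ r ∈ R, Joined E r v) :
    ∃ F, IsSpanning k B F ∧ totalLength x F ≤ totalLength x E + 4 * √d * (R.card : ℝ) ^ expo d := by
  induction h : R.card using Nat.strong_induction_on generalizing R E with
  | _ n ih =>
    have hmono : ((n - 1 : ℕ) : ℝ) ^ expo d ≤ (n : ℝ) ^ expo d :=
      Real.rpow_le_rpow (Nat.cast_nonneg _) (Nat.cast_le.2 (Nat.sub_le _ _)) (expo_pos hd).le
    by_cases hn : n ≤ 1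
    · refine ⟨E, ⟨hE, fun u hu v hv => ?_⟩, ?_⟩
      · obtain ⟨r, hr, hru⟩ := hR u hu
        obtain ⟨r', hr', hrv⟩ := hR v hv
        rw [← h] at hn
        rw [Finset.card_le_one.1 hn r hr r' hr'] at hru
        exact hru.symm.trans hrv
      · have : 0 ≤ 4 * √d * (n : ℝ) ^ expo d := by positivity
        linarith
    -- Two representatives of one component: drop one at no cost. Otherwise the representatives lie
    -- in distinct components, and two of these are merged.
    by_cases hj : ∃ r ∈ R, ∃ r' ∈ R, r ≠ r' ∧ Joined E r r'
    · obtain ⟨r, hr, r', hr', hne, hj⟩ := hj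
      have hc : (R.erase r').card = n - 1 := by rw [Finset.card_erase_of_mem hr', h]
      obtain ⟨F, hF, hFl⟩ := ih (n - 1) (by omega) hE ((Finset.erase_subset r' R).trans hRB)
        (fun v hv => by
          obtain ⟨t, ht, htv⟩ := hR v hv
          by_cases htr : t = r'
          · subst htr
            exact ⟨r, Finset.mem_erase.2 ⟨hne, hr⟩, hj.trans htv⟩
          · exact ⟨t, Finset.mem_erase.2 ⟨htr, ht⟩, htv⟩) hc
      refine ⟨F, hF, hFl.trans ?_⟩
      gcongr
    · push Not at hj
      obtain ⟨F, hFE, hFf, hFj⟩ := exists_isForest_subset E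
      choose leaf hleaf hdeg using hFf.exists_edgeDegree_le_one
      have hFb := hE.subset hFE
      have hleafB : ∀ r ∈ R, leaf r ∈ B := fun r hr => hFb.mem_of_joined (hRB hr) (hleaf r)
      -- Pigeonhole is applied to the leaves, one for each representative, so the new edge raises
      -- degrees from at most 1 to at most 2.
      obtain ⟨r, hr, r', hr', hne, hdist⟩ := exists_dist_le_of_cube (by omega) R (by omega)
        (fun r => x (leaf r)) (fun r hr => hx _ (hleafB r hr))
      have hnj : leaf r ≠ leaf r' := fun heq => hj r hr r' hr' hne
        (((hleaf r).trans (heq ▸ (hleaf r').symm)).mono hFE)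
      set e := s(leaf r, leaf r')
      have hb : IsDegreeBounded k B (insert e F) := by
        refine ⟨fun a b hab => ?_, fun a b hab => ?_, fun v => ?_⟩
        · rcases Finset.mem_insert.1 hab with hab | hab
          · rcases Sym2.eq_iff.1 hab with ⟨rfl, -⟩ | ⟨rfl, -⟩
            · exact hleafB r hr
            · exact hleafB r' hr'
          · exact hFb.mem a b hab
        · rcases Finset.mem_insert.1 hab with hab | hab
          · rcases Sym2.eq_iff.1 hab with ⟨rfl, rfl⟩ | ⟨rfl, rfl⟩
            · exact hnj
            · exact hnj.symm
          · exact hFb.ne a b hab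
        · by_cases hv : v ∈ e
          · have h1 := edgeDegree_insert_le F e v
            have h2 : edgeDegree F v ≤ 1 := by
              rcases Sym2.mem_iff.1 hv with rfl | rfl
              · exact hdeg r
              · exact hdeg r'
            omega
          · rw [edgeDegree_insert_of_notMem hv]
            exact hFb.degree_le v
      have hc : (R.erase r').card = n - 1 := by rw [Finset.card_erase_of_mem hr', h]
      have hsub : F ⊆ insert e F := Finset.subset_insert _ _
      have hrr : Joined (insert e F) r r' :=
        ((hleaf r).mono hsub).trans ((Joined.of_mem (Finset.mem_insert_self _ _)).trans
          ((hleaf r').mono hsub).symm)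
      obtain ⟨F', hF', hFl⟩ := ih (n - 1) (by omega) hb ((Finset.erase_subset r' R).trans hRB)
        (fun v hv => by
          obtain ⟨t, ht, htv⟩ := hR v hv
          have htv' := (hFj _ _ htv).mono hsub
          by_cases htr : t = r'
          · subst htr
            exact ⟨r, Finset.mem_erase.2 ⟨hne, hr⟩, hrr.trans htv'⟩
          · exact ⟨t, Finset.mem_erase.2 ⟨htr, ht⟩, htv'⟩) hc
      refine ⟨F', hF', hFl.trans ?_⟩
      have h1 := totalLength_insert_le x F e
      have h2 := totalLength_mono x hFE
      have h3 : edgeLength x e ≤ 2 * √d * (n : ℝ) ^ (-(1 / d : ℝ)) := by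
        rw [← h]; exact hdist
      have h4 := mul_le_mul_of_nonneg_left (two_mul_rpow_add_le hd (show 1 ≤ n by omega))
        (Real.sqrt_nonneg d)
      nlinarith

/-- The least length of a connected graph on `B` with degrees at most `k`. -/
def spanLength (k : ℕ) (x : ι → Pt d) (B : Finset ι) : ℝ :=
  ⨅ E : {E : Finset (Sym2 ι) // IsSpanning k B E}, totalLength x E

theorem IsDegreeBounded.subset_sym2 {k : ℕ} {B : Finset ι} {E : Finset (Sym2 ι)}
    (h : IsDegreeBounded k B E) : E ⊆ B.sym2 := by
  intro e he
  induction e with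
  | _ a b =>
    rw [Finset.mk_mem_sym2_iff]
    exact ⟨h.mem a b he, h.mem b a (by rwa [Sym2.eq_swap])⟩

instance (k : ℕ) (B : Finset ι) : Finite {E : Finset (Sym2 ι) // IsSpanning k B E} :=
  Finite.of_injective (β := B.sym2.powerset)
    (fun E => ⟨E.1, Finset.mem_powerset.2 E.2.toIsDegreeBounded.subset_sym2⟩)
    (fun _ _ h => Subtype.ext (congrArg (fun z => z.1) h))

theorem isDegreeBounded_empty (k : ℕ) (B : Finset ι) : IsDegreeBounded k B ∅ :=
  ⟨by simp, by simp, by simp [edgeDegree]⟩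

theorem nonempty_isSpanning {k : ℕ} (hk : 2 ≤ k) (B : Finset ι) :
    Nonempty {E : Finset (Sym2 ι) // IsSpanning k B E} := by
  -- Only the combinatorial content matters here, so all points are placed at the origin of the
  -- plane.
  obtain ⟨E, hE, -⟩ := (isDegreeBounded_empty k B).exists_isSpanning (d := 2) le_rfl hk
    (x := fun _ => 0) (fun i _ l => by simp) subset_rfl (fun v hv => ⟨v, hv, Joined.refl _ _⟩)
  exact ⟨⟨E, hE⟩⟩

theorem spanLength_nonneg (k : ℕ) (x : ι → Pt d) (B : Finset ι) : 0 ≤ spanLength k x B :=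
  Real.iInf_nonneg fun _ => totalLength_nonneg _ _

theorem IsSpanning.spanLength_le {k : ℕ} {B : Finset ι} {E : Finset (Sym2 ι)}
    (h : IsSpanning k B E) (x : ι → Pt d) : spanLength k x B ≤ totalLength x E :=
  ciInf_le ⟨0, by rintro _ ⟨E, rfl⟩; exact totalLength_nonneg _ _⟩
    (⟨E, h⟩ : {E : Finset (Sym2 ι) // IsSpanning k B E})

theorem exists_isSpanning_eq {k : ℕ} (hk : 2 ≤ k) (x : ι → Pt d) (B : Finset ι) :
    ∃ E, IsSpanning k B E ∧ totalLength x E = spanLength k x B := by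
  have := nonempty_isSpanning hk B
  obtain ⟨E, hE⟩ := exists_eq_ciInf_of_finite
    (f := fun E : {E : Finset (Sym2 ι) // IsSpanning k B E} => totalLength x E.1)
  exact ⟨E.1, E.2, hE⟩

theorem spanLength_le_of_cover (hd : 2 ≤ d) {k : ℕ} (hk : 2 ≤ k) {B : Finset ι}
    {x : ι → Pt d} (hx : ∀ i ∈ B, x i ∈ cube d) {E : Finset (Sym2 ι)}
    (hE : IsDegreeBounded k B E) {R : Finset ι} (hRB : R ⊆ B)
    (hR : ∀ v ∈ B, ∃ r ∈ R, Joined E r v) :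
    spanLength k x B ≤ totalLength x E + 4 * √d * (R.card : ℝ) ^ expo d := by
  obtain ⟨F, hF, hl⟩ := hE.exists_isSpanning hd hk hx hRB hR
  exact (hF.spanLength_le x).trans hl

theorem spanLength_le_rpow (hd : 2 ≤ d) {k : ℕ} (hk : 2 ≤ k) {B : Finset ι}
    {x : ι → Pt d} (hx : ∀ i ∈ B, x i ∈ cube d) :
    spanLength k x B ≤ 4 * √d * (B.card : ℝ) ^ expo d := by
  have := spanLength_le_of_cover hd hk hx (isDegreeBounded_empty k B) subset_rfl
    (fun v hv => ⟨v, hv, Joined.refl _ _⟩)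
  simpa [totalLength] using this

theorem spanLength_empty (k : ℕ) (x : ι → Pt d) : spanLength k x ∅ = 0 :=
  le_antisymm (((⟨isDegreeBounded_empty k ∅, by simp⟩ : IsSpanning k ∅ ∅).spanLength_le x).trans
    (by simp [totalLength])) (spanLength_nonneg _ _ _)

end

/-! ### Smoothness, subadditivity, scaling, relabelling and measurability of `spanLength` -/

section

variable {ι κ : Type*} {d : ℕ}

theorem joined_map_iff (f : κ ↪ ι) (E : Finset (Sym2 κ)) (u v : κ) :
    Joined (E.map f.sym2Map) (f u) (f v) ↔ Joined E u v := by
  have hmem : ∀ a b, s(f a, f b) ∈ E.map f.sym2Map ↔ s(a, b) ∈ E := fun a b =>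
    Finset.mem_map' f.sym2Map (a := s(a, b))
  constructor
  · suffices ∀ {p w : ι}
        (_ : (SimpleGraph.fromEdgeSet ((E.map f.sym2Map : Finset _) : Set (Sym2 ι))).Walk p w),
        ∀ u, p = f u → ∃ v, w = f v ∧ Joined E u v by
      rintro ⟨p⟩
      obtain ⟨v', hv', h⟩ := this p u rfl
      rwa [f.injective hv']
    intro p w q
    induction q with
    | nil => exact fun u hu => ⟨u, hu, Joined.refl _ _⟩
    | @cons a b c hadj q ih =>
      rintro u rfl
      rw [SimpleGraph.fromEdgeSet_adj, Finset.mem_coe] at hadj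
      obtain ⟨v, rfl⟩ : ∃ v, b = f v := by
        obtain ⟨e, -, he⟩ := Finset.mem_map.1 hadj.1
        have hb : b ∈ Sym2.map f e := by
          have : f.sym2Map e = Sym2.map f e := rfl
          rw [← this, he]; simp
        obtain ⟨v, -, hv⟩ := Sym2.mem_map.1 hb
        exact ⟨v, hv.symm⟩
      obtain ⟨v', hv', h⟩ := ih v rfl
      exact ⟨v', hv', (Joined.of_mem ((hmem u v).1 hadj.1)).trans h⟩
  · rintro ⟨p⟩
    induction p with
    | nil => exact Joined.refl _ _
    | @cons a b c hadj _ ih =>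
      rw [SimpleGraph.fromEdgeSet_adj, Finset.mem_coe] at hadj
      exact (Joined.of_mem ((hmem _ _).2 hadj.1)).trans ih

theorem totalLength_map (f : κ ↪ ι) (x : ι → Pt d) (E : Finset (Sym2 κ)) :
    totalLength x (E.map f.sym2Map) = totalLength (x ∘ f) E := by
  rw [totalLength, Finset.sum_map, totalLength]
  refine Finset.sum_congr rfl fun e _ => ?_
  induction e with | _ a b => rfl

variable [DecidableEq ι] [DecidableEq κ]

/-- The constant in the smoothness estimate for `spanLength k`. -/
def smoothConst (d k : ℕ) : ℝ := 4 * √d * (k : ℝ) ^ expo d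

theorem smoothConst_nonneg (d k : ℕ) : 0 ≤ smoothConst d k := by
  unfold smoothConst
  positivity

theorem rpow_expo_mono (hd : 2 ≤ d) {a b : ℕ} (h : a ≤ b) : (a : ℝ) ^ expo d ≤ (b : ℝ) ^ expo d :=
  Real.rpow_le_rpow (Nat.cast_nonneg _) (Nat.cast_le.2 h) (expo_pos hd).le

theorem le_smoothConst_mul (hd : 2 ≤ d) {k m j : ℕ} (h : m ≤ k * j) :
    4 * √d * (m : ℝ) ^ expo d ≤ smoothConst d k * (j : ℝ) ^ expo d := by
  have h1 := rpow_expo_mono hd h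
  rw [Nat.cast_mul, Real.mul_rpow (Nat.cast_nonneg _) (Nat.cast_nonneg _)] at h1
  rw [smoothConst, mul_assoc (4 * √(d : ℝ))]
  exact mul_le_mul_of_nonneg_left h1 (show 0 ≤ 4 * √(d : ℝ) by positivity)

/-- Restrict an optimal graph on `B` to `A`. Every component that remains contains a former
neighbour of a deleted vertex, and there are at most `k * |B \ A|` of those. -/
theorem spanLength_le_of_subset (hd : 2 ≤ d) {k : ℕ} (hk : 2 ≤ k) {A B : Finset ι}
    (hAB : A ⊆ B) {x : ι → Pt d} (hx : ∀ i ∈ B, x i ∈ cube d) :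
    spanLength k x A ≤ spanLength k x B + smoothConst d k * ((B \ A).card : ℝ) ^ expo d := by
  have hnn : 0 ≤ smoothConst d k * ((B \ A).card : ℝ) ^ expo d :=
    mul_nonneg (smoothConst_nonneg d k) (by positivity)
  rcases (B \ A).eq_empty_or_nonempty with hBA | ⟨y, hy⟩
  · rw [Finset.sdiff_eq_empty_iff_subset] at hBA
    rw [hAB.antisymm hBA] at hnn ⊢
    linarith
  classical
  obtain ⟨E, hE, hEl⟩ := exists_isSpanning_eq hk x B
  let E' := E.filter fun e => ∀ v ∈ e, v ∈ A
  have hE'E : E' ⊆ E := Finset.filter_subset _ _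
  let N : ι → Finset ι := fun y => A.filter fun v => s(v, y) ∈ E
  let R := (B \ A).biUnion N
  have hb : IsDegreeBounded k A E' := by
    refine ⟨fun a b hab => ?_, fun a b hab => hE.ne a b (hE'E hab),
      (hE.toIsDegreeBounded.subset hE'E).degree_le⟩
    exact (Finset.mem_filter.1 hab).2 a (by simp)
  -- Follow a walk from `A` to a deleted vertex: the last vertex before it first leaves `A` lies in
  -- `R`.
  have hcover : ∀ {v w : ι} (p : (SimpleGraph.fromEdgeSet (E : Set (Sym2 ι))).Walk v w),
      v ∈ A → w ∉ A → ∃ r ∈ R, Joined E' r v := by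
    intro v w p
    induction p with
    | nil => exact fun h h' => absurd h h'
    | @cons v c w hadj q ih =>
      intro hv hw
      rw [SimpleGraph.fromEdgeSet_adj] at hadj
      have hvc : s(v, c) ∈ E := by simpa using hadj.1
      by_cases hc : c ∈ A
      · obtain ⟨r, hr, hrc⟩ := ih hc hw
        refine ⟨r, hr, hrc.trans (Joined.of_mem (Finset.mem_filter.2 ⟨by rwa [Sym2.eq_swap], ?_⟩))⟩
        intro z hz
        rcases Sym2.mem_iff.1 hz with rfl | rfl
        · exact hc
        · exact hv
      · have hcB : c ∈ B := hE.mem c v (by rwa [Sym2.eq_swap])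
        exact ⟨v, Finset.mem_biUnion.2 ⟨c, Finset.mem_sdiff.2 ⟨hcB, hc⟩,
          Finset.mem_filter.2 ⟨hv, hvc⟩⟩, Joined.refl _ _⟩
  have hRA : R ⊆ A := Finset.biUnion_subset.2 fun y _ => Finset.filter_subset _ _
  have hN : ∀ y, (N y).card ≤ k := by
    intro y
    refine le_trans ?_ (hE.degree_le y)
    refine Finset.card_le_card_of_injOn (fun v => s(v, y)) (fun v hv => ?_) (fun v _ w _ h => ?_)
    · exact Finset.mem_coe.2 (Finset.mem_filter.2 ⟨(Finset.mem_filter.1 hv).2, by simp⟩)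
    · exact Sym2.congr_left.1 h
  have hR : R.card ≤ k * (B \ A).card := by
    rw [mul_comm]
    exact Finset.card_biUnion_le_card_mul _ _ _ fun y _ => hN y
  have h1 := spanLength_le_of_cover hd hk (fun i hi => hx i (hAB hi)) hb hRA (fun v hv => by
    rw [Finset.mem_sdiff] at hy
    obtain ⟨p⟩ := hE.joined v (hAB hv) y hy.1
    exact hcover p hv hy.2)
  have h2 := le_smoothConst_mul hd hR
  have h3 := totalLength_mono x hE'E
  linarith

/-- Take an optimal graph on `A` with the new points isolated. One vertex of `A` and the new points
represent all components, and `1 + j ≤ k * j` for `j ≥ 1`. -/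
theorem spanLength_le_of_superset (hd : 2 ≤ d) {k : ℕ} (hk : 2 ≤ k) {A B : Finset ι}
    (hAB : A ⊆ B) {x : ι → Pt d} (hx : ∀ i ∈ B, x i ∈ cube d) :
    spanLength k x B ≤ spanLength k x A + smoothConst d k * ((B \ A).card : ℝ) ^ expo d := by
  have hnn : 0 ≤ smoothConst d k * ((B \ A).card : ℝ) ^ expo d :=
    mul_nonneg (smoothConst_nonneg d k) (by positivity)
  rcases A.eq_empty_or_nonempty with rfl | ⟨a, ha⟩
  · rw [spanLength_empty, Finset.sdiff_empty, zero_add]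
    exact (spanLength_le_rpow hd hk hx).trans (le_smoothConst_mul hd (by nlinarith))
  rcases (B \ A).eq_empty_or_nonempty with hBA | hBA
  · rw [Finset.sdiff_eq_empty_iff_subset] at hBA
    rw [hAB.antisymm hBA] at hnn ⊢
    linarith
  obtain ⟨E, hE, hEl⟩ := exists_isSpanning_eq hk x A
  have hb : IsDegreeBounded k B E := ⟨fun u v h => hAB (hE.mem u v h), hE.ne, hE.degree_le⟩
  have h1 := spanLength_le_of_cover hd hk hx hb (R := insert a (B \ A))
    (Finset.insert_subset (hAB ha) Finset.sdiff_subset) (fun v hv => by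
      by_cases hvA : v ∈ A
      · exact ⟨a, Finset.mem_insert_self _ _, hE.joined a ha v hvA⟩
      · exact ⟨v, Finset.mem_insert_of_mem (Finset.mem_sdiff.2 ⟨hv, hvA⟩), Joined.refl _ _⟩)
  have hc := Finset.card_insert_le a (B \ A)
  have hp := hBA.card_pos
  have h2 := le_smoothConst_mul hd (show (insert a (B \ A)).card ≤ k * (B \ A).card by nlinarith)
  linarith

/-- The union of optimal graphs on the classes of `q` has one component per nonempty class, and
these are then connected. -/
theorem spanLength_le_sum_add (hd : 2 ≤ d) {k : ℕ} (hk : 2 ≤ k) {B : Finset ι}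
    {x : ι → Pt d} (hx : ∀ i ∈ B, x i ∈ cube d) (q : ι → κ) (S : Finset κ)
    (hq : ∀ i ∈ B, q i ∈ S) :
    spanLength k x B ≤ ∑ c ∈ S, spanLength k x (B.filter (q · = c)) +
      4 * √d * (S.card : ℝ) ^ expo d := by
  choose F hF hFl using fun c => exists_isSpanning_eq hk x (B.filter (q · = c))
  have hFq : ∀ c a b, s(a, b) ∈ F c → q a = c := fun c a b h =>
    (Finset.mem_filter.1 ((hF c).mem a b h)).2
  have hmemq : ∀ c e, e ∈ F c → ∀ v ∈ e, q v = c := by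
    intro c e he v hv
    obtain ⟨w, rfl⟩ := hv
    exact hFq c v w he
  let E := S.biUnion F
  have hb : IsDegreeBounded k B E := by
    refine ⟨fun a b hab => ?_, fun a b hab => ?_, fun v => ?_⟩
    · obtain ⟨c, -, hc⟩ := Finset.mem_biUnion.1 hab
      exact Finset.filter_subset _ _ ((hF c).mem a b hc)
    · obtain ⟨c, -, hc⟩ := Finset.mem_biUnion.1 hab
      exact (hF c).ne a b hc
    · refine le_trans (Finset.card_le_card ?_) ((hF (q v)).degree_le v)
      intro e he
      rw [Finset.mem_filter, Finset.mem_biUnion] at he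
      obtain ⟨⟨c, -, hc⟩, hv⟩ := he
      rw [Finset.mem_filter, hmemq c e hc v hv]
      exact ⟨hc, hv⟩
  have hlen : totalLength x E = ∑ c ∈ S, spanLength k x (B.filter (q · = c)) := by
    rw [totalLength, Finset.sum_biUnion]
    · exact Finset.sum_congr rfl fun c _ => hFl c
    · intro c _ c' _ hcc
      refine Finset.disjoint_left.2 fun e he he' => hcc ?_
      induction e with
      | _ a b => rw [← hFq c a b he, ← hFq c' a b he']
  let T := S.filter fun c => (B.filter (q · = c)).Nonempty
  have hT : ∀ c ∈ T, ∃ r, r ∈ B.filter (q · = c) := fun c hc => (Finset.mem_filter.1 hc).2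
  choose rep hrep using hT
  have h1 := spanLength_le_of_cover hd hk hx hb (R := T.attach.image fun c => rep c.1 c.2)
    (by
      intro r hr
      obtain ⟨c, -, rfl⟩ := Finset.mem_image.1 hr
      exact Finset.filter_subset _ _ (hrep c.1 c.2))
    (by
      intro v hv
      have hvf : v ∈ B.filter (q · = q v) := Finset.mem_filter.2 ⟨hv, rfl⟩
      have hc : q v ∈ T := Finset.mem_filter.2 ⟨hq v hv, v, hvf⟩
      refine ⟨rep (q v) hc, Finset.mem_image.2 ⟨⟨q v, hc⟩, Finset.mem_attach _ _, rfl⟩, ?_⟩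
      exact ((hF (q v)).joined _ (hrep _ hc) _ hvf).mono
        (Finset.subset_biUnion_of_mem F (hq v hv)))
  have hc : (T.attach.image fun c => rep c.1 c.2).card ≤ S.card :=
    Finset.card_image_le.trans (by rw [Finset.card_attach]; exact Finset.card_filter_le _ _)
  have h2 := mul_le_mul_of_nonneg_left (rpow_expo_mono hd hc) (show 0 ≤ 4 * √(d : ℝ) by positivity)
  linarith

theorem spanLength_eq_mul {k : ℕ} {B : Finset ι} {d' : ℕ} {x : ι → Pt d} {y : ι → Pt d'} {r : ℝ}
    (hr : 0 ≤ r) (h : ∀ i ∈ B, ∀ j ∈ B, dist (y i) (y j) = r * dist (x i) (x j)) :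
    spanLength k y B = r * spanLength k x B := by
  rw [spanLength, spanLength, Real.mul_iInf_of_nonneg hr]
  refine iInf_congr fun E => ?_
  rw [totalLength, totalLength, Finset.mul_sum]
  refine Finset.sum_congr rfl fun e he => ?_
  induction e with
  | _ a b =>
    exact h a (E.2.mem a b he) b (E.2.mem b a (by rwa [Sym2.eq_swap]))

theorem spanLength_congr {k : ℕ} {B : Finset ι} {x y : ι → Pt d} (h : ∀ i ∈ B, x i = y i) :
    spanLength k x B = spanLength k y B := by
  rw [spanLength_eq_mul (r := 1) zero_le_one (x := y), one_mul]
  intro i hi j hj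
  rw [h i hi, h j hj, one_mul]

theorem isSpanning_map_iff (f : κ ↪ ι) {k : ℕ} {B : Finset κ} {E : Finset (Sym2 κ)} :
    IsSpanning k (B.map f) (E.map f.sym2Map) ↔ IsSpanning k B E := by
  have hmem : ∀ a b, s(f a, f b) ∈ E.map f.sym2Map ↔ s(a, b) ∈ E := fun a b =>
    Finset.mem_map' f.sym2Map (a := s(a, b))
  have hex : ∀ a b, s(a, b) ∈ E.map f.sym2Map → ∃ u v, a = f u ∧ b = f v ∧ s(u, v) ∈ E := by
    intro a b hab
    obtain ⟨e, he, h⟩ := Finset.mem_map.1 hab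
    induction e with
    | _ u v =>
      rcases Sym2.eq_iff.1 (show s(f u, f v) = s(a, b) from h) with ⟨rfl, rfl⟩ | ⟨rfl, rfl⟩
      · exact ⟨u, v, rfl, rfl, he⟩
      · exact ⟨v, u, rfl, rfl, by rwa [Sym2.eq_swap]⟩
  have hdeg : ∀ v, edgeDegree (E.map f.sym2Map) (f v) = edgeDegree E v := by
    intro v
    rw [edgeDegree, Finset.filter_map, Finset.card_map, edgeDegree]
    congr 1
    refine Finset.filter_congr fun e _ => ?_
    change f v ∈ Sym2.map f e ↔ _
    rw [Sym2.mem_map]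
    exact ⟨fun ⟨a, ha, h⟩ => f.injective h ▸ ha, fun h => ⟨v, h, rfl⟩⟩
  constructor
  · intro h
    refine ⟨⟨fun a b hab => ?_, fun a b hab => ?_, fun v => ?_⟩, fun u hu v hv => ?_⟩
    · exact (Finset.mem_map' f).1 (h.mem _ _ ((hmem a b).2 hab))
    · exact fun hne => h.ne _ _ ((hmem a b).2 hab) (by rw [hne])
    · rw [← hdeg]; exact h.degree_le _
    · exact (joined_map_iff f E u v).1
        (h.joined _ (Finset.mem_map_of_mem f hu) _ (Finset.mem_map_of_mem f hv))
  · intro h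
    refine ⟨⟨fun a b hab => ?_, fun a b hab => ?_, fun v => ?_⟩, fun u hu v hv => ?_⟩
    · obtain ⟨u, v, rfl, rfl, huv⟩ := hex a b hab
      exact Finset.mem_map_of_mem f (h.mem u v huv)
    · obtain ⟨u, v, rfl, rfl, huv⟩ := hex a b hab
      exact fun hne => h.ne u v huv (f.injective hne)
    · by_cases hv : ∃ u, v = f u
      · obtain ⟨u, rfl⟩ := hv
        rw [hdeg]; exact h.degree_le _
      · have : edgeDegree (E.map f.sym2Map) v = 0 := by
          rw [edgeDegree, Finset.card_eq_zero, Finset.filter_eq_empty_iff]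
          rintro e he ⟨w, rfl⟩
          obtain ⟨u, -, hu, -⟩ := hex _ _ he
          exact hv ⟨u, hu⟩
        omega
    · obtain ⟨u, hu', rfl⟩ := Finset.mem_map.1 hu
      obtain ⟨v, hv', rfl⟩ := Finset.mem_map.1 hv
      exact (joined_map_iff f E u v).2 (h.joined u hu' v hv')

/-- Invariance under relabelling; it passes between point sets, initial segments of `ℕ`, and `Fin
n`. -/
theorem spanLength_map {k : ℕ} (hk : 2 ≤ k) (f : κ ↪ ι) (x : ι → Pt d) (B : Finset κ) :
    spanLength k x (B.map f) = spanLength k (x ∘ f) B := by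
  apply le_antisymm
  · obtain ⟨E, hE, hl⟩ := exists_isSpanning_eq hk (x ∘ f) B
    rw [← hl, ← totalLength_map]
    exact ((isSpanning_map_iff f).2 hE).spanLength_le x
  · obtain ⟨E, hE, hl⟩ := exists_isSpanning_eq hk x (B.map f)
    have hsub : E ⊆ B.sym2.map f.sym2Map := by
      refine hE.toIsDegreeBounded.subset_sym2.trans ?_
      rw [Finset.sym2_map]
    obtain ⟨F, -, rfl⟩ := Finset.subset_map_iff.1 hsub
    rw [← hl, totalLength_map]
    exact ((isSpanning_map_iff f).1 hE).spanLength_le _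

/-- The family of admissible graphs is finite and does not depend on the positions, so this is an
infimum of finitely many sums of distances. -/
theorem measurable_spanLength (k : ℕ) (B : Finset ι) :
    Measurable fun x : ι → Pt d => spanLength k x B := by
  refine Measurable.iInf fun E => Finset.measurable_sum _ fun e _ => ?_
  induction e with
  | _ a b => exact (measurable_pi_apply a).dist (measurable_pi_apply b)

end

/-! ### Identification of `mstDeg`, `mst` and `tsp` in terms of `spanLength` -/

section

variable {ι κ : Type*} {d : ℕ}

theorem graphLength_eq {X : Finset (Pt d)} (T : SimpleGraph X) [Fintype T.edgeSet] :
    graphLength T = totalLength (Subtype.val : X → Pt d) T.edgeFinset := by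
  rw [graphLength, totalLength]
  refine Finset.sum_congr (by ext; simp) fun e _ => ?_
  induction e with | _ a b => rfl

theorem graphLength_nonneg {X : Finset (Pt d)} (T : SimpleGraph X) : 0 ≤ graphLength T := by
  classical
  rw [graphLength_eq]
  exact totalLength_nonneg _ _

open scoped Classical in
theorem isSpanning_edgeFinset {V : Type*} [Fintype V] [DecidableEq V] {T : SimpleGraph V}
    (hT : T.Connected)
    {k : ℕ} (hk : ∀ v, T.degree v ≤ k) : IsSpanning k Finset.univ T.edgeFinset := by
  refine ⟨⟨fun a b _ => Finset.mem_univ a, fun a b hab => ?_, fun v => ?_⟩, fun u _ v _ => ?_⟩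
  · rw [SimpleGraph.mem_edgeFinset, SimpleGraph.mem_edgeSet] at hab
    exact hab.ne
  · have h := T.card_incidenceFinset_eq_degree v
    rw [SimpleGraph.incidenceFinset_eq_filter] at h
    refine le_trans (le_of_eq ?_) (hk v)
    rw [← h, edgeDegree]
  · have h := hT.preconnected u v
    rw [Joined, SimpleGraph.coe_edgeFinset, SimpleGraph.fromEdgeSet_edgeSet]
    exact h

open scoped Classical in
theorem exists_isTree_of_isSpanning {V : Type*} [Fintype V] [DecidableEq V] [Nonempty V] {k : ℕ}
    {E : Finset (Sym2 V)} (hE : IsSpanning k Finset.univ E) :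
    ∃ T : SimpleGraph V, T.IsTree ∧ (∀ v, T.degree v ≤ k) ∧ T.edgeFinset ⊆ E := by
  have hconn : (SimpleGraph.fromEdgeSet (E : Set (Sym2 V))).Connected :=
    { preconnected := fun u v => hE.joined u (Finset.mem_univ u) v (Finset.mem_univ v)
      nonempty := inferInstance }
  obtain ⟨T, hT, htree⟩ := hconn.exists_isTree_le
  have hsub : T.edgeFinset ⊆ E := by
    intro e he
    rw [SimpleGraph.mem_edgeFinset] at he
    have := SimpleGraph.edgeSet_mono hT he
    rw [SimpleGraph.edgeSet_fromEdgeSet] at this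
    exact this.1
  refine ⟨T, htree, fun v => ?_, hsub⟩
  rw [← SimpleGraph.card_incidenceFinset_eq_degree, SimpleGraph.incidenceFinset_eq_filter]
  exact (edgeDegree_mono hsub v).trans (hE.degree_le v)

/-- Passing from a connected graph to a spanning tree inside it increases neither length nor
degrees. -/
theorem mstDeg_eq_spanLength {k : ℕ} (hk : 2 ≤ k) {X : Finset (Pt d)} (hX : X.Nonempty) :
    mstDeg k X = spanLength k (Subtype.val : X → Pt d) Finset.univ := by
  classical
  have : Nonempty X := hX.to_subtype
  unfold mstDeg
  obtain ⟨E, hE, hl⟩ := exists_isSpanning_eq hk (Subtype.val : X → Pt d) Finset.univ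
  obtain ⟨T, hT, hdeg, hsub⟩ := exists_isTree_of_isSpanning hE
  apply le_antisymm
  · refine le_trans (csInf_le ⟨0, ?_⟩ ⟨T, hT, hdeg, rfl⟩) ?_
    · rintro _ ⟨T, -, -, rfl⟩
      exact graphLength_nonneg T
    · rw [← hl, graphLength_eq]
      exact totalLength_mono _ hsub
  · refine le_csInf ⟨_, T, hT, hdeg, rfl⟩ ?_
    rintro _ ⟨T, hT, hdeg, rfl⟩
    rw [graphLength_eq]
    exact (isSpanning_edgeFinset hT.connected hdeg).spanLength_le _

/-- A degree is always less than the number of vertices, so the bound `k` is vacuous. -/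
theorem mst_eq_mstDeg {X : Finset (Pt d)} {k : ℕ} (hk : X.card ≤ k) : mst X = mstDeg k X := by
  classical
  rw [mst, mstDeg]
  congr 1
  ext l
  refine ⟨fun ⟨T, hT, h⟩ => ⟨T, hT, fun v => ?_, h⟩, fun ⟨T, hT, _, h⟩ => ⟨T, hT, h⟩⟩
  have := T.degree_lt_card_verts v
  rw [Fintype.card_coe] at this
  exact this.le.trans hk

theorem mst_le_mstDeg {k : ℕ} (hk : 2 ≤ k) {X : Finset (Pt d)} (hX : X.Nonempty) :
    mst X ≤ mstDeg k X := by
  classical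
  have : Nonempty X := hX.to_subtype
  obtain ⟨E, hE, hl⟩ := exists_isSpanning_eq hk (Subtype.val : X → Pt d) Finset.univ
  obtain ⟨T, hT, hdeg, hsub⟩ := exists_isTree_of_isSpanning hE
  refine csInf_le_csInf ⟨0, ?_⟩ ⟨_, T, hT, hdeg, rfl⟩ fun l ⟨T, hT, _, h⟩ => ⟨T, hT, h⟩
  rintro _ ⟨T, -, rfl⟩
  exact graphLength_nonneg T

/-- A sequence of distinct vertices traces a connected graph with degrees at most two. -/
theorem isSpanning_path [DecidableEq ι] {m : ℕ} {y : Fin (m + 1) → ι} (hy : Function.Injective y) :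
    IsSpanning 2 (Finset.univ.image y)
      (Finset.univ.image fun i : Fin m => s(y i.castSucc, y i.succ)) := by
  set E := Finset.univ.image fun i : Fin m => s(y i.castSucc, y i.succ)
  have hmem : ∀ i : Fin m, s(y i.castSucc, y i.succ) ∈ E := fun i =>
    Finset.mem_image_of_mem _ (Finset.mem_univ i)
  have hj : ∀ j, Joined E (y 0) (y j) := by
    intro j
    induction j using Fin.induction with
    | zero => exact Joined.refl _ _
    | succ i ih => exact ih.trans (Joined.of_mem (hmem i))
  refine ⟨⟨fun a b hab => ?_, fun a b hab => ?_, fun v => ?_⟩, fun u hu v hv => ?_⟩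
  · obtain ⟨i, -, hi⟩ := Finset.mem_image.1 hab
    rcases Sym2.eq_iff.1 hi with ⟨rfl, -⟩ | ⟨-, rfl⟩ <;>
      exact Finset.mem_image_of_mem _ (Finset.mem_univ _)
  · obtain ⟨i, -, hi⟩ := Finset.mem_image.1 hab
    have hne : y i.castSucc ≠ y i.succ := fun h => (Fin.castSucc_lt_succ (i := i)).ne (hy h)
    rcases Sym2.eq_iff.1 hi with ⟨rfl, rfl⟩ | ⟨rfl, rfl⟩
    · exact hne
    · exact hne.symm
  · have hsub : E.filter (v ∈ ·) ⊆ (Finset.univ.filter fun i : Fin m => y i.castSucc = v).image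
        (fun i => s(y i.castSucc, y i.succ)) ∪ (Finset.univ.filter fun i : Fin m =>
          y i.succ = v).image (fun i => s(y i.castSucc, y i.succ)) := by
      intro e he
      obtain ⟨he, hv⟩ := Finset.mem_filter.1 he
      obtain ⟨i, -, rfl⟩ := Finset.mem_image.1 he
      rcases Sym2.mem_iff.1 hv with rfl | rfl
      · exact Finset.mem_union_left _ (Finset.mem_image_of_mem _ (by simp))
      · exact Finset.mem_union_right _ (Finset.mem_image_of_mem _ (by simp))
    refine (Finset.card_le_card hsub).trans ((Finset.card_union_le _ _).trans ?_)
    have h1 : ((Finset.univ.filter fun i : Fin m => y i.castSucc = v).image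
        (fun i => s(y i.castSucc, y i.succ))).card ≤ 1 := by
      refine Finset.card_image_le.trans (Finset.card_le_one.2 fun i hi j hj => ?_)
      rw [Finset.mem_filter] at hi hj
      exact Fin.castSucc_injective _ (hy (hi.2.trans hj.2.symm))
    have h2 : ((Finset.univ.filter fun i : Fin m => y i.succ = v).image
        (fun i => s(y i.castSucc, y i.succ))).card ≤ 1 := by
      refine Finset.card_image_le.trans (Finset.card_le_one.2 fun i hi j hj => ?_)
      rw [Finset.mem_filter] at hi hj
      exact Fin.succ_injective _ (hy (hi.2.trans hj.2.symm))
    omega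
  · obtain ⟨i, -, rfl⟩ := Finset.mem_image.1 hu
    obtain ⟨j, -, rfl⟩ := Finset.mem_image.1 hv
    exact (hj i).symm.trans (hj j)

/-- A connected graph with degrees at most two has a Hamiltonian path. -/
theorem IsSpanning.exists_path [DecidableEq ι] {B : Finset ι} (hB : B.Nonempty)
    {E : Finset (Sym2 ι)} (hE : IsSpanning 2 B E) :
    ∃ (m : ℕ) (y : Fin (m + 1) → ι), Function.Injective y ∧ Finset.univ.image y = B ∧
      ∀ i : Fin m, s(y i.castSucc, y i.succ) ∈ E := by
  classical
  set G := SimpleGraph.fromEdgeSet (E : Set (Sym2 ι)) with hG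
  have hadjE : ∀ {u v}, G.Adj u v → s(u, v) ∈ E := fun {u v} h => by
    rw [hG, SimpleGraph.fromEdgeSet_adj] at h
    simpa using h.1
  -- A longest path is Hamiltonian: an edge leaving it at an end would extend it, and one leaving it
  -- at an interior vertex would make the degree 3. By connectedness it then meets every vertex.
  let P : ℕ → Prop := fun n => ∃ a ∈ B, ∃ b, ∃ p : G.Walk a b, p.IsPath ∧ p.length = n
  have hsupp : ∀ {a b : ι} (p : G.Walk a b), a ∈ B → ∀ v ∈ p.support, v ∈ B :=
    fun p ha v hv => hE.toIsDegreeBounded.mem_of_joined ha ⟨p.takeUntil v hv⟩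
  have hbound : ∀ n, P n → n ≤ B.card := by
    rintro n ⟨a, ha, b, p, hp, rfl⟩
    have h1 : p.support.toFinset ⊆ B := fun v hv => hsupp p ha v (List.mem_toFinset.1 hv)
    have h2 := Finset.card_le_card h1
    rw [List.toFinset_card_of_nodup hp.support_nodup, SimpleGraph.Walk.length_support] at h2
    omega
  obtain ⟨a₀, ha₀⟩ := hB
  have hP0 : P 0 := ⟨a₀, ha₀, a₀, SimpleGraph.Walk.nil, SimpleGraph.Walk.IsPath.nil, rfl⟩
  obtain ⟨a, ha, b, p, hp, hpl⟩ : P (Nat.findGreatest P B.card) :=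
    Nat.findGreatest_spec (Nat.zero_le _) hP0
  have hmax : ∀ n, P n → n ≤ p.length := fun n hn => by
    rw [hpl]; exact Nat.le_findGreatest (hbound n hn) hn
  have hinj := hp.getVert_injOn
  have hclosed : ∀ i ≤ p.length, ∀ c, G.Adj (p.getVert i) c → c ∈ p.support := by
    intro i hi c hc
    by_contra hcs
    have hcB : c ∈ B := hE.mem c (p.getVert i) (by rw [Sym2.eq_swap]; exact hadjE hc)
    rcases Nat.eq_zero_or_pos i with rfl | hi0
    · rw [SimpleGraph.Walk.getVert_zero] at hc
      have := hmax (p.length + 1) ⟨c, hcB, b, SimpleGraph.Walk.cons hc.symm p,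
        hp.cons hcs, by simp⟩
      omega
    rcases hi.eq_or_lt with rfl | hil
    · rw [SimpleGraph.Walk.getVert_length] at hc
      have := hmax (p.length + 1) ⟨a, ha, c, p.concat hc, hp.concat hcs hc, by simp⟩
      omega
    · obtain ⟨j, rfl⟩ : ∃ j, i = j + 1 := ⟨i - 1, by omega⟩
      have h1 : G.Adj (p.getVert j) (p.getVert (j + 1)) := p.adj_getVert_succ (by omega)
      have h2 : G.Adj (p.getVert (j + 1)) (p.getVert (j + 1 + 1)) := p.adj_getVert_succ hil
      have hne : p.getVert j ≠ p.getVert (j + 1 + 1) := fun h => by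
        have := hinj (show j ≤ p.length by omega) (show j + 1 + 1 ≤ p.length by omega) h
        omega
      have hc1 : p.getVert j ≠ c := fun h => hcs (h ▸ p.getVert_mem_support j)
      have hc2 : p.getVert (j + 1 + 1) ≠ c := fun h => hcs (h ▸ p.getVert_mem_support _)
      have hsub : ({s(p.getVert (j + 1), p.getVert j), s(p.getVert (j + 1), p.getVert (j + 1 + 1)),
          s(p.getVert (j + 1), c)} : Finset (Sym2 ι)) ⊆ E.filter (p.getVert (j + 1) ∈ ·) := by
        intro e he
        simp only [Finset.mem_insert, Finset.mem_singleton] at he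
        rcases he with rfl | rfl | rfl
        · exact Finset.mem_filter.2 ⟨hadjE h1.symm, by simp⟩
        · exact Finset.mem_filter.2 ⟨hadjE h2, by simp⟩
        · exact Finset.mem_filter.2 ⟨hadjE hc, by simp⟩
      have hcard := (Finset.card_le_card hsub).trans (hE.degree_le _)
      rw [Finset.card_eq_three.2 ⟨_, _, _, ?_, ?_, ?_, rfl⟩] at hcard
      · omega
      · exact fun h => hne (Sym2.congr_right.1 h)
      · exact fun h => hc1 (Sym2.congr_right.1 h)
      · exact fun h => hc2 (Sym2.congr_right.1 h)
  have hall : ∀ {u v : ι} (q : G.Walk u v), u ∈ p.support → v ∈ p.support := by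
    intro u v q
    induction q with
    | nil => exact id
    | @cons u c v hadj q ih =>
      intro hu
      obtain ⟨i, rfl, hi⟩ := SimpleGraph.Walk.mem_support_iff_exists_getVert.1 hu
      exact ih (hclosed i hi c hadj)
  refine ⟨p.length, fun i => p.getVert i, fun i j hij => ?_, ?_, fun i => ?_⟩
  · exact Fin.ext (hinj (show (i : ℕ) ≤ p.length by omega) (show (j : ℕ) ≤ p.length by omega) hij)
  · ext v
    constructor
    · intro hv
      obtain ⟨i, -, rfl⟩ := Finset.mem_image.1 hv
      exact hsupp p ha _ (p.getVert_mem_support _)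
    · intro hv
      obtain ⟨q⟩ := hE.joined a ha v hv
      obtain ⟨i, rfl, hi⟩ := SimpleGraph.Walk.mem_support_iff_exists_getVert.1
        (hall q p.start_mem_support)
      exact Finset.mem_image.2 ⟨⟨i, by omega⟩, Finset.mem_univ _, rfl⟩
  · exact hadjE (p.adj_getVert_succ i.2)

theorem sum_finRotate {m n : ℕ} (h : n = m + 1) (y : Fin n → Pt d) :
    ∑ i, dist (y i) (y (finRotate n i)) =
      ∑ i : Fin m, dist (y (Fin.cast h.symm i.castSucc)) (y (Fin.cast h.symm i.succ)) +
        dist (y (Fin.cast h.symm (Fin.last m))) (y (Fin.cast h.symm 0)) := by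
  subst h
  rw [Fin.sum_univ_castSucc]
  congr 1
  · refine Finset.sum_congr rfl fun i _ => ?_
    rw [finRotate_apply, Fin.coeSucc_eq_succ]
    rfl
  · rw [finRotate_last]
    rfl

theorem dist_le_sqrt_of_mem_cube {u v : Pt d} (hu : u ∈ cube d) (hv : v ∈ cube d) :
    dist u v ≤ √d := by
  rw [EuclideanSpace.dist_eq]
  refine Real.sqrt_le_sqrt ?_
  calc ∑ l, dist (u l) (v l) ^ 2 ≤ ∑ _l : Fin d, (1 : ℝ) := by
        refine Finset.sum_le_sum fun l _ => ?_
        have h : |u l - v l| ≤ 1 := by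
          have h1 := hu l
          have h2 := hv l
          rw [abs_le]
          constructor <;> linarith [h1.1, h1.2, h2.1, h2.2]
        rw [Real.dist_eq]
        exact pow_le_one₀ (abs_nonneg _) h
    _ = d := by simp

/-- Omitting the closing edge of a tour leaves a spanning path. -/
theorem spanLength_two_le_tsp {X : Finset (Pt d)} (hX : X.Nonempty) :
    spanLength 2 (Subtype.val : X → Pt d) Finset.univ ≤ tsp X := by
  obtain ⟨m, hm⟩ : ∃ m, X.card = m + 1 := Nat.exists_eq_succ_of_ne_zero hX.card_pos.ne'
  refine le_csInf ⟨_, (Fintype.equivFinOfCardEq (Fintype.card_coe X)).symm, rfl⟩ ?_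
  rintro _ ⟨e, rfl⟩
  rw [sum_finRotate hm (fun i => (e i : Pt d))]
  have hs := isSpanning_path (y := fun i : Fin (m + 1) => e (Fin.cast hm.symm i))
    (e.injective.comp (Fin.cast_injective _))
  have himg : Finset.univ.image (fun i : Fin (m + 1) => e (Fin.cast hm.symm i)) = Finset.univ := by
    rw [Finset.eq_univ_iff_forall]
    intro v
    exact Finset.mem_image.2 ⟨Fin.cast hm (e.symm v), Finset.mem_univ _, by simp⟩
  rw [himg] at hs
  refine (hs.spanLength_le _).trans ?_
  refine (Finset.sum_image_le_of_nonneg ?_).trans ?_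
  · exact fun _ _ => edgeLength_nonneg _ _
  · exact le_add_of_nonneg_right dist_nonneg

/-- Close up the Hamiltonian path contained in an optimal graph; the closing edge is at most the
diameter of the cube. -/
theorem tsp_le_spanLength_two_add {X : Finset (Pt d)} (hX : X.Nonempty)
    (hc : ∀ v ∈ X, v ∈ cube d) :
    tsp X ≤ spanLength 2 (Subtype.val : X → Pt d) Finset.univ + √d := by
  have : Nonempty X := hX.to_subtype
  obtain ⟨E, hE, hl⟩ := exists_isSpanning_eq le_rfl (Subtype.val : X → Pt d) Finset.univ
  obtain ⟨m, y, hy, himg, hyE⟩ := hE.exists_path Finset.univ_nonempty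
  have hsurj : Function.Surjective y := fun v => by
    have : v ∈ Finset.univ.image y := by rw [himg]; exact Finset.mem_univ v
    simpa using this
  have hcard : X.card = m + 1 := by
    rw [← Fintype.card_coe X, ← Fintype.card_of_bijective ⟨hy, hsurj⟩, Fintype.card_fin]
  let e : Fin X.card ≃ X := (finCongr hcard).trans (Equiv.ofBijective y ⟨hy, hsurj⟩)
  have he : ∀ i : Fin (m + 1), e (Fin.cast hcard.symm i) = y i := fun i => rfl
  have h1 : tsp X ≤ ∑ i, dist (e i : Pt d) (e (finRotate X.card i) : Pt d) := by
    refine csInf_le ⟨0, ?_⟩ ⟨e, rfl⟩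
    rintro _ ⟨e, rfl⟩
    exact Finset.sum_nonneg fun _ _ => dist_nonneg
  rw [sum_finRotate hcard (fun i => (e i : Pt d))] at h1
  simp only [he] at h1
  have h2 : ∑ i : Fin m, dist (y i.castSucc : Pt d) (y i.succ : Pt d) ≤
      totalLength (Subtype.val : X → Pt d) E := by
    have hinj : Function.Injective fun i : Fin m => s(y i.castSucc, y i.succ) := by
      intro i j hij
      rcases Sym2.eq_iff.1 hij with ⟨h, -⟩ | ⟨h, h'⟩
      · exact Fin.castSucc_injective _ (hy h)
      · have h3 := congrArg Fin.val (hy h)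
        have h4 := congrArg Fin.val (hy h')
        simp at h3 h4
        omega
    have := totalLength_mono (Subtype.val : X → Pt d) (E := Finset.univ.image fun i : Fin m =>
      s(y i.castSucc, y i.succ)) (F := E) (by
        intro e he
        obtain ⟨i, -, rfl⟩ := Finset.mem_image.1 he
        exact hyE i)
    rwa [totalLength, Finset.sum_image (fun i _ j _ h => hinj h)] at this
  have h3 := dist_le_sqrt_of_mem_cube (hc _ (y (Fin.last m)).2) (hc _ (y 0).2)
  linarith

open scoped Classical in
theorem spanLength_image {k : ℕ} (hk : 2 ≤ k) [DecidableEq ι] (x : ι → Pt d) (B : Finset ι)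
    (hx : Set.InjOn x B) :
    spanLength k (Subtype.val : {v // v ∈ B.image x} → Pt d) Finset.univ =
      spanLength k x B := by
  have hex : ∀ v : {v // v ∈ B.image x}, ∃ i ∈ B, x i = v := fun v =>
    Finset.mem_image.1 v.2
  choose f hfB hf using hex
  have hfinj : Function.Injective f := fun u v h => Subtype.ext (by rw [← hf u, ← hf v, h])
  have hmap : Finset.univ.map ⟨f, hfinj⟩ = B := by
    ext i
    constructor
    · intro hi
      obtain ⟨v, -, rfl⟩ := Finset.mem_map.1 hi
      exact hfB v
    · intro hi
      refine Finset.mem_map.2 ⟨⟨x i, Finset.mem_image_of_mem x hi⟩, Finset.mem_univ _, ?_⟩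
      exact hx (hfB _) hi (hf _)
  have h := spanLength_map hk ⟨f, hfinj⟩ x Finset.univ
  rw [hmap] at h
  rw [h]
  congr 1
  funext v
  exact (hf v).symm

end

/-! ### McDiarmid's inequality -/

section

open ProbabilityTheory NNReal

theorem abs_sub_le_of_boundedDifferences {X : Type*} {n : ℕ} {h : (Fin n → X) → ℝ} {c : ℝ≥0}
    (hc : ∀ x i t, |h (Function.update x i t) - h x| ≤ c) (x y : Fin n → X) :
    |h y - h x| ≤ n * c := by
  suffices ∀ s : Finset (Fin n), |h (s.piecewise y x) - h x| ≤ s.card * c by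
    have h1 := this Finset.univ
    rwa [Finset.piecewise_univ, Finset.card_univ, Fintype.card_fin] at h1
  intro s
  induction s using Finset.induction_on with
  | empty => simp
  | insert i s hi ih =>
    rw [Finset.piecewise_insert, Finset.card_insert_of_notMem hi]
    have h1 := hc (s.piecewise y x) i (y i)
    calc _ ≤ |h (Function.update (s.piecewise y x) i (y i)) - h (s.piecewise y x)| +
          |h (s.piecewise y x) - h x| := abs_sub_le _ _ _
      _ ≤ c + s.card * c := add_le_add h1 ih
      _ = _ := by push_cast; ring

/-- **McDiarmid's inequality**: a function with bounded differences of independent, identically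
distributed variables is sub-Gaussian. -/
theorem hasSubgaussianMGF_of_boundedDifferences {X : Type*} [MeasurableSpace X] (ν : Measure X)
    [IsProbabilityMeasure ν] {n : ℕ} {h : (Fin n → X) → ℝ} (hm : Measurable h) {c : ℝ≥0}
    (hc : ∀ x i t, |h (Function.update x i t) - h x| ≤ c) :
    HasSubgaussianMGF (fun x => h x - ∫ y, h y ∂Measure.pi fun _ => ν) (n * c ^ 2)
      (Measure.pi fun _ => ν) := by
  obtain ⟨t₀⟩ : Nonempty X := nonempty_of_isProbabilityMeasure ν
  have hbdd : ∀ {n : ℕ} {h : (Fin n → X) → ℝ}, Measurable h →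
      (∀ x i t, |h (Function.update x i t) - h x| ≤ c) →
      Integrable h (Measure.pi fun _ => ν) := by
    intro n h hm hc
    refine Integrable.of_bound hm.aestronglyMeasurable (|h fun _ => t₀| + n * c)
      (ae_of_all _ fun x => ?_)
    rw [Real.norm_eq_abs]
    have h1 := abs_sub_le_of_boundedDifferences hc (fun _ => t₀) x
    have h2 := abs_sub_abs_le_abs_sub (h x) (h fun _ => t₀)
    linarith
  induction n with
  | zero =>
    have : (fun x => h x - ∫ y, h y ∂Measure.pi fun _ => ν) = fun _ => 0 := by
      funext x
      have : ∀ y, h y = h x := fun y => by rw [Subsingleton.elim y x]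
      simp [this]
    rw [this]
    simp
  | succ n ih =>
    set π := Measure.pi fun _ : Fin n => ν with hπ
    have hcons : Measurable fun z : X × (Fin n → X) => (Fin.cons z.1 z.2 : Fin (n + 1) → X) := by
      refine measurable_pi_lambda _ fun i => ?_
      refine Fin.cases ?_ (fun j => ?_) i
      · simp only [Fin.cons_zero]
        exact measurable_fst
      · simp only [Fin.cons_succ]
        exact (measurable_pi_apply j).comp measurable_snd
    have hH : Measurable fun z : X × (Fin n → X) => h (Fin.cons z.1 z.2) := hm.comp hcons
    -- Averaging out the first coordinate leaves a function of `n` coordinates with the same bounded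
    -- differences, to which the induction hypothesis applies.
    set g : (Fin n → X) → ℝ := fun y => ∫ t, h (Fin.cons t y) ∂ν with hg
    have hdt : ∀ t t' y, |h (Fin.cons t y) - h (Fin.cons t' y)| ≤ c := by
      intro t t' y
      have := hc (Fin.cons t' y) 0 t
      rwa [Fin.update_cons_zero] at this
    have hint : ∀ y, Integrable (fun t => h (Fin.cons t y)) ν := by
      intro y
      refine Integrable.of_bound
        (hH.comp (measurable_id.prodMk measurable_const)).aestronglyMeasurable
        (|h (Fin.cons t₀ y)| + c) (ae_of_all _ fun t => ?_)
      rw [Real.norm_eq_abs]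
      have h2 := abs_sub_abs_le_abs_sub (h (Fin.cons t y)) (h (Fin.cons t₀ y))
      linarith [hdt t t₀ y]
    have hgm : Measurable g := hH.stronglyMeasurable.integral_prod_left'.measurable
    have hgc : ∀ y i t, |g (Function.update y i t) - g y| ≤ c := by
      intro y i t
      rw [hg]
      simp only
      rw [← integral_sub (hint _) (hint _), ← Real.norm_eq_abs]
      refine (norm_integral_le_of_norm_le_const (C := c) (ae_of_all _ fun s => ?_)).trans ?_
      · rw [Real.norm_eq_abs, Fin.cons_update]
        exact hc _ _ _
      · simp
    have hg_sub := ih hgm hgc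
    have mp := measurePreserving_piFinSuccAbove (fun _ : Fin (n + 1) => ν) 0
    have hsymm : ⇑(MeasurableEquiv.piFinSuccAbove (fun _ : Fin (n + 1) => X) 0).symm =
        fun z => (Fin.cons z.1 z.2 : Fin (n + 1) → X) := by
      funext z
      exact Fin.insertNth_zero' z.1 z.2
    have mp' := mp.symm
    have hemb :=
      (MeasurableEquiv.piFinSuccAbove (fun _ : Fin (n + 1) => X) 0).symm.measurableEmbedding
    rw [hsymm] at mp' hemb
    have htransfer : ∀ f : (Fin (n + 1) → X) → ℝ,
        ∫ x, f x ∂(Measure.pi fun _ => ν) = ∫ z, f (Fin.cons z.1 z.2) ∂(ν.prod π) :=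
      fun f => (mp'.integral_comp hemb f).symm
    have hhint := hbdd hm hc
    have hHint : Integrable (fun z : X × (Fin n → X) => h (Fin.cons z.1 z.2)) (ν.prod π) :=
      (mp'.integrable_comp_emb hemb).2 hhint
    have hmean : ∫ x, h x ∂(Measure.pi fun _ => ν) = ∫ y, g y ∂π := by
      rw [htransfer, integral_prod_symm _ hHint]
    set M := ∫ y, g y ∂π with hM
    rw [hmean]
    have hexp_int : ∀ s : ℝ, Integrable (fun x => Real.exp (s * (h x - M)))
        (Measure.pi fun _ => ν) := by
      intro s
      refine Integrable.of_bound (by fun_prop)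
        (Real.exp (|s| * (|h (fun _ => t₀) - M| + (n + 1 : ℕ) * c))) (ae_of_all _ fun x => ?_)
      rw [Real.norm_eq_abs, abs_of_pos (Real.exp_pos _), Real.exp_le_exp]
      refine (le_abs_self _).trans ?_
      rw [abs_mul]
      refine mul_le_mul_of_nonneg_left ?_ (abs_nonneg _)
      have h1 := abs_sub_le_of_boundedDifferences hc (fun _ => t₀) x
      have h2 := abs_sub_le (h x) (h fun _ => t₀) M
      linarith
    refine ⟨hexp_int, fun s => ?_⟩
    rw [mgf, htransfer]
    have hI : Integrable (fun z : X × (Fin n → X) => Real.exp (s * (h (Fin.cons z.1 z.2) - M)))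
        (ν.prod π) :=
      (mp'.integrable_comp_emb hemb).2 (hexp_int s)
    rw [integral_prod_symm _ hI]
    -- For fixed `y` the values lie in an interval of length `2 * c` about the value at `t₀`, so
    -- Hoeffding's lemma gives the parameter `c ^ 2`. These parameters add up over the coordinates.
    have hinner : ∀ y, ∫ t, Real.exp (s * (h (Fin.cons t y) - M)) ∂ν ≤
        Real.exp (c ^ 2 * s ^ 2 / 2) * Real.exp (s * (g y - M)) := by
      intro y
      have hoeff := hasSubgaussianMGF_of_mem_Icc (μ := ν) (X := fun t => h (Fin.cons t y))
        (a := h (Fin.cons t₀ y) - c) (b := h (Fin.cons t₀ y) + c)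
        (hint y).aemeasurable (ae_of_all _ fun t => by
          have := abs_le.1 (hdt t t₀ y)
          exact ⟨by linarith, by linarith⟩)
      have h1 := hoeff.mgf_le s
      have h2 : ((‖h (Fin.cons t₀ y) + c - (h (Fin.cons t₀ y) - c)‖₊ / 2) ^ 2 : ℝ≥0) = c ^ 2 := by
        congr 1
        rw [← NNReal.coe_inj]
        push_cast
        rw [Real.norm_eq_abs, abs_of_nonneg] <;> [ring; (ring_nf; positivity)]
      rw [h2, mgf] at h1
      have h3 : ∀ t, Real.exp (s * (h (Fin.cons t y) - M)) =
          Real.exp (s * (h (Fin.cons t y) - g y)) * Real.exp (s * (g y - M)) := by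
        intro t
        rw [← Real.exp_add]
        congr 1
        ring
      simp_rw [h3]
      rw [integral_mul_const]
      refine mul_le_mul_of_nonneg_right ?_ (Real.exp_pos _).le
      simpa using h1
    calc ∫ y, ∫ t, Real.exp (s * (h (Fin.cons t y) - M)) ∂ν ∂π
        ≤ ∫ y, Real.exp (c ^ 2 * s ^ 2 / 2) * Real.exp (s * (g y - M)) ∂π :=
          integral_mono hI.integral_prod_right ((hg_sub.integrable_exp_mul s).const_mul _) hinner
      _ = Real.exp (c ^ 2 * s ^ 2 / 2) * mgf (fun y => g y - M) π s := by
          rw [integral_const_mul, mgf]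
      _ ≤ Real.exp (c ^ 2 * s ^ 2 / 2) * Real.exp ((n * c ^ 2 : ℝ≥0) * s ^ 2 / 2) :=
          mul_le_mul_of_nonneg_left (hg_sub.mgf_le s) (Real.exp_pos _).le
      _ = _ := by
          rw [← Real.exp_add]
          congr 1
          push_cast
          ring

theorem measureReal_abs_sub_ge_le {X : Type*} [MeasurableSpace X] (ν : Measure X)
    [IsProbabilityMeasure ν] {n : ℕ} {h : (Fin n → X) → ℝ} (hm : Measurable h) {c : ℝ≥0}
    (hc : ∀ x i t, |h (Function.update x i t) - h x| ≤ c) {ε : ℝ} (hε : 0 ≤ ε) :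
    (Measure.pi fun _ => ν).real {x | ε ≤ |h x - ∫ y, h y ∂Measure.pi fun _ => ν|} ≤
      2 * Real.exp (-ε ^ 2 / (2 * (n * c ^ 2))) := by
  have h1 := hasSubgaussianMGF_of_boundedDifferences ν hm hc
  have h2 := h1.measure_ge_le hε
  have h3 := h1.neg.measure_ge_le hε
  refine (measureReal_mono (s₂ := {x | ε ≤ h x - ∫ y, h y ∂Measure.pi fun _ => ν} ∪
    {x | ε ≤ (-fun x => h x - ∫ y, h y ∂Measure.pi fun _ => ν) x}) ?_).trans
      ((measureReal_union_le _ _).trans ?_)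
  · intro x hx
    rcases le_abs.1 (show ε ≤ |_| from hx) with h | h
    · exact Or.inl h
    · exact Or.inr h
  · push_cast at h2 h3
    linarith

end

/-! ### Lipschitz regularization of set functions and concentration of smooth functionals -/

section

open ProbabilityTheory NNReal

section Regularization

variable {α : Type*} [DecidableEq α] {F G : Finset α → ℝ} {c s : ℝ}

/-- Supremal convolution of a set function with `c` times the number of removed points. -/
def supConv (c : ℝ) (F : Finset α → ℝ) (A : Finset α) : ℝ :=
  A.powerset.sup' (Finset.powerset_nonempty A) fun B => F B - c * (A \ B).card

/-- Infimal convolution of a set function with `c` times the number of removed points. -/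
def infConv (c : ℝ) (F : Finset α → ℝ) (A : Finset α) : ℝ :=
  A.powerset.inf' (Finset.powerset_nonempty A) fun B => F B + c * (A \ B).card

/-- A regularization of a set function which changes by at most `c` when a point is added. -/
def lipReg (c : ℝ) (F : Finset α → ℝ) : Finset α → ℝ := infConv c (supConv c F)

theorem card_insert_sdiff {A B : Finset α} {a : α} (ha : a ∉ A) (hB : B ⊆ A) :
    ((insert a A \ B).card : ℝ) = (A \ B).card + 1 := by
  rw [Finset.insert_sdiff_of_notMem _ (fun h => ha (hB h)), Finset.card_insert_of_notMem
    (fun h => ha (Finset.mem_sdiff.1 h).1)]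
  push_cast
  ring

/-- A competitor for `A` competes for `insert a A` with one more removed point. This one-sided bound
is what makes the infimal convolution of `supConv c F` Lipschitz on both sides. -/
theorem supConv_le_insert (c : ℝ) (F : Finset α → ℝ) {A : Finset α} {a : α} (ha : a ∉ A) :
    supConv c F A ≤ supConv c F (insert a A) + c := by
  refine Finset.sup'_le _ _ fun B hB => ?_
  rw [Finset.mem_powerset] at hB
  have h := Finset.le_sup' (s := (insert a A).powerset)
    (fun B => F B - c * ((insert a A \ B).card : ℝ))
    (Finset.mem_powerset.2 (hB.trans (Finset.subset_insert a A)))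
  simp only [card_insert_sdiff ha hB] at h
  change _ ≤ supConv c F (insert a A) at h
  linarith

theorem le_supConv (c : ℝ) (F : Finset α → ℝ) (A : Finset α) : F A ≤ supConv c F A := by
  have h : F A - c * ((A \ A).card : ℝ) ≤ supConv c F A :=
    Finset.le_sup' (fun B => F B - c * ((A \ B).card : ℝ)) (Finset.mem_powerset_self A)
  rwa [Finset.sdiff_self, Finset.card_empty, Nat.cast_zero, mul_zero, sub_zero] at h

theorem infConv_le (c : ℝ) (F : Finset α → ℝ) (A : Finset α) : infConv c F A ≤ F A := by
  have h : infConv c F A ≤ F A + c * ((A \ A).card : ℝ) :=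
    Finset.inf'_le (fun B => F B + c * ((A \ B).card : ℝ)) (Finset.mem_powerset_self A)
  rwa [Finset.sdiff_self, Finset.card_empty, Nat.cast_zero, mul_zero, add_zero] at h

/-- The penalty `c * |A \ B|` absorbs the linear part of the oscillation, so no competitor in the
supremum exceeds `F A + s` and none in the infimum falls below `F A - s`. -/
theorem abs_lipReg_sub_le (h : ∀ A B, A ⊆ B → |F A - F B| ≤ s + c * (B \ A).card) (A : Finset α) :
    |lipReg c F A - F A| ≤ s := by
  rw [abs_le]
  constructor
  · suffices F A - s ≤ lipReg c F A by linarith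
    refine Finset.le_inf' (Finset.powerset_nonempty _) _ fun B hB => ?_
    have h1 := (abs_le.1 (h B A (Finset.mem_powerset.1 hB))).1
    have h2 := le_supConv c F B
    linarith
  · suffices supConv c F A ≤ F A + s by
      have := infConv_le c (supConv c F) A
      rw [lipReg]
      linarith
    refine Finset.sup'_le _ _ fun B hB => ?_
    have h1 := (abs_le.1 (h B A (Finset.mem_powerset.1 hB))).2
    linarith

/-- The increase is at most `c` because the same competitors remain with one more removed point. For
the decrease, a competitor `B` containing `a` is replaced by `B.erase a`, which `supConv_le_insert`
controls. -/
theorem abs_lipReg_insert_sub_le (hc : 0 ≤ c) (F : Finset α → ℝ) {A : Finset α} {a : α}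
    (ha : a ∉ A) : |lipReg c F (insert a A) - lipReg c F A| ≤ c := by
  rw [abs_le]
  constructor
  · suffices lipReg c F A - c ≤ lipReg c F (insert a A) by linarith
    refine Finset.le_inf' (Finset.powerset_nonempty _) _ fun B hB => ?_
    rw [Finset.mem_powerset] at hB
    by_cases haB : a ∈ B
    · have hBA : B.erase a ⊆ A := Finset.subset_insert_iff.1 hB
      have h1 := Finset.inf'_le (s := A.powerset)
        (fun B => supConv c F B + c * ((A \ B).card : ℝ)) (Finset.mem_powerset.2 hBA)
      change lipReg c F A ≤ _ at h1
      have h2 := supConv_le_insert c F (Finset.notMem_erase a B)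
      rw [Finset.insert_erase haB] at h2
      have h3 : A \ B.erase a = insert a A \ B := by
        ext z
        simp only [Finset.mem_sdiff, Finset.mem_erase, Finset.mem_insert]
        by_cases hz : z = a
        · subst hz
          simp [ha, haB]
        · simp [hz]
      rw [h3] at h1
      linarith
    · have hBA : B ⊆ A := (Finset.subset_insert_iff_of_notMem haB).1 hB
      have h1 := Finset.inf'_le (s := A.powerset)
        (fun B => supConv c F B + c * ((A \ B).card : ℝ)) (Finset.mem_powerset.2 hBA)
      change lipReg c F A ≤ _ at h1
      rw [card_insert_sdiff ha hBA]
      linarith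
  · suffices lipReg c F (insert a A) - c ≤ lipReg c F A by linarith
    refine Finset.le_inf' (Finset.powerset_nonempty _) _ fun B hB => ?_
    rw [Finset.mem_powerset] at hB
    have h1 := Finset.inf'_le (s := (insert a A).powerset)
      (fun B => supConv c F B + c * ((insert a A \ B).card : ℝ))
      (Finset.mem_powerset.2 (hB.trans (Finset.subset_insert a A)))
    change lipReg c F (insert a A) ≤ _ at h1
    rw [card_insert_sdiff ha hB] at h1
    linarith

theorem lipReg_congr {A : Finset α} (h : ∀ B ⊆ A, F B = G B) : lipReg c F A = lipReg c G A := by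
  have h1 : ∀ B ⊆ A, supConv c F B = supConv c G B := fun B hB =>
    Finset.sup'_congr _ rfl fun D hD => by
      rw [h D ((Finset.mem_powerset.1 hD).trans hB)]
  exact Finset.inf'_congr (Finset.powerset_nonempty _) rfl fun B hB => by
    rw [h1 B (Finset.mem_powerset.1 hB)]

theorem measurable_lipReg {X : Type*} [MeasurableSpace X] {F : X → Finset α → ℝ}
    (hF : ∀ A, Measurable fun x => F x A) (c : ℝ) (A : Finset α) :
    Measurable fun x => lipReg c (F x) A := by
  have h1 : ∀ A, Measurable fun x => supConv c (F x) A := by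
    intro A
    have : (fun x => supConv c (F x) A) = A.powerset.sup' (Finset.powerset_nonempty A)
        fun B x => F x B - c * ((A \ B).card : ℝ) := by
      ext x
      rw [supConv]
      exact (Finset.sup'_apply (C := fun _ : X => ℝ) (Finset.powerset_nonempty A)
        (fun B x => F x B - c * ((A \ B).card : ℝ)) x).symm
    rw [this]
    exact Finset.measurable_sup' _ fun B _ => (hF B).sub_const _
  have : (fun x => lipReg c (F x) A) = A.powerset.inf' (Finset.powerset_nonempty A)
      fun B x => supConv c (F x) B + c * ((A \ B).card : ℝ) := by
    ext x
    rw [lipReg, infConv]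
    exact (Finset.inf'_apply (C := fun _ : X => ℝ) (Finset.powerset_nonempty A)
      (fun B x => supConv c (F x) B + c * ((A \ B).card : ℝ)) x).symm
  rw [this]
  exact Finset.inf'_induction (p := fun f : X → ℝ => Measurable f) _ _
    (fun _ hf _ hg => hf.inf hg) fun B _ => (h1 B).add_const _

end Regularization

/-- Weighted bound of a concave power by an affine function. -/
theorem exists_rpow_le_affine {p C ε : ℝ} (hp : 0 < p) (hC : 0 ≤ C) (hε : 0 < ε) :
    ∃ Λ : ℝ, 0 < Λ ∧ ∀ n j : ℕ, 1 ≤ n → j ≤ n →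
      C * (j : ℝ) ^ p ≤ ε * (n : ℝ) ^ p + Λ * (n : ℝ) ^ (p - 1) * j := by
  -- With `r = j / n`, the constant term suffices for `r ≤ δ`, and for `r ≥ δ` the linear term does
  -- since `r ^ p ≤ 1`.
  obtain ⟨δ, hδ, hCδ⟩ : ∃ δ : ℝ, 0 < δ ∧ C * δ ^ p ≤ ε := by
    refine ⟨(ε / (C + 1)) ^ p⁻¹, by positivity, ?_⟩
    rw [Real.rpow_inv_rpow (by positivity) hp.ne', mul_div_assoc', div_le_iff₀ (by positivity)]
    nlinarith
  refine ⟨(C + 1) / δ, by positivity, fun n j hn hj => ?_⟩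
  have hn0 : (0 : ℝ) < n := by exact_mod_cast hn
  have hnp : 0 < (n : ℝ) ^ p := Real.rpow_pos_of_pos hn0 _
  set r : ℝ := j / n with hr
  have hr0 : 0 ≤ r := by positivity
  have hr1 : r ≤ 1 := by
    rw [hr, div_le_one hn0]
    exact_mod_cast hj
  have hjr : (j : ℝ) = n * r := by rw [hr]; field_simp
  have h1 : (n : ℝ) ^ (p - 1) * (n * r) = (n : ℝ) ^ p * r := by
    rw [Real.rpow_sub_one hn0.ne']
    field_simp
  rw [hjr, Real.mul_rpow hn0.le hr0, mul_assoc, h1]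
  suffices C * r ^ p ≤ ε + (C + 1) / δ * r by nlinarith
  rcases le_total r δ with h | h
  · have h2 : C * r ^ p ≤ C * δ ^ p :=
      mul_le_mul_of_nonneg_left (Real.rpow_le_rpow hr0 h hp.le) hC
    have h3 : 0 ≤ (C + 1) / δ * r := by positivity
    linarith
  · have h2 : r ^ p ≤ 1 := Real.rpow_le_one hr0 hr1 hp.le
    have h3 : (C + 1) ≤ (C + 1) / δ * r := by
      rw [div_mul_eq_mul_div, le_div_iff₀ hδ]
      exact mul_le_mul_of_nonneg_left h (by linarith)
    nlinarith

/-- Concentration for a smooth functional of independent, identically distributed points. -/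
theorem exists_concentration {p C ε : ℝ} (hp : 0 < p) (hC : 0 ≤ C) (hε : 0 < ε) :
    ∃ a : ℝ, 0 < a ∧ ∀ {X : Type} [MeasurableSpace X] (ν : Measure X) [IsProbabilityMeasure ν]
      (n : ℕ), 1 ≤ n → ∀ F : (Fin n → X) → Finset (Fin n) → ℝ,
      (∀ A, Measurable fun x => F x A) →
      (∀ x y A, (∀ i ∈ A, x i = y i) → F x A = F y A) →
      (∀ x A B, A ⊆ B → |F x A - F x B| ≤ C * ((B \ A).card : ℝ) ^ p) →
      (∀ x, F x ∅ = 0) →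
      (Measure.pi fun _ => ν).real {x | 3 * ε * (n : ℝ) ^ p ≤
        |F x Finset.univ - ∫ y, F y Finset.univ ∂Measure.pi fun _ => ν|} ≤
          2 * Real.exp (-a * n) := by
  obtain ⟨Λ, hΛ, hΛb⟩ := exists_rpow_le_affine hp hC hε
  -- With `s = ε n ^ p` and differences `2 c`, `c = Λ n ^ (p - 1)`, the McDiarmid exponent `s ^ 2 /
  -- (2 n (2 c) ^ 2)` equals `n ε ^ 2 / (8 Λ ^ 2)`: all powers of `n` but one cancel. In the
  -- threshold `3 s`, one `s` is the deviation of `h`, the other two replace `F` by `h` and the mean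
  -- of `F` by that of `h`.
  refine ⟨ε ^ 2 / (8 * Λ ^ 2), by positivity, fun {X} _ ν _ n hn F hFm hFl hFs hF0 => ?_⟩
  have hn0 : (0 : ℝ) < n := by exact_mod_cast hn
  set c : ℝ := Λ * (n : ℝ) ^ (p - 1) with hc
  have hc0 : 0 < c := by positivity
  set s : ℝ := ε * (n : ℝ) ^ p with hs
  set π := Measure.pi fun _ : Fin n => ν
  have hFa : ∀ x A B, A ⊆ B → |F x A - F x B| ≤ s + c * (B \ A).card := fun x A B hAB =>
    (hFs x A B hAB).trans (hΛb n _ hn (by simpa using Finset.card_le_univ (B \ A)))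
  set h : (Fin n → X) → ℝ := fun x => lipReg c (F x) Finset.univ with hh
  have hhm : Measurable h := measurable_lipReg hFm c _
  have hclose : ∀ x, |h x - F x Finset.univ| ≤ s := fun x => abs_lipReg_sub_le (hFa x) _
  -- Moving one point means removing it and inserting it elsewhere, at cost `c` each; without the
  -- point the two values agree.
  have hdiff : ∀ x i t, |h (Function.update x i t) - h x| ≤ (⟨2 * c, by positivity⟩ : ℝ≥0) := by
    intro x i t
    have hi : i ∉ Finset.univ.erase i := Finset.notMem_erase _ _
    have h1 := abs_lipReg_insert_sub_le hc0.le (F x) hi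
    have h2 := abs_lipReg_insert_sub_le hc0.le (F (Function.update x i t)) hi
    rw [Finset.insert_erase (Finset.mem_univ i)] at h1 h2
    have h3 : lipReg c (F (Function.update x i t)) (Finset.univ.erase i) =
        lipReg c (F x) (Finset.univ.erase i) :=
      lipReg_congr fun B hB => hFl _ _ _ fun j hj =>
        Function.update_of_ne (Finset.ne_of_mem_erase (hB hj)) _ _
    rw [h3] at h2
    change |_| ≤ 2 * c
    rw [abs_le] at h1 h2 ⊢
    constructor <;> simp only [hh] <;> linarith [h1.1, h1.2, h2.1, h2.2]
  have hFint : Integrable (fun x => F x Finset.univ) π := by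
    refine Integrable.of_bound (hFm _).aestronglyMeasurable (C * (n : ℝ) ^ p)
      (ae_of_all _ fun x => ?_)
    have := hFs x ∅ Finset.univ (Finset.empty_subset _)
    rw [hF0, zero_sub, abs_neg] at this
    simpa using this
  have hhint : Integrable h π := by
    refine Integrable.of_bound hhm.aestronglyMeasurable (C * (n : ℝ) ^ p + s)
      (ae_of_all _ fun x => ?_)
    have h1 := hFs x ∅ Finset.univ (Finset.empty_subset _)
    rw [hF0, zero_sub, abs_neg] at h1
    simp only [Finset.sdiff_empty, Finset.card_univ, Fintype.card_fin] at h1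
    have h2 := hclose x
    rw [Real.norm_eq_abs]
    have h3 := abs_sub_abs_le_abs_sub (h x) (F x Finset.univ)
    linarith
  have hmean : |(∫ x, h x ∂π) - ∫ x, F x Finset.univ ∂π| ≤ s := by
    rw [← integral_sub hhint hFint, ← Real.norm_eq_abs]
    refine (norm_integral_le_of_norm_le_const (C := s) (ae_of_all _ fun x => ?_)).trans (by simp)
    exact hclose x
  have hs0 : 0 ≤ s := by positivity
  have key := measureReal_abs_sub_ge_le ν hhm hdiff hs0
  refine (measureReal_mono ?_).trans (key.trans (le_of_eq ?_))
  · intro x hx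
    have hx' : 3 * ε * (n : ℝ) ^ p ≤ |F x Finset.univ - ∫ y, F y Finset.univ ∂π| := hx
    have h1 := hclose x
    change s ≤ |h x - ∫ y, h y ∂π|
    have h2 : |F x Finset.univ - ∫ y, F y Finset.univ ∂π| ≤ |F x Finset.univ - h x| +
        (|h x - ∫ y, h y ∂π| + |(∫ x, h x ∂π) - ∫ x, F x Finset.univ ∂π|) :=
      (abs_sub_le _ (h x) _).trans (by gcongr; exact abs_sub_le _ _ _)
    rw [abs_sub_comm] at h1
    have h3 : 3 * ε * (n : ℝ) ^ p = 3 * s := by rw [hs]; ring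
    linarith
  · congr 2
    change -s ^ 2 / (2 * (n * (2 * c) ^ 2)) = _
    have h1 : (n : ℝ) ^ p = n ^ (p - 1) * n := by
      rw [Real.rpow_sub_one hn0.ne']
      field_simp
    have h2 : 0 < (n : ℝ) ^ (p - 1) := Real.rpow_pos_of_pos hn0 _
    rw [hs, hc, h1]
    field_simp
    ring

end

/-! ### Product measures and the splitting of the uniform distribution into cells -/

section

open ProbabilityTheory NNReal ENNReal

theorem map_comp_infinitePi {X ι κ : Type*} [MeasurableSpace X] (ν : Measure X)
    [IsProbabilityMeasure ν] [Fintype κ] (f : κ ↪ ι) :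
    (Measure.infinitePi fun _ : ι => ν).map (fun x => x ∘ f) = Measure.pi fun _ : κ => ν := by
  classical
  refine (Measure.pi_eq fun s hs => ?_).symm
  have hmeas : Measurable fun x : ι → X => x ∘ f :=
    measurable_pi_lambda _ fun i => measurable_pi_apply (f i)
  rw [Measure.map_apply hmeas (MeasurableSet.univ_pi hs)]
  let t : ι → Set X := fun j => if h : ∃ i, f i = j then s h.choose else Set.univ
  have ht : ∀ i, t (f i) = s i := by
    intro i
    have h : ∃ i', f i' = f i := ⟨i, rfl⟩
    simp only [t, dif_pos h]
    rw [f.injective h.choose_spec]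
  have hpre : (fun x : ι → X => x ∘ f) ⁻¹' Set.univ.pi s =
      Set.pi (Finset.univ.map f : Finset ι) t := by
    ext x
    simp [Set.mem_pi, ht]
  rw [hpre, Measure.infinitePi_pi _ (fun j hj => ?_), Finset.prod_map]
  · simp_rw [ht]
  · obtain ⟨i, -, rfl⟩ := Finset.mem_map.1 hj
    rw [ht]
    exact hs i

theorem map_comp_pi {X : Type*} [MeasurableSpace X] (ν : Measure X) {ι κ : Type*}
    [IsProbabilityMeasure ν] [Fintype ι] [Fintype κ] (f : κ ↪ ι) :
    (Measure.pi fun _ : ι => ν).map (fun x => x ∘ f) = Measure.pi fun _ : κ => ν := by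
  rw [← map_comp_infinitePi ν f, Measure.infinitePi_eq_pi]

/-- A product of averages is an average of products. -/
theorem pi_sum_smul {X ι κ : Type*} [MeasurableSpace X] [Fintype ι] [DecidableEq ι] [Fintype κ]
    {ν : Measure X} [SigmaFinite ν] (c : ℝ≥0∞) (ρ : κ → Measure X) [∀ q, SigmaFinite (ρ q)]
    (h : ν = ∑ q, c • ρ q) :
    Measure.pi (fun _ : ι => ν) =
      ∑ σ : ι → κ, c ^ Fintype.card ι • Measure.pi fun i => ρ (σ i) := by
  refine (Measure.pi_eq fun s hs => ?_)
  rw [Measure.finsetSum_apply]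
  simp only [Measure.smul_apply, Measure.pi_pi, smul_eq_mul, h, Measure.finsetSum_apply]
  rw [Finset.prod_univ_sum, Fintype.piFinset_univ]
  refine Finset.sum_congr rfl fun σ _ => ?_
  rw [Finset.prod_mul_distrib, Finset.prod_const, Finset.card_univ]

/-- Half-open intervals make the `m` pieces an exact partition; changing the endpoint alters only a
null set. -/
theorem volume_restrict_Ico_eq_sum {m : ℕ} (hm : 1 ≤ m) :
    (volume : Measure ℝ).restrict (Set.Ico 0 1) = ∑ q : Fin m, (m : ℝ≥0∞)⁻¹ •
      ((volume : Measure ℝ).restrict (Set.Ico 0 1)).map fun u => ((q : ℝ) + u) * (m : ℝ)⁻¹ := by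
  have hm0 : (0 : ℝ) < m := by exact_mod_cast hm
  have hm' : (m : ℝ)⁻¹ ≠ 0 := by positivity
  ext s hs
  have hterm : ∀ q : ℕ, ((m : ℝ≥0∞)⁻¹ • ((volume : Measure ℝ).restrict (Set.Ico 0 1)).map
      fun u => ((q : ℝ) + u) * (m : ℝ)⁻¹) s =
        volume (s ∩ Set.Ico ((q : ℝ) / m) ((q + 1 : ℝ) / m)) := by
    intro q
    have hmeas : Measurable fun u : ℝ => ((q : ℝ) + u) * (m : ℝ)⁻¹ := by fun_prop
    rw [Measure.smul_apply, Measure.map_apply hmeas hs, Measure.restrict_apply (hmeas hs)]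
    have hset : (fun u : ℝ => ((q : ℝ) + u) * (m : ℝ)⁻¹) ⁻¹' s ∩ Set.Ico 0 1 =
        (fun u => (q : ℝ) + u) ⁻¹' ((fun v => (m : ℝ)⁻¹ * v) ⁻¹'
          (s ∩ Set.Ico ((q : ℝ) / m) ((q + 1 : ℝ) / m))) := by
      ext u
      simp only [Set.mem_inter_iff, Set.mem_preimage, Set.mem_Ico, mul_comm (m : ℝ)⁻¹,
        ← div_eq_mul_inv]
      rw [div_le_div_iff_of_pos_right hm0, div_lt_div_iff_of_pos_right hm0]
      constructor <;> rintro ⟨h1, h2, h3⟩ <;> exact ⟨h1, by linarith, by linarith⟩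
    rw [hset, measure_preimage_add, Real.volume_preimage_mul_left hm', inv_inv,
      abs_of_pos hm0, ENNReal.ofReal_natCast, smul_eq_mul, ← mul_assoc,
      ENNReal.inv_mul_cancel (by simp; omega) (ENNReal.natCast_ne_top m), one_mul]
  rw [Measure.finsetSum_apply, Finset.sum_congr rfl fun (q : Fin m) _ => hterm q,
    Fin.sum_univ_eq_sum_range (fun q : ℕ => volume (s ∩ Set.Ico ((q : ℝ) / m) ((q + 1 : ℝ) / m))) m]
  have hind : ∀ j : ℕ, ∑ q ∈ Finset.range j, volume (s ∩ Set.Ico ((q : ℝ) / m) ((q + 1 : ℝ) / m)) =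
      volume (s ∩ Set.Ico 0 ((j : ℝ) / m)) := by
    intro j
    induction j with
    | zero => simp
    | succ j ih =>
      have h1 : (0 : ℝ) ≤ (j : ℝ) / m := by positivity
      have h2 : (j : ℝ) / m ≤ ((j : ℝ) + 1) / m := by gcongr; linarith
      rw [Finset.sum_range_succ, ih, ← measure_union _ (hs.inter measurableSet_Ico),
        ← Set.inter_union_distrib_left, Set.Ico_union_Ico_eq_Ico h1 h2]
      · push_cast
        rfl
      · refine Set.disjoint_left.2 fun z hz hz' => ?_
        have h3 := hz.2.2
        have h4 := hz'.2.1
        linarith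
  rw [hind, div_self hm0.ne', Measure.restrict_apply hs]

/-- The affine map taking the unit cube to the subcube of side `1 / m` with index `Q`. -/
def cellMap {d m : ℕ} (Q : Fin d → Fin m) (u : Pt d) : Pt d :=
  WithLp.toLp 2 fun l => ((Q l : ℝ) + u l) * (m : ℝ)⁻¹

theorem measurable_cellMap {d m : ℕ} (Q : Fin d → Fin m) : Measurable (cellMap Q) := by
  unfold cellMap
  fun_prop

theorem dist_cellMap {d m : ℕ} (Q : Fin d → Fin m) (u v : Pt d) :
    dist (cellMap Q u) (cellMap Q v) = (m : ℝ)⁻¹ * dist u v := by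
  rw [EuclideanSpace.dist_eq, EuclideanSpace.dist_eq,
    ← Real.sqrt_sq (show 0 ≤ (m : ℝ)⁻¹ by positivity),
    ← Real.sqrt_mul (by positivity), Finset.mul_sum]
  congr 1
  refine Finset.sum_congr rfl fun l _ => ?_
  simp only [cellMap, Real.dist_eq, sq_abs]
  ring

theorem cellMap_mem_cube {d m : ℕ} (Q : Fin d → Fin m) {u : Pt d} (hu : u ∈ cube d) :
    cellMap Q u ∈ cube d := by
  intro l
  obtain ⟨h0, h1⟩ := hu l
  have hm : 0 < m := (Q l).pos
  have hm0 : (0 : ℝ) < m := by exact_mod_cast hm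
  have hq : ((Q l : ℕ) : ℝ) + 1 ≤ m := by exact_mod_cast (Q l).2
  change ((Q l : ℝ) + u l) * (m : ℝ)⁻¹ ∈ _
  rw [← div_eq_mul_inv]
  constructor
  · positivity
  · rw [div_le_one hm0]
    linarith

theorem uniformCube_eq_map (d : ℕ) : uniformCube d =
    (Measure.pi fun _ : Fin d => (volume : Measure ℝ).restrict (Set.Ico 0 1)).map
      (WithLp.toLp 2) := by
  have h1 : (Measure.pi fun _ : Fin d => (volume : Measure ℝ).restrict (Set.Ico 0 1)) =
      (volume : Measure (Fin d → ℝ)).restrict (Set.univ.pi fun _ => Set.Icc 0 1) := by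
    rw [volume_pi, Measure.restrict_pi_pi]
    congr 1
    funext _
    exact Measure.restrict_congr_set Ico_ae_eq_Icc
  have h2 : (Set.univ.pi fun _ : Fin d => Set.Icc (0 : ℝ) 1) = WithLp.toLp 2 ⁻¹' cube d := by
    ext x
    simp only [cube, Set.mem_univ_pi, Set.mem_preimage, Set.mem_ofPred_eq]
  rw [h1, h2, uniformCube]
  exact ((PiLp.volume_preserving_toLp (Fin d)).restrict_preimage_emb
    (MeasurableEquiv.toLp 2 (Fin d → ℝ)).measurableEmbedding (cube d)).map_eq.symm

/-- A uniform point is a uniformly chosen cell together with a uniform point inside it. -/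
theorem uniformCube_eq_sum (d : ℕ) {m : ℕ} (hm : 1 ≤ m) :
    uniformCube d =
      ∑ Q : Fin d → Fin m, ((m ^ d : ℕ) : ℝ≥0∞)⁻¹ • (uniformCube d).map (cellMap Q) := by
  have hmeas : ∀ q : Fin m, Measurable fun u : ℝ => ((q : ℝ) + u) * (m : ℝ)⁻¹ := fun q => by
    fun_prop
  set U := (volume : Measure ℝ).restrict (Set.Ico 0 1)
  have h1 := pi_sum_smul (ι := Fin d) (m : ℝ≥0∞)⁻¹
    (fun q : Fin m => U.map fun u => ((q : ℝ) + u) * (m : ℝ)⁻¹) (volume_restrict_Ico_eq_sum hm)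
  have htoLp : Measurable (WithLp.toLp 2 : (Fin d → ℝ) → Pt d) := by fun_prop
  conv_lhs => rw [uniformCube_eq_map, h1]
  rw [Measure.map_finset_sum' htoLp.aemeasurable]
  refine Finset.sum_congr rfl fun Q _ => ?_
  rw [Measure.map_smul, uniformCube_eq_map, Measure.map_map (measurable_cellMap Q) htoLp,
    ← Measure.pi_map_pi (fun i => (hmeas (Q i)).aemeasurable), Measure.map_map htoLp (by fun_prop)]
  congr 1
  rw [Fintype.card_fin, Nat.cast_pow, ENNReal.inv_pow]

theorem ae_mem_cube (d : ℕ) : ∀ᵐ u ∂uniformCube d, u ∈ cube d := by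
  refine ae_restrict_mem ?_
  have : cube d = ⋂ l, (fun x : Pt d => x l) ⁻¹' Set.Icc 0 1 := by
    ext x; simp [cube]
  rw [this]
  exact MeasurableSet.iInter fun l => measurableSet_Icc.preimage (by fun_prop)

theorem ae_forall_mem_cube (d n : ℕ) :
    ∀ᵐ x ∂Measure.pi fun _ : Fin n => uniformCube d, ∀ i, x i ∈ cube d :=
  ae_all_iff.2 fun i => (Measure.tendsto_eval_ae_ae (μ := fun _ : Fin n => uniformCube d)
    (i := i)).eventually (ae_mem_cube d)

theorem ae_forall_mem_cube' (d : ℕ) :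
    ∀ᵐ x ∂Measure.infinitePi fun _ : ℕ => uniformCube d, ∀ i, x i ∈ cube d :=
  ae_all_iff.2 fun i => (measurePreserving_eval_infinitePi (fun _ : ℕ => uniformCube d)
    i).quasiMeasurePreserving.tendsto_ae.eventually (ae_mem_cube d)

end

/-! ### Expected lengths and their approximate subadditivity -/

section

open ProbabilityTheory NNReal

variable {d k : ℕ}

/-- The expected value of `spanLength k` for `n` independent uniform points of the unit cube. -/
def meanLength (d k n : ℕ) : ℝ :=
  ∫ x, spanLength k x Finset.univ ∂Measure.pi fun _ : Fin n => uniformCube d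

theorem integrable_spanLength_comp (hd : 2 ≤ d) (hk : 2 ≤ k) {n : ℕ} {f : Fin n → Pt d → Pt d}
    (hf : ∀ i, Measurable (f i)) (hfc : ∀ i, ∀ u ∈ cube d, f i u ∈ cube d) (B : Finset (Fin n)) :
    Integrable (fun x => spanLength k (fun i => f i (x i)) B)
      (Measure.pi fun _ : Fin n => uniformCube d) := by
  refine Integrable.of_bound ((measurable_spanLength k B).comp
    (measurable_pi_lambda _ fun i => (hf i).comp (measurable_pi_apply i))).aestronglyMeasurable
    (4 * √d * (B.card : ℝ) ^ expo d) ?_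
  filter_upwards [ae_forall_mem_cube d n] with x hx
  rw [Real.norm_eq_abs, abs_of_nonneg (spanLength_nonneg _ _ _)]
  exact spanLength_le_rpow hd hk fun i _ => hfc i _ (hx i)

theorem integrable_spanLength (hd : 2 ≤ d) (hk : 2 ≤ k) {n : ℕ} (B : Finset (Fin n)) :
    Integrable (fun x => spanLength k x B) (Measure.pi fun _ : Fin n => uniformCube d) :=
  integrable_spanLength_comp hd hk (f := fun _ => id) (fun _ => measurable_id) (fun _ _ h => h) B

theorem meanLength_nonneg (d k n : ℕ) : 0 ≤ meanLength d k n :=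
  integral_nonneg fun _ => spanLength_nonneg _ _ _

theorem meanLength_le (hd : 2 ≤ d) (hk : 2 ≤ k) (n : ℕ) :
    meanLength d k n ≤ 4 * √d * (n : ℝ) ^ expo d := by
  have h := integral_mono_ae (integrable_spanLength hd hk Finset.univ) (integrable_const _)
    ((ae_forall_mem_cube d n).mono fun x hx => spanLength_le_rpow hd hk fun i _ => hx i)
  simpa [meanLength] using h

/-- The points are exchangeable, so only the number of chosen indices matters. -/
theorem integral_spanLength (hk : 2 ≤ k) {n : ℕ} (A : Finset (Fin n)) :
    ∫ x, spanLength k x A ∂(Measure.pi fun _ : Fin n => uniformCube d) = meanLength d k A.card := by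
  let f : Fin A.card ↪ Fin n := (A.orderEmbOfFin rfl).toEmbedding
  have hmap : Finset.univ.map f = A := by
    ext i
    rw [Finset.mem_map]
    constructor
    · rintro ⟨j, -, rfl⟩
      exact A.orderEmbOfFin_mem rfl j
    · intro hi
      have : i ∈ Set.range (A.orderEmbOfFin rfl) := by
        rw [Finset.range_orderEmbOfFin]
        exact hi
      obtain ⟨j, hj⟩ := this
      exact ⟨j, Finset.mem_univ j, hj⟩
  rw [meanLength, ← map_comp_pi (uniformCube d) f, integral_map]
  · refine integral_congr_ae (ae_of_all _ fun x => ?_)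
    have h := spanLength_map hk f x Finset.univ
    rw [hmap] at h
    exact h
  · exact (measurable_pi_lambda _ fun i => measurable_pi_apply (f i)).aemeasurable
  · exact (measurable_spanLength k _).aestronglyMeasurable

theorem meanLength_le_add (hd : 2 ≤ d) (hk : 2 ≤ k) (j K : ℕ) :
    meanLength d k j ≤ meanLength d k K + smoothConst d k * |(j : ℝ) - K| ^ expo d := by
  rcases le_total j K with h | h
  · obtain ⟨A, -, hA⟩ := Finset.exists_subset_card_eq (s := (Finset.univ : Finset (Fin K)))
      (n := j) (by simpa using h)
    have h1 := integral_mono_ae (integrable_spanLength hd hk A)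
      ((integrable_spanLength hd hk Finset.univ).add (integrable_const _))
      ((ae_forall_mem_cube d K).mono fun x hx =>
        spanLength_le_of_subset hd hk (Finset.subset_univ A) fun i _ => hx i)
    simp only [Pi.add_apply] at h1
    rw [integral_spanLength hk, integral_add (integrable_spanLength hd hk _) (integrable_const _),
      hA] at h1
    have h2 : ((Finset.univ \ A).card : ℝ) = |(j : ℝ) - K| := by
      rw [Finset.card_sdiff_of_subset (Finset.subset_univ A), hA, Finset.card_univ,
        Fintype.card_fin, Nat.cast_sub h, abs_of_nonpos (by simpa using h)]
      ring
    rw [h2] at h1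
    simpa [meanLength] using h1
  · obtain ⟨A, -, hA⟩ := Finset.exists_subset_card_eq (s := (Finset.univ : Finset (Fin j)))
      (n := K) (by simpa using h)
    have h1 := integral_mono_ae (integrable_spanLength hd hk Finset.univ)
      ((integrable_spanLength hd hk A).add (integrable_const _))
      ((ae_forall_mem_cube d j).mono fun x hx =>
        spanLength_le_of_superset hd hk (Finset.subset_univ A) fun i _ => hx i)
    simp only [Pi.add_apply] at h1
    rw [integral_add (integrable_spanLength hd hk _) (integrable_const _),
      integral_spanLength hk A, hA] at h1
    have h2 : ((Finset.univ \ A).card : ℝ) = |(j : ℝ) - K| := by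
      rw [Finset.card_sdiff_of_subset (Finset.subset_univ A), hA, Finset.card_univ,
        Fintype.card_fin, Nat.cast_sub h, abs_of_nonneg (by simpa using h)]
    rw [h2] at h1
    simpa [meanLength] using h1

/-- Conditioning on the cells: `σ` records the cell of each point, and all `σ` are equally likely.
-/
theorem meanLength_eq_sum (hd : 2 ≤ d) (hk : 2 ≤ k) (n : ℕ) {m : ℕ} (hm : 1 ≤ m) :
    meanLength d k n = ∑ σ : Fin n → Fin d → Fin m, (((m ^ d : ℕ) : ℝ)⁻¹) ^ n *
      ∫ u, spanLength k (fun i => cellMap (σ i) (u i)) Finset.univ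
        ∂(Measure.pi fun _ : Fin n => uniformCube d) := by
  have hprob : ∀ Q : Fin d → Fin m, IsProbabilityMeasure ((uniformCube d).map (cellMap Q)) :=
    fun Q => Measure.isProbabilityMeasure_map (measurable_cellMap Q).aemeasurable
  have hmap : ∀ σ : Fin n → Fin d → Fin m,
      Measure.pi (fun i => (uniformCube d).map (cellMap (σ i))) =
        (Measure.pi fun _ : Fin n => uniformCube d).map fun u i => cellMap (σ i) (u i) := fun σ =>
    (Measure.pi_map_pi fun i => (measurable_cellMap (σ i)).aemeasurable).symm
  have hmeas : ∀ σ : Fin n → Fin d → Fin m,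
      Measurable fun (u : Fin n → Pt d) i => cellMap (σ i) (u i) := fun σ =>
    measurable_pi_lambda _ fun i => (measurable_cellMap (σ i)).comp (measurable_pi_apply i)
  have hc : (((m ^ d : ℕ) : ENNReal)⁻¹) ≠ ⊤ := by
    rw [ENNReal.inv_ne_top, Nat.cast_ne_zero]
    positivity
  conv_lhs =>
    rw [meanLength, pi_sum_smul (ι := Fin n) _ _ (uniformCube_eq_sum d hm)]
  rw [integral_finsetSum_measure]
  · refine Finset.sum_congr rfl fun σ _ => ?_
    rw [integral_smul_measure, hmap, integral_map (hmeas σ).aemeasurable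
      (measurable_spanLength k _).aestronglyMeasurable, Fintype.card_fin]
    simp
  · intro σ _
    refine Integrable.smul_measure ?_ (ENNReal.pow_ne_top hc)
    rw [hmap]
    refine (integrable_map_measure (measurable_spanLength k _).aestronglyMeasurable
      (hmeas σ).aemeasurable).2 ?_
    exact integrable_spanLength_comp hd hk (fun i => measurable_cellMap (σ i))
      (fun i u hu => cellMap_mem_cube (σ i) hu) _

/-- The second moment of the number of balls in a fixed urn. -/
theorem sum_card_filter_sub_sq {κ : Type*} [Fintype κ] [DecidableEq κ] (c : κ) (n : ℕ) (a : ℝ) :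
    ∑ σ : Fin n → κ, (((Finset.univ.filter (σ · = c)).card : ℝ) - a) ^ 2 =
      (Fintype.card κ : ℝ) ^ n * ((n / Fintype.card κ - a) ^ 2 +
        n / Fintype.card κ * (1 - 1 / Fintype.card κ)) := by
  have hN : (Fintype.card κ : ℝ) ≠ 0 := by
    have : Nonempty κ := ⟨c⟩
    exact_mod_cast Fintype.card_ne_zero
  -- Conditioning on the first ball shifts the reference value `a`, which must therefore vary.
  induction n generalizing a with
  | zero => simp
  | succ n ih =>
    rw [← (Fin.consEquiv fun _ : Fin (n + 1) => κ).sum_comp, Fintype.sum_prod_type]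
    have hcard : ∀ (q : κ) (σ : Fin n → κ),
        ((Finset.univ.filter ((Fin.consEquiv fun _ : Fin (n + 1) => κ) (q, σ) · = c)).card : ℝ) =
          (if q = c then 1 else 0) + ((Finset.univ.filter (σ · = c)).card : ℝ) := by
      intro q σ
      rw [Finset.card_filter, Finset.card_filter, Fin.sum_univ_succ]
      push_cast
      rfl
    simp_rw [hcard]
    have h1 : ∀ q : κ, ∑ σ : Fin n → κ,
        ((if q = c then (1 : ℝ) else 0) + ((Finset.univ.filter (σ · = c)).card : ℝ) - a) ^ 2 =
          (Fintype.card κ : ℝ) ^ n * ((n / Fintype.card κ - (a - if q = c then 1 else 0)) ^ 2 +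
        n / Fintype.card κ * (1 - 1 / Fintype.card κ)) := by
      intro q
      rw [← ih]
      refine Finset.sum_congr rfl fun σ _ => ?_
      ring
    simp_rw [h1]
    rw [← Finset.mul_sum, Finset.sum_add_distrib, Finset.sum_const, Finset.card_univ, nsmul_eq_mul]
    have h2 : ∑ q : κ, ((n : ℝ) / Fintype.card κ - (a - if q = c then 1 else 0)) ^ 2 =
        ∑ q : κ, (((n : ℝ) / Fintype.card κ - a) ^ 2 +
          if q = c then 2 * ((n : ℝ) / Fintype.card κ - a) + 1 else 0) := by
      refine Finset.sum_congr rfl fun q _ => ?_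
      split_ifs <;> ring
    rw [h2, Finset.sum_add_distrib, Finset.sum_const, Finset.card_univ, nsmul_eq_mul,
      Finset.sum_ite_eq' Finset.univ c, if_pos (Finset.mem_univ c)]
    push_cast
    field_simp
    ring

/-- It reduces the `p`-th moment of a deviation to its second moment; `t` will be of the order of
the standard deviation. -/
theorem rpow_le_add_sq_mul {p t r : ℝ} (hp0 : 0 < p) (hp2 : p ≤ 2) (ht : 0 < t) (hr : 0 ≤ r) :
    r ^ p ≤ t ^ p + r ^ 2 * t ^ (p - 2) := by
  rcases le_total r t with h | h
  · have := Real.rpow_le_rpow hr h hp0.le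
    have : 0 ≤ r ^ 2 * t ^ (p - 2) := by positivity
    linarith
  · have hr' : 0 < r := ht.trans_le h
    have h1 : r ^ p = r ^ 2 * r ^ (p - 2) := by
      rw [← Real.rpow_natCast r 2, ← Real.rpow_add hr']
      congr 1
      push_cast
      ring
    have h2 : r ^ (p - 2) ≤ t ^ (p - 2) :=
      Real.rpow_le_rpow_of_nonpos ht h (by linarith)
    have : 0 ≤ t ^ p := by positivity
    rw [h1]
    nlinarith [sq_nonneg r]

theorem pow_rpow_expo (hd : 2 ≤ d) {m : ℕ} (hm : 1 ≤ m) :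
    ((m ^ d : ℕ) : ℝ) ^ expo d = (m : ℝ)⁻¹ * ((m ^ d : ℕ) : ℝ) := by
  have hm0 : (0 : ℝ) < m := by exact_mod_cast hm
  have hd0 : (d : ℝ) ≠ 0 := by positivity
  push_cast
  rw [← Real.rpow_natCast, ← Real.rpow_mul hm0.le, expo, mul_div_cancel₀ _ hd0,
    Real.rpow_sub_one hm0.ne']
  field_simp

/-- Build a graph in each of the `N = m ^ d` cells and join them. A cell is a copy of the cube
scaled by `1 / m`, which gives the factor `N / m = N ^ expo d`. Its number of points has mean `n /
N` and variance at most `n / N`; smoothness replaces that number by `K`. -/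
theorem meanLength_le_of_cells (hd : 2 ≤ d) (hk : 2 ≤ k) (n K : ℕ) {m : ℕ} (hm : 1 ≤ m) {t : ℝ}
    (ht : 0 < t) :
    meanLength d k n ≤ ((m ^ d : ℕ) : ℝ) ^ expo d * (meanLength d k K + smoothConst d k *
      (t ^ expo d + ((n / (m ^ d : ℕ) - K : ℝ) ^ 2 + n / (m ^ d : ℕ)) * t ^ (expo d - 2)) +
        4 * √d) := by
  set N : ℝ := ((m ^ d : ℕ) : ℝ) with hN
  set p := expo d with hp
  set C := smoothConst d k with hC
  have hC0 : 0 ≤ C := smoothConst_nonneg d k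
  have hcardN : (Fintype.card (Fin d → Fin m) : ℝ) = N := by simp [hN]
  have hN1 : 1 ≤ N := by
    rw [hN]
    exact_mod_cast Nat.one_le_pow _ _ hm
  have hN0 : 0 < N := by linarith
  have hm0 : (0 : ℝ) < m := by exact_mod_cast hm
  let cnt : (Fin n → Fin d → Fin m) → (Fin d → Fin m) → Finset (Fin n) := fun σ Q =>
    Finset.univ.filter (σ · = Q)
  have hσ : ∀ σ : Fin n → Fin d → Fin m,
      ∫ u, spanLength k (fun i => cellMap (σ i) (u i)) Finset.univ
        ∂(Measure.pi fun _ : Fin n => uniformCube d) ≤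
      ∑ Q, (m : ℝ)⁻¹ * (meanLength d k K + C * (t ^ p +
        (((cnt σ Q).card : ℝ) - K) ^ 2 * t ^ (p - 2))) + 4 * √d * N ^ p := by
    intro σ
    have h1 : ∀ᵐ u ∂(Measure.pi fun _ : Fin n => uniformCube d),
        spanLength k (fun i => cellMap (σ i) (u i)) Finset.univ ≤
          ∑ Q, (m : ℝ)⁻¹ * spanLength k u (cnt σ Q) + 4 * √d * N ^ p := by
      filter_upwards [ae_forall_mem_cube d n] with u hu
      have h := spanLength_le_sum_add hd hk (B := Finset.univ)
        (x := fun i => cellMap (σ i) (u i)) (fun i _ => cellMap_mem_cube (σ i) (hu i)) σ Finset.univ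
        (fun i _ => Finset.mem_univ _)
      rw [Finset.card_univ, hcardN] at h
      refine h.trans (le_of_eq ?_)
      congr 1
      refine Finset.sum_congr rfl fun Q _ => spanLength_eq_mul (by positivity) fun i hi j hj => ?_
      rw [(Finset.mem_filter.1 hi).2, (Finset.mem_filter.1 hj).2, dist_cellMap]
    have hint : ∀ Q, Integrable (fun u => (m : ℝ)⁻¹ * spanLength k u (cnt σ Q))
        (Measure.pi fun _ : Fin n => uniformCube d) := fun Q =>
      (integrable_spanLength hd hk (cnt σ Q)).const_mul _
    have h2 := integral_mono_ae (integrable_spanLength_comp hd hk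
      (fun i => measurable_cellMap (σ i)) (fun i u hu => cellMap_mem_cube (σ i) hu) Finset.univ)
      ((integrable_finsetSum _ fun Q _ => hint Q).add (integrable_const (4 * √d * N ^ p))) h1
    refine h2.trans ?_
    simp only [Pi.add_apply]
    rw [integral_add (integrable_finsetSum _ fun Q _ => hint Q) (integrable_const _),
      integral_finsetSum _ fun Q _ => hint Q]
    simp only [integral_const, probReal_univ, one_smul]
    gcongr with Q _
    rw [integral_const_mul, integral_spanLength hk]
    gcongr
    refine (meanLength_le_add hd hk _ K).trans ?_
    gcongr
    refine (rpow_le_add_sq_mul (expo_pos hd) (by linarith [expo_lt_one hd]) ht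
      (abs_nonneg _)).trans (le_of_eq ?_)
    rw [sq_abs]
  rw [meanLength_eq_sum hd hk n hm]
  have hNn : ∑ _σ : Fin n → Fin d → Fin m, (N⁻¹) ^ n = 1 := by
    rw [Finset.sum_const, Finset.card_univ, nsmul_eq_mul, Fintype.card_fun, Fintype.card_fin]
    push_cast
    rw [hcardN, ← mul_pow, mul_inv_cancel₀ hN0.ne', one_pow]
  set V : ℝ := (n / N - K) ^ 2 + n / N with hV
  calc _ ≤ ∑ σ : Fin n → Fin d → Fin m, (N⁻¹) ^ n * (∑ Q, (m : ℝ)⁻¹ * (meanLength d k K + C *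
        (t ^ p + (((cnt σ Q).card : ℝ) - K) ^ 2 * t ^ (p - 2))) + 4 * √d * N ^ p) := by
        gcongr with σ _
        exact hσ σ
    _ = ∑ Q : Fin d → Fin m, (m : ℝ)⁻¹ * (meanLength d k K + C * (t ^ p +
          (N⁻¹ ^ n * ∑ σ : Fin n → Fin d → Fin m, (((cnt σ Q).card : ℝ) - K) ^ 2) *
            t ^ (p - 2))) + 4 * √d * N ^ p := by
        have e1 : ∀ z : ℝ, ∑ _σ : Fin n → Fin d → Fin m, (N⁻¹) ^ n * z = z := fun z => by
          rw [← Finset.sum_mul, hNn, one_mul]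
        simp_rw [mul_add ((N⁻¹) ^ n)]
        rw [Finset.sum_add_distrib, e1]
        congr 1
        simp_rw [Finset.mul_sum]
        rw [Finset.sum_comm]
        refine Finset.sum_congr rfl fun Q _ => ?_
        -- The summand is affine in the squared deviation and the weights sum to 1, so averaging may
        -- be moved inside.
        rw [← e1 ((m : ℝ)⁻¹ * (meanLength d k K + C * (t ^ p + (∑ σ : Fin n → Fin d → Fin m,
          N⁻¹ ^ n * (((cnt σ Q).card : ℝ) - K) ^ 2) * t ^ (p - 2)))), ← sub_eq_zero,
          ← Finset.sum_sub_distrib]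
        have e2 : ∀ σ : Fin n → Fin d → Fin m, N⁻¹ ^ n * ((m : ℝ)⁻¹ * (meanLength d k K + C *
            (t ^ p + (((cnt σ Q).card : ℝ) - K) ^ 2 * t ^ (p - 2)))) -
            N⁻¹ ^ n * ((m : ℝ)⁻¹ * (meanLength d k K + C * (t ^ p +
            (∑ σ : Fin n → Fin d → Fin m, N⁻¹ ^ n * (((cnt σ Q).card : ℝ) - K) ^ 2) *
              t ^ (p - 2)))) = (N⁻¹ ^ n * (((cnt σ Q).card : ℝ) - K) ^ 2 - N⁻¹ ^ n *
            (∑ σ : Fin n → Fin d → Fin m, N⁻¹ ^ n * (((cnt σ Q).card : ℝ) - K) ^ 2)) *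
              ((m : ℝ)⁻¹ * C * t ^ (p - 2)) := fun σ => by ring
        simp_rw [e2]
        rw [← Finset.sum_mul, Finset.sum_sub_distrib, e1, sub_self, zero_mul]
    _ ≤ ∑ Q : Fin d → Fin m, (m : ℝ)⁻¹ * (meanLength d k K + C * (t ^ p + V * t ^ (p - 2))) +
          4 * √d * N ^ p := by
        gcongr with Q _
        change N⁻¹ ^ n * ∑ σ : Fin n → Fin d → Fin m,
          (((Finset.univ.filter (σ · = Q)).card : ℝ) - K) ^ 2 ≤ V
        rw [sum_card_filter_sub_sq, hcardN, ← mul_assoc, ← mul_pow, inv_mul_cancel₀ hN0.ne',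
          one_pow, one_mul, hV]
        gcongr
        have h3 : 0 ≤ (n : ℝ) / N := by positivity
        have h4 : 0 ≤ 1 / N := by positivity
        nlinarith
    _ = N * ((m : ℝ)⁻¹ * (meanLength d k K + C * (t ^ p + V * t ^ (p - 2)))) +
          4 * √d * N ^ p := by
        rw [Finset.sum_const, Finset.card_univ, nsmul_eq_mul, hcardN]
    _ = _ := by
        rw [hN, hp, pow_rpow_expo hd hm]
        ring

end

/-! ### Convergence of the means and the strong law -/

section

open ProbabilityTheory

variable {d k : ℕ}

/-- For each `K ≥ 1` the limsup is at most `a K + e K`; letting `K` grow bounds it by the liminf. -/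
theorem exists_tendsto_of_eventually_le {a e : ℕ → ℝ} {D : ℝ} (h0 : ∀ n, 0 ≤ a n)
    (hD : ∀ n, a n ≤ D) (he : Tendsto e atTop (𝓝 0))
    (h : ∀ K, 1 ≤ K → ∀ᶠ n in atTop, a n ≤ a K + e K) : ∃ β, Tendsto a atTop (𝓝 β) := by
  have hbu : IsBoundedUnder (· ≤ ·) atTop a := ⟨D, eventually_map.2 (Eventually.of_forall hD)⟩
  have hbl : IsBoundedUnder (· ≥ ·) atTop a := ⟨0, eventually_map.2 (Eventually.of_forall h0)⟩
  refine ⟨limsup a atTop, tendsto_of_le_liminf_of_limsup_le ?_ le_rfl hbu hbl⟩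
  refine le_of_forall_pos_le_add fun ε hε => ?_
  rw [← sub_le_iff_le_add]
  refine le_liminf_of_le hbu.isCoboundedUnder_ge ?_
  filter_upwards [he.eventually_lt_const hε, eventually_ge_atTop 1] with K hK hK1
  have := limsup_le_of_le hbl.isCoboundedUnder_le (h K hK1)
  linarith

/-- Cut the cube into cells holding about `K` points each. Relative to `K ^ p`, the fluctuation of
order `√K` in a cell costs `K ^ (-p/2)` and the joining costs `K ^ (-p)`. -/
theorem exists_tendsto_meanLength (hd : 2 ≤ d) (hk : 2 ≤ k) :
    ∃ β, Tendsto (fun n : ℕ => meanLength d k n / (n : ℝ) ^ expo d) atTop (𝓝 β) := by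
  have hp := expo_pos hd
  set p := expo d with hpdef
  set C := smoothConst d k
  have hC0 : 0 ≤ C := smoothConst_nonneg d k
  refine exists_tendsto_of_eventually_le (D := 4 * √d)
    (e := fun K : ℕ => 4 * C * (K : ℝ) ^ (-(p / 2)) + 4 * √d * (K : ℝ) ^ (-p))
    (fun n => div_nonneg (meanLength_nonneg d k n) (by positivity)) (fun n => ?_) ?_ fun K hK => ?_
  · exact div_le_of_le_mul₀ (by positivity) (by positivity) (meanLength_le hd hk n)
  · have h1 := (tendsto_rpow_neg_atTop (show 0 < p / 2 by positivity)).comp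
      (tendsto_natCast_atTop_atTop (R := ℝ))
    have h2 := (tendsto_rpow_neg_atTop hp).comp (tendsto_natCast_atTop_atTop (R := ℝ))
    simpa using (h1.const_mul (4 * C)).add (h2.const_mul (4 * √d))
  · have hK0 : (0 : ℝ) < K := by exact_mod_cast hK
    have hK1 : (1 : ℝ) ≤ K := by exact_mod_cast hK
    have hd0 : (0 : ℝ) < d := by positivity
    -- With this `m` one has `K ≤ n / m ^ d ≤ K * (1 + 1 / m) ^ d`, which is eventually at most `K +
    -- 1`.
    let m : ℕ → ℕ := fun n => ⌊((n : ℝ) / K) ^ (1 / d : ℝ)⌋₊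
    have hm : Tendsto m atTop atTop := tendsto_nat_floor_atTop.comp
      ((tendsto_rpow_atTop (show (0 : ℝ) < 1 / d by positivity)).comp
        (tendsto_natCast_atTop_atTop.atTop_div_const hK0))
    have hlim : Tendsto (fun n => (K : ℝ) * (1 + 1 / (m n : ℝ)) ^ d) atTop (𝓝 K) := by
      have h1 : Tendsto (fun n => (1 : ℝ) / (m n : ℝ)) atTop (𝓝 0) :=
        tendsto_one_div_atTop_nhds_zero_nat.comp hm
      simpa using ((h1.const_add 1).pow d).const_mul (K : ℝ)
    filter_upwards [hm.eventually_ge_atTop 1, hlim.eventually_le_const (lt_add_one (K : ℝ)),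
      eventually_ge_atTop 1] with n hmn hKn hn
    have hn0 : (0 : ℝ) < n := by exact_mod_cast hn
    have hm0 : (0 : ℝ) < m n := by exact_mod_cast hmn
    set N : ℝ := ((m n ^ d : ℕ) : ℝ) with hN
    have hNm : N = (m n : ℝ) ^ d := by rw [hN]; push_cast; rfl
    have hN0 : 0 < N := by rw [hNm]; positivity
    have hroot : (((n : ℝ) / K) ^ (1 / d : ℝ)) ^ d = n / K := by
      rw [← Real.rpow_natCast, ← Real.rpow_mul (by positivity), one_div_mul_cancel hd0.ne',
        Real.rpow_one]
    have hle : N * K ≤ n := by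
      rw [← le_div_iff₀ hK0, ← hroot, hNm]
      exact pow_le_pow_left₀ hm0.le (Nat.floor_le (by positivity)) d
    have hge : (n : ℝ) / N ≤ K + 1 := by
      refine le_trans ?_ hKn
      rw [div_le_iff₀ hN0, mul_assoc, hNm, ← mul_pow, ← div_le_iff₀' hK0, ← hroot]
      refine pow_le_pow_left₀ (by positivity) ?_ d
      have := (Nat.lt_floor_add_one (((n : ℝ) / K) ^ (1 / d : ℝ))).le
      refine this.trans (le_of_eq ?_)
      change (m n : ℝ) + 1 = _
      field_simp
    have hle' : (K : ℝ) ≤ n / N := by rwa [le_div_iff₀ hN0, mul_comm]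
    set t : ℝ := (K : ℝ) ^ (1 / 2 : ℝ) with ht
    have ht0 : 0 < t := by positivity
    have htK : t ^ (p - 2) = t ^ p / K := by
      rw [Real.rpow_sub ht0, ht, ← Real.rpow_mul hK0.le (1 / 2) 2]
      norm_num
    have htp : t ^ p = (K : ℝ) ^ (p / 2) := by
      rw [ht, ← Real.rpow_mul hK0.le]
      congr 1
      ring
    have hmain := meanLength_le_of_cells hd hk n K hmn ht0
    rw [← hN, ← hpdef] at hmain
    have hV : ((n / N - K : ℝ) ^ 2 + n / N) * t ^ (p - 2) ≤ 3 * t ^ p := by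
      have h1 : ((n / N - K : ℝ) ^ 2 + n / N) ≤ 3 * K := by nlinarith
      rw [htK]
      calc _ ≤ 3 * K * (t ^ p / K) := mul_le_mul_of_nonneg_right h1 (by positivity)
        _ = 3 * t ^ p := by field_simp
    have hfin : meanLength d k n ≤ N ^ p * (meanLength d k K + 4 * C * t ^ p + 4 * √d) := by
      refine hmain.trans (mul_le_mul_of_nonneg_left ?_ (by positivity))
      have := mul_le_mul_of_nonneg_left hV hC0
      linarith
    have hNK : N ^ p * (K : ℝ) ^ p ≤ (n : ℝ) ^ p := by
      rw [← Real.mul_rpow hN0.le hK0.le]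
      exact Real.rpow_le_rpow (by positivity) hle hp.le
    have hKp : 0 < (K : ℝ) ^ p := by positivity
    have hnp : 0 < (n : ℝ) ^ p := by positivity
    have hb := meanLength_nonneg d k K
    rw [div_le_iff₀ hnp]
    have e1 : meanLength d k K / (K : ℝ) ^ p + (4 * C * (K : ℝ) ^ (-(p / 2)) +
        4 * √d * (K : ℝ) ^ (-p)) = (meanLength d k K + 4 * C * t ^ p + 4 * √d) / (K : ℝ) ^ p := by
      have e2 : (K : ℝ) ^ (-(p / 2)) = t ^ p / (K : ℝ) ^ p := by
        rw [htp, ← Real.rpow_sub hK0]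
        congr 1
        ring
      rw [e2, Real.rpow_neg hK0.le]
      field_simp
      ring
    rw [e1, div_mul_eq_mul_div, le_div_iff₀ hKp]
    have hS : 0 ≤ meanLength d k K + 4 * C * t ^ p + 4 * √d := by positivity
    calc meanLength d k n * (K : ℝ) ^ p
        ≤ N ^ p * (meanLength d k K + 4 * C * t ^ p + 4 * √d) * (K : ℝ) ^ p :=
          mul_le_mul_of_nonneg_right hfin hKp.le
      _ = (meanLength d k K + 4 * C * t ^ p + 4 * √d) * (N ^ p * (K : ℝ) ^ p) := by ring
      _ ≤ _ := mul_le_mul_of_nonneg_left hNK hS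

/-- The coordinatewise projection to the unit cube. -/
def clamp (u : Pt d) : Pt d := WithLp.toLp 2 fun l => max 0 (min 1 (u l))

theorem measurable_clamp : Measurable (clamp : Pt d → Pt d) := by
  unfold clamp
  fun_prop

theorem clamp_mem_cube (u : Pt d) : clamp u ∈ cube d := fun _ =>
  ⟨le_max_left _ _, max_le zero_le_one (min_le_left _ _)⟩

theorem clamp_eq_self {u : Pt d} (hu : u ∈ cube d) : clamp u = u := by
  ext l
  obtain ⟨h0, h1⟩ := hu l
  simp [clamp, h0, h1]

theorem spanLength_range (hk : 2 ≤ k) (x : ℕ → Pt d) (n : ℕ) :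
    spanLength k x (Finset.range n) = spanLength k (x ∘ Fin.valEmbedding (n := n)) Finset.univ := by
  rw [← spanLength_map hk]
  congr 1
  ext i
  simp only [Finset.mem_range, Finset.mem_map, Finset.mem_univ, true_and]
  exact ⟨fun h => ⟨⟨i, h⟩, rfl⟩, fun ⟨j, hj⟩ => hj ▸ j.2⟩

/-- The exponential tail bounds are summable, so Borel–Cantelli applies. -/
theorem ae_eventually_abs_sub_lt (hd : 2 ≤ d) (hk : 2 ≤ k) {ε : ℝ} (hε : 0 < ε) :
    ∀ᵐ x ∂Measure.infinitePi fun _ : ℕ => uniformCube d, ∀ᶠ n : ℕ in atTop,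
      |spanLength k x (Finset.range n) - meanLength d k n| < 3 * ε * (n : ℝ) ^ expo d := by
  obtain ⟨a, ha, hconc⟩ := exists_concentration (expo_pos hd) (smoothConst_nonneg d k) hε
  -- The concentration lemma asks for smoothness at every configuration; clamping secures this and
  -- changes nothing on the cube, hence nothing almost surely.
  let F : ∀ n, (Fin n → Pt d) → Finset (Fin n) → ℝ := fun n x A =>
    spanLength k (fun i => clamp (x i)) A
  have hFm : ∀ n A, Measurable fun x => F n x A := fun n A =>
    (measurable_spanLength k A).comp (measurable_pi_lambda _ fun i =>
      measurable_clamp.comp (measurable_pi_apply i))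
  have hmean : ∀ n, ∫ y, F n y Finset.univ ∂(Measure.pi fun _ : Fin n => uniformCube d) =
      meanLength d k n := by
    intro n
    refine integral_congr_ae ?_
    filter_upwards [ae_forall_mem_cube d n] with x hx
    exact spanLength_congr fun i _ => clamp_eq_self (hx i)
  let T : ∀ n, Set (Fin n → Pt d) := fun n => {x | 3 * ε * (n : ℝ) ^ expo d ≤
    |F n x Finset.univ - meanLength d k n|}
  have hT : ∀ n, MeasurableSet (T n) := fun n =>
    measurableSet_le measurable_const ((hFm n _).sub_const _).abs
  have hTb : ∀ n, (Measure.pi fun _ : Fin n => uniformCube d) (T n) ≤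
      ENNReal.ofReal (2 * Real.exp (-a * n)) := by
    intro n
    rcases Nat.eq_zero_or_pos n with rfl | hn
    · refine prob_le_one.trans ?_
      simp
    · have h := hconc (uniformCube d) n hn (F n) (hFm n)
        (fun x y A hxy => spanLength_congr fun i hi => by rw [hxy i hi])
        (fun x A B hAB => by
          have h1 := spanLength_le_of_subset hd hk hAB (x := fun i => clamp (x i))
            (fun i _ => clamp_mem_cube (x i))
          have h2 := spanLength_le_of_superset hd hk hAB (x := fun i => clamp (x i))
            (fun i _ => clamp_mem_cube (x i))
          exact abs_sub_le_iff.2 ⟨sub_le_iff_le_add'.2 h1, sub_le_iff_le_add'.2 h2⟩)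
        (fun x => spanLength_empty k _)
      rw [hmean] at h
      rw [← ofReal_measureReal]
      exact ENNReal.ofReal_le_ofReal h
  let S : ℕ → Set (ℕ → Pt d) := fun n => (fun x => x ∘ Fin.valEmbedding (n := n)) ⁻¹' T n
  have hS : ∀ n, (Measure.infinitePi fun _ : ℕ => uniformCube d) (S n) ≤
      ENNReal.ofReal (2 * Real.exp (-a * n)) := by
    intro n
    have hmeas : Measurable fun x : ℕ → Pt d => x ∘ Fin.valEmbedding (n := n) :=
      measurable_pi_lambda _ fun i => measurable_pi_apply _
    rw [← Measure.map_apply hmeas (hT n), map_comp_infinitePi]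
    exact hTb n
  have hsum : Summable fun n : ℕ => 2 * Real.exp (-a * n) := by
    have := (Real.summable_exp_nat_mul_iff.2 (neg_neg_of_pos ha)).mul_left 2
    refine this.congr fun n => ?_
    rw [mul_comm (n : ℝ)]
  have hBC := ae_eventually_notMem (μ := Measure.infinitePi fun _ : ℕ => uniformCube d) (s := S)
    (ne_top_of_le_ne_top hsum.tsum_ofReal_ne_top (ENNReal.tsum_le_tsum hS))
  filter_upwards [hBC, ae_forall_mem_cube' d] with x hx hxc
  filter_upwards [hx] with n hn
  have h : ¬ (3 * ε * (n : ℝ) ^ expo d ≤ |F n (x ∘ Fin.valEmbedding) Finset.univ -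
    meanLength d k n|) := hn
  rw [not_le] at h
  rw [spanLength_range hk]
  have he : F n (x ∘ Fin.valEmbedding) Finset.univ =
      spanLength k (x ∘ Fin.valEmbedding) Finset.univ :=
    spanLength_congr fun i _ => clamp_eq_self (hxc _)
  rwa [he] at h

/-- The strong law for `spanLength k`. -/
theorem ae_tendsto_spanLength (hd : 2 ≤ d) (hk : 2 ≤ k) {β : ℝ}
    (hβ : Tendsto (fun n : ℕ => meanLength d k n / (n : ℝ) ^ expo d) atTop (𝓝 β)) :
    ∀ᵐ x ∂Measure.infinitePi fun _ : ℕ => uniformCube d,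
      Tendsto (fun n : ℕ => spanLength k x (Finset.range n) / (n : ℝ) ^ expo d) atTop (𝓝 β) := by
  have h := ae_all_iff.2 fun j : ℕ => ae_eventually_abs_sub_lt hd hk
    (show (0 : ℝ) < 1 / (3 * ((j : ℝ) + 1)) by positivity)
  filter_upwards [h] with x hx
  have hdiff : Tendsto (fun n : ℕ => spanLength k x (Finset.range n) / (n : ℝ) ^ expo d -
      meanLength d k n / (n : ℝ) ^ expo d) atTop (𝓝 0) := by
    rw [Metric.tendsto_atTop']
    intro ε hε
    obtain ⟨j, hj⟩ := exists_nat_one_div_lt hε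
    obtain ⟨M, hM⟩ := eventually_atTop.1 (hx j)
    refine ⟨M, fun n hn => ?_⟩
    have hn0 : (0 : ℝ) < n := by exact_mod_cast (by omega : 0 < n)
    have hnp : 0 < (n : ℝ) ^ expo d := Real.rpow_pos_of_pos hn0 _
    have h1 := hM n hn.le
    rw [Real.dist_eq, sub_zero, ← sub_div, abs_div, abs_of_pos hnp, div_lt_iff₀ hnp]
    refine h1.trans_le (mul_le_mul_of_nonneg_right ?_ hnp.le)
    refine le_trans (le_of_eq ?_) hj.le
    field_simp
  simpa using hdiff.add hβ

end

/-! ### From `spanLength` to the asymptotic constants -/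

section

open ProbabilityTheory

variable {d k : ℕ}

theorem uniformCube_sphere (hd : 2 ≤ d) (c : Pt d) (r : ℝ) :
    uniformCube d (Metric.sphere c r) = 0 := by
  have : Nonempty (Fin d) := ⟨⟨0, by omega⟩⟩
  refine le_antisymm ((Measure.restrict_apply_le _ _).trans ?_) zero_le
  rw [Measure.addHaar_sphere]

/-- For given `x i` and `x l`, equality confines `x j` to a sphere about `x i`, a null set. -/
theorem ae_dist_ne_dist (hd : 2 ≤ d) : ∀ᵐ x ∂Measure.infinitePi fun _ : ℕ => uniformCube d,
    ∀ i j l : ℕ, i ≠ j → i ≠ l → j ≠ l → dist (x i) (x j) ≠ dist (x i) (x l) := by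
  simp only [ae_all_iff]
  intro i j l hij hil hjl
  have hinj : Function.Injective ![j, i, l] := by
    intro a b hab
    fin_cases a <;> fin_cases b <;> simp_all
  let f : Fin 3 ↪ ℕ := ⟨![j, i, l], hinj⟩
  let S : Set (Fin 3 → Pt d) := {y | dist (y 1) (y 0) = dist (y 1) (y 2)}
  have hS : MeasurableSet S := measurableSet_eq_fun
    ((measurable_pi_apply 1).dist (measurable_pi_apply 0))
    ((measurable_pi_apply 1).dist (measurable_pi_apply 2))
  have hnull : (Measure.pi fun _ : Fin 3 => uniformCube d) S = 0 := by
    have mp := (measurePreserving_piFinSuccAbove (fun _ : Fin 3 => uniformCube d) 0).symm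
    rw [← mp.measure_preimage hS.nullMeasurableSet, Measure.prod_apply_symm (mp.measurable hS)]
    rw [lintegral_eq_zero_iff' (by exact
      (measurable_measure_prodMk_right (mp.measurable hS)).aemeasurable)]
    refine ae_of_all _ fun y => ?_
    refine measure_mono_null (t := Metric.sphere (y 0) (dist (y 0) (y 1))) ?_
      (uniformCube_sphere hd _ _)
    intro t ht
    have h : dist (y 0) t = dist (y 0) (y 1) := ht
    rw [Metric.mem_sphere, dist_comm]
    exact h
  have hmeas : Measurable fun x : ℕ → Pt d => x ∘ f :=
    measurable_pi_lambda _ fun a => measurable_pi_apply (f a)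
  rw [← map_comp_infinitePi (uniformCube d) f, Measure.map_apply hmeas hS] at hnull
  refine (measure_eq_zero_iff_ae_notMem.1 hnull).mono fun x hx h => hx ?_
  exact h

/-- Two coinciding points are equidistant from any third one, here the one with index `i + j + 1`.
-/
theorem injective_of_dist_ne_dist {x : ℕ → Pt d}
    (h : ∀ i j l : ℕ, i ≠ j → i ≠ l → j ≠ l → dist (x i) (x j) ≠ dist (x i) (x l)) :
    Function.Injective x := by
  intro i j hij
  by_contra hne
  refine h (i + j + 1) i j (by omega) (by omega) hne ?_
  rw [hij]

open scoped Classical in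
theorem mstDeg_image_range (hk : 2 ≤ k) {x : ℕ → Pt d} (hx : Function.Injective x) {n : ℕ}
    (hn : 1 ≤ n) : mstDeg k ((Finset.range n).image x) = spanLength k x (Finset.range n) := by
  rw [← spanLength_image hk x _ hx.injOn]
  have hne : ((Finset.range n).image x).Nonempty :=
    (Finset.nonempty_range_iff.2 (by omega)).image x
  rw [mstDeg_eq_spanLength hk hne]

theorem isAsymptoticConstant_mstDeg (hd : 2 ≤ d) (hk : 2 ≤ k) {β : ℝ}
    (h : ∀ᵐ x ∂Measure.infinitePi fun _ : ℕ => uniformCube d,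
      Tendsto (fun n : ℕ => spanLength k x (Finset.range n) / (n : ℝ) ^ expo d) atTop (𝓝 β)) :
    IsAsymptoticConstant d (mstDeg k) β := by
  filter_upwards [h, ae_dist_ne_dist hd] with x hx hne
  refine hx.congr' ?_
  filter_upwards [eventually_ge_atTop 1] with n hn
  rw [mstDeg_image_range hk (injective_of_dist_ne_dist hne) hn]
  rfl

theorem isAsymptoticConstant_tsp (hd : 2 ≤ d) {β : ℝ}
    (h : ∀ᵐ x ∂Measure.infinitePi fun _ : ℕ => uniformCube d,
      Tendsto (fun n : ℕ => spanLength 2 x (Finset.range n) / (n : ℝ) ^ expo d) atTop (𝓝 β)) :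
    IsAsymptoticConstant d tsp β := by
  classical
  filter_upwards [h, ae_dist_ne_dist hd, ae_forall_mem_cube' d] with x hx hne hc
  have hinj := injective_of_dist_ne_dist hne
  have hb : ∀ n : ℕ, 1 ≤ n → spanLength 2 x (Finset.range n) ≤ tsp ((Finset.range n).image x) ∧
      tsp ((Finset.range n).image x) ≤ spanLength 2 x (Finset.range n) + √d := by
    intro n hn
    have hX : ((Finset.range n).image x).Nonempty :=
      (Finset.nonempty_range_iff.2 (by omega)).image x
    have h1 := spanLength_two_le_tsp hX
    have h2 := tsp_le_spanLength_two_add hX (fun v hv => by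
      obtain ⟨i, -, rfl⟩ := Finset.mem_image.1 hv
      exact hc i)
    have h3 := spanLength_image le_rfl x (Finset.range n) hinj.injOn
    have h4 : spanLength 2 (Subtype.val : {v // v ∈ (Finset.range n).image x} → Pt d) Finset.univ =
      spanLength 2 x (Finset.range n) := by
      rw [← h3]
    constructor
    · rw [← h4]; exact h1
    · rw [← h4]; exact h2
  have hup : Tendsto (fun n : ℕ => spanLength 2 x (Finset.range n) / (n : ℝ) ^ expo d +
      √d * (n : ℝ) ^ (-expo d)) atTop (𝓝 β) := by
    have h2 := ((tendsto_rpow_neg_atTop (expo_pos hd)).comp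
      (tendsto_natCast_atTop_atTop (R := ℝ))).const_mul (√(d : ℝ))
    simpa using hx.add h2
  refine tendsto_of_tendsto_of_tendsto_of_le_of_le' hx hup ?_ ?_
  · filter_upwards [eventually_ge_atTop 1] with n hn
    have := (hb n hn).1
    change _ ≤ _ / (n : ℝ) ^ expo d
    refine (div_le_div_of_nonneg_right this (by positivity)).trans (le_of_eq ?_)
    congr!
  · filter_upwards [eventually_ge_atTop 1] with n hn
    have := (hb n hn).2
    change _ / (n : ℝ) ^ expo d ≤ _
    rw [Real.rpow_neg (Nat.cast_nonneg _), ← div_eq_mul_inv, ← add_div]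
    refine (le_of_eq ?_).trans (div_le_div_of_nonneg_right this (by positivity))
    congr!

/-! ### Strict kissing configurations and degrees of minimum spanning trees -/

section Kissing

variable {ι : Type*} [DecidableEq ι]

/-- Scaled by `2 + ε`, the balls are disjoint once `2 (1 + ε) < (2 + ε) * dist`. This is strict at
`ε = 0`, so by continuity it persists for small `ε`, simultaneously for the finitely many pairs. -/
theorem hasStrictKissingConfiguration_of_unit {K : ℕ} {c : Fin K → Pt d} (hc : ∀ i, ‖c i‖ = 1)
    (h : ∀ i j, i ≠ j → 1 < dist (c i) (c j)) : HasStrictKissingConfiguration d K := by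
  have hev : ∀ᶠ ε in 𝓝[>] (0 : ℝ), ∀ i j : Fin K, i ≠ j →
      2 * (1 + ε) < (2 + ε) * dist (c i) (c j) := by
    simp only [eventually_all]
    intro i j hij
    have h1 : ContinuousAt (fun ε : ℝ => (2 + ε) * dist (c i) (c j) - 2 * (1 + ε)) 0 := by fun_prop
    have h2 := (h1.eventually (lt_mem_nhds (a := 0) (by
      have := h i j hij
      simp only [add_zero]
      linarith))).filter_mono (nhdsWithin_le_nhds (s := Set.Ioi 0))
    exact h2.mono fun ε hε => by linarith
  obtain ⟨ε, hε, hε0⟩ := (hev.and self_mem_nhdsWithin).exists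
  have hε0 : 0 < ε := hε0
  refine ⟨ε, hε0, fun i => (2 + ε) • c i, fun i => ?_, fun i j hij => ?_⟩
  · rw [dist_zero_right, norm_smul, hc, Real.norm_of_nonneg (by positivity)]
    ring
  · refine Metric.closedBall_disjoint_closedBall ?_
    rw [dist_smul₀, Real.norm_of_nonneg (by positivity)]
    linarith [hε i j hij]

/-- Two opposite unit vectors and one orthogonal to them are at mutual distances 2 and `√2`. -/
theorem three_le_strictKissingNumber (hd : 2 ≤ d) : 3 ≤ strictKissingNumber d := by
  refine (isGreatest_strictKissingNumber d).2 ?_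
  set a : Pt d := EuclideanSpace.single ⟨0, by omega⟩ 1 with ha
  set b : Pt d := EuclideanSpace.single ⟨1, by omega⟩ 1 with hb
  have hna : ‖a‖ = 1 := by simp [ha]
  have hnb : ‖b‖ = 1 := by simp [hb]
  have hab : inner ℝ a b = 0 := by
    rw [ha, hb, EuclideanSpace.inner_single_left]
    simp
  have h1 : 1 < dist a b := by
    rw [dist_eq_norm]
    have := norm_sub_sq_real a b
    rw [hab, hna, hnb] at this
    nlinarith [norm_nonneg (a - b)]
  have h2 : 1 < dist (-a) b := by
    rw [dist_eq_norm]
    have := norm_sub_sq_real (-a) b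
    rw [inner_neg_left, hab, norm_neg, hna, hnb] at this
    nlinarith [norm_nonneg (-a - b)]
  have h3 : 1 < dist a (-a) := by
    rw [dist_eq_norm, sub_neg_eq_add, ← two_smul ℝ, norm_smul, hna]
    norm_num
  refine hasStrictKissingConfiguration_of_unit (c := ![a, -a, b]) (fun i => ?_) fun i j hij => ?_
  · fin_cases i <;> simp [hna, hnb]
  · fin_cases i <;> fin_cases j <;> first | exact absurd rfl hij | skip
    · exact h3
    · exact h1
    · change 1 < dist (-a) a
      rw [dist_comm]; exact h3
    · exact h2
    · change 1 < dist b a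
      rw [dist_comm]; exact h1
    · change 1 < dist b (-a)
      rw [dist_comm]; exact h2

/-- In the triangle `0, a, b` the side `ab` is strictly the longest, so the angle at `0` exceeds
60°. -/
theorem one_lt_dist_normalize {a b : Pt d} (ha : ‖a‖ < dist a b) (hb : ‖b‖ < dist a b)
    (ha0 : a ≠ 0) (hb0 : b ≠ 0) : 1 < dist (‖a‖⁻¹ • a) (‖b‖⁻¹ • b) := by
  have hna := norm_pos_iff.2 ha0
  have hnb := norm_pos_iff.2 hb0
  rw [dist_eq_norm] at *
  have h1 := norm_sub_sq_real a b
  have h2 := norm_sub_sq_real (‖a‖⁻¹ • a) (‖b‖⁻¹ • b)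
  have e1 : ∀ {v : Pt d}, 0 < ‖v‖ → ‖‖v‖⁻¹ • v‖ = 1 := fun {v} hv => by
    rw [norm_smul, norm_inv, norm_norm, inv_mul_cancel₀ hv.ne']
  rw [e1 hna, e1 hnb, real_inner_smul_left, real_inner_smul_right] at h2
  have h3 : 2 * inner ℝ a b < ‖a‖ * ‖b‖ := by
    rcases le_total ‖a‖ ‖b‖ with h | h
    · have : ‖b‖ ^ 2 < ‖a - b‖ ^ 2 := pow_lt_pow_left₀ hb hnb.le two_ne_zero
      nlinarith
    · have : ‖a‖ ^ 2 < ‖a - b‖ ^ 2 := pow_lt_pow_left₀ ha hna.le two_ne_zero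
      nlinarith
  have h4 : 2 * (‖a‖⁻¹ * (‖b‖⁻¹ * inner ℝ a b)) < 1 := by
    have : ‖a‖⁻¹ * ‖b‖⁻¹ * (2 * inner ℝ a b) < ‖a‖⁻¹ * ‖b‖⁻¹ * (‖a‖ * ‖b‖) :=
      mul_lt_mul_of_pos_left h3 (by positivity)
    have e2 : ‖a‖⁻¹ * ‖b‖⁻¹ * (‖a‖ * ‖b‖) = 1 := by field_simp
    rw [e2] at this
    linarith
  nlinarith [norm_nonneg (‖a‖⁻¹ • a - ‖b‖⁻¹ • b)]

theorem card_le_strictKissingNumber {α : Type*} {s : Finset α} {y : α → Pt d} (h0 : ∀ i ∈ s, y i ≠ 0)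
    (h : ∀ i ∈ s, ∀ j ∈ s, i ≠ j → ‖y i‖ < dist (y i) (y j)) :
    s.card ≤ strictKissingNumber d := by
  refine (isGreatest_strictKissingNumber d).2 ?_
  let e := s.equivFin.symm
  refine hasStrictKissingConfiguration_of_unit
    (c := fun i => ‖y (e i)‖⁻¹ • y (e i)) (fun i => ?_) fun i j hij => ?_
  · rw [norm_smul, norm_inv, norm_norm, inv_mul_cancel₀ (norm_ne_zero_iff.2 (h0 _ (e i).2))]
  · have hne : (e i : α) ≠ e j := fun h => hij (e.injective (Subtype.ext h))
    refine one_lt_dist_normalize (h _ (e i).2 _ (e j).2 hne) ?_ (h0 _ (e i).2) (h0 _ (e j).2)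
    rw [dist_comm]
    exact h _ (e j).2 _ (e i).2 hne.symm

theorem edgeDegree_eq_card {B : Finset ι} {E : Finset (Sym2 ι)} (hE : ∀ a b, s(a, b) ∈ E → a ∈ B)
    (v : ι) : edgeDegree E v = (B.filter fun u => s(v, u) ∈ E).card := by
  have : E.filter (v ∈ ·) = (B.filter fun u => s(v, u) ∈ E).image fun u => s(v, u) := by
    ext e
    simp only [Finset.mem_filter, Finset.mem_image]
    constructor
    · rintro ⟨he, u, rfl⟩
      exact ⟨u, ⟨hE u v (by rwa [Sym2.eq_swap]), he⟩, rfl⟩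
    · rintro ⟨u, ⟨-, hu⟩, rfl⟩
      exact ⟨hu, by simp⟩
  rw [edgeDegree, this, Finset.card_image_of_injOn]
  exact fun a _ b _ hab => Sym2.congr_right.1 hab

/-- In a minimum spanning tree without isosceles triples all degrees are at most the strict
kissing number. -/
theorem spanLength_strictKissingNumber_le {B : Finset ι} {x : ι → Pt d}
    (hx : ∀ i ∈ B, ∀ j ∈ B, ∀ l ∈ B, i ≠ j → i ≠ l → j ≠ l → dist (x i) (x j) ≠ dist (x i) (x l))
    (hinj : Set.InjOn x B) {n : ℕ} (hn : 2 ≤ n) (hB : B.card ≤ n) :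
    spanLength (strictKissingNumber d) x B ≤ spanLength n x B := by
  obtain ⟨E, hE, hl⟩ := exists_isSpanning_eq hn x B
  rw [← hl]
  refine IsSpanning.spanLength_le ⟨⟨hE.mem, hE.ne, fun v => ?_⟩, hE.joined⟩ x
  rw [edgeDegree_eq_card hE.mem]
  by_cases hvB : v ∈ B
  swap
  · rw [Finset.filter_false_of_mem fun u _ hu => hvB (hE.mem v u hu)]
    exact Nat.zero_le _
  refine card_le_strictKissingNumber (y := fun u => x u - x v) (fun u hu => ?_)
    fun u hu w hw huw => ?_
  · rw [Finset.mem_filter] at hu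
    rw [sub_ne_zero]
    exact fun h => hE.ne v u hu.2 (hinj hvB hu.1 h.symm)
  · rw [Finset.mem_filter] at hu hw
    rw [dist_sub_right, ← dist_eq_norm]
    have hvu := hE.ne v u hu.2
    have hvw := hE.ne v w hw.2
    refine lt_of_le_of_ne ?_ (hx u hu.1 v hvB w hw.1 hvu.symm huw hvw)
    -- Otherwise replace the edge `vu` by the shorter `uw`. The graph stays connected through `w`,
    -- and the degree bound `n` is vacuous because `|B| ≤ n`, so minimality is contradicted.
    by_contra! hlt
    have he : s(v, u) ∈ E := hu.2
    have hmem : ∀ a b, s(a, b) ∈ insert s(u, w) (E.erase s(v, u)) → a ∈ B := by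
      intro a b hab
      rcases Finset.mem_insert.1 hab with hab | hab
      · rcases Sym2.eq_iff.1 hab with ⟨rfl, -⟩ | ⟨rfl, -⟩
        · exact hu.1
        · exact hw.1
      · exact hE.mem a b (Finset.mem_of_mem_erase hab)
    have hsp : IsSpanning n B (insert s(u, w) (E.erase s(v, u))) := by
      refine ⟨⟨hmem, fun a b hab => ?_, fun z => ?_⟩, fun a ha b hb => ?_⟩
      · rcases Finset.mem_insert.1 hab with hab | hab
        · rcases Sym2.eq_iff.1 hab with ⟨rfl, rfl⟩ | ⟨rfl, rfl⟩
          · exact huw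
          · exact huw.symm
        · exact hE.ne a b (Finset.mem_of_mem_erase hab)
      · rw [edgeDegree_eq_card hmem]
        exact (Finset.card_filter_le _ _).trans hB
      · refine (hE.joined a ha b hb).of_forall_edge fun p q hpq => ?_
        have hvu' : Joined (insert s(u, w) (E.erase s(v, u))) v u := by
          have h1 : s(v, w) ∈ insert s(u, w) (E.erase s(v, u)) :=
            Finset.mem_insert_of_mem (Finset.mem_erase.2
              ⟨fun h => huw (Sym2.congr_right.1 h).symm, hw.2⟩)
          exact (Joined.of_mem h1).trans (Joined.of_mem (Finset.mem_insert_self _ _)).symm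
        by_cases hq : s(p, q) = s(v, u)
        · rcases Sym2.eq_iff.1 hq with ⟨rfl, rfl⟩ | ⟨rfl, rfl⟩
          · exact hvu'
          · exact hvu'.symm
        · exact Joined.of_mem (Finset.mem_insert_of_mem (Finset.mem_erase.2 ⟨hq, hpq⟩))
    have h1 := hsp.spanLength_le x
    have h2 := totalLength_insert_le x (E.erase s(v, u)) s(u, w)
    rw [totalLength_erase x he, edgeLength_mk, edgeLength_mk] at h2
    rw [dist_comm (x v)] at h2
    linarith

end Kissing

/-- On `n` points `mst` is `mstDeg n`, which for generic points equals `mstDeg` at the strict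
kissing number. -/
theorem isAsymptoticConstant_mst (hd : 2 ≤ d) {β : ℝ}
    (h : IsAsymptoticConstant d (mstDeg (strictKissingNumber d)) β) :
    IsAsymptoticConstant d mst β := by
  classical
  have hk : 2 ≤ strictKissingNumber d := by linarith [three_le_strictKissingNumber hd]
  filter_upwards [h, ae_dist_ne_dist hd] with x hx hne
  have hinj := injective_of_dist_ne_dist hne
  refine hx.congr' ?_
  filter_upwards [eventually_ge_atTop 2] with n hn
  congr 1
  have hX : ((Finset.range n).image x).Nonempty :=
    (Finset.nonempty_range_iff.2 (by omega)).image x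
  refine le_antisymm ?_ (mst_le_mstDeg hk (by convert hX))
  have hcard : ((Finset.range n).image x).card ≤ n :=
    Finset.card_image_le.trans (by simp)
  rw [mst_eq_mstDeg (k := n) (by convert hcard), mstDeg_image_range hk hinj (by omega),
    mstDeg_image_range hn hinj (by omega)]
  exact spanLength_strictKissingNumber_le (fun i _ j _ l _ => hne i j l) hinj.injOn hn (by simp)

end

/-! ### Saving length by one more unit of degree -/

section

section Swap

variable {ι : Type*} [DecidableEq ι] {d k : ℕ}

/-- If all points but `c` are at distance at least `b` from each of the more than `k` points of
`P`, which are within `a` of `c`, then an edge at a point of `P` can be replaced by one to `c`. -/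
theorem IsSpanning.exists_swap {B : Finset ι} {E : Finset (Sym2 ι)} (hE : IsSpanning (k + 1) B E)
    {c : ι} (hc : c ∈ B) (hdeg : edgeDegree E c ≤ k) {P : Finset ι} (hPB : P ⊆ B)
    (hcard : k < P.card) (hcP : c ∉ P) {x : ι → Pt d} {a b : ℝ}
    (ha : ∀ p ∈ P, dist (x p) (x c) ≤ a)
    (hb : ∀ p ∈ P, ∀ q ∈ B, q ≠ p → q ≠ c → b ≤ dist (x p) (x q)) :
    ∃ F, IsSpanning (k + 1) B F ∧ totalLength x F ≤ totalLength x E - (b - a) ∧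
      ∀ v ≠ c, edgeDegree F v ≤ edgeDegree E v := by
  -- The degree of `c` is less than `|P|`. For a non-neighbour `p`, the first edge `pq` of a path
  -- from `p` to `c` is exchanged for `pc`; the rest of the path keeps `q` joined to `c`.
  obtain ⟨p, hpP, hpc⟩ : ∃ p ∈ P, s(p, c) ∉ E := by
    by_contra! h
    rw [edgeDegree_eq_card hE.mem] at hdeg
    refine absurd (Finset.card_le_card (s := P) fun p hp => ?_) (not_le.2 (hdeg.trans_lt hcard))
    exact Finset.mem_filter.2 ⟨hPB hp, by rw [Sym2.eq_swap]; exact h p hp⟩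
  have hpne : p ≠ c := fun h => hcP (h ▸ hpP)
  obtain ⟨w⟩ := hE.joined p (hPB hpP) c hc
  obtain ⟨w, hw⟩ := w.toPath
  cases w with
  | nil => exact absurd rfl hpne
  | @cons _ q _ hadj w =>
    rw [SimpleGraph.Walk.isPath_def, SimpleGraph.Walk.support_cons, List.nodup_cons] at hw
    rw [SimpleGraph.fromEdgeSet_adj] at hadj
    have hpq : s(p, q) ∈ E := by simpa using hadj.1
    have hqp : q ≠ p := hadj.2.symm
    have hqc : q ≠ c := fun h => hpc (h ▸ hpq)
    have hqB : q ∈ B := hE.mem q p (by rwa [Sym2.eq_swap])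
    have hqcj : Joined (E.erase s(p, q)) q c := joined_erase_of_walk w hw.1
    have hdegree : ∀ v ≠ c, edgeDegree (insert s(p, c) (E.erase s(p, q))) v ≤ edgeDegree E v := by
      intro v hv
      by_cases hvp : v = p
      · subst hvp
        refine (edgeDegree_insert_le _ _ _).trans ?_
        rw [edgeDegree_erase_of_mem hpq (by simp)]
      · rw [edgeDegree_insert_of_notMem (by simp [hv, hvp])]
        exact edgeDegree_mono (Finset.erase_subset _ _) v
    refine ⟨insert s(p, c) (E.erase s(p, q)), ⟨⟨fun u v huv => ?_, fun u v huv => ?_,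
      fun v => ?_⟩, fun u hu v hv => ?_⟩, ?_, hdegree⟩
    · rcases Finset.mem_insert.1 huv with huv | huv
      · rcases Sym2.eq_iff.1 huv with ⟨rfl, -⟩ | ⟨rfl, -⟩
        · exact hPB hpP
        · exact hc
      · exact hE.mem u v (Finset.mem_of_mem_erase huv)
    · rcases Finset.mem_insert.1 huv with huv | huv
      · rcases Sym2.eq_iff.1 huv with ⟨rfl, rfl⟩ | ⟨rfl, rfl⟩
        · exact hpne
        · exact hpne.symm
      · exact hE.ne u v (Finset.mem_of_mem_erase huv)
    · by_cases hv : v = c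
      · subst hv
        refine (edgeDegree_insert_le _ _ _).trans (Nat.succ_le_succ ?_)
        exact (edgeDegree_mono (Finset.erase_subset _ _) v).trans hdeg
      · exact (hdegree v hv).trans (hE.degree_le v)
    · refine (hE.joined u hu v hv).of_forall_edge fun r s hrs => ?_
      have hpq' : Joined (insert s(p, c) (E.erase s(p, q))) p q :=
        (Joined.of_mem (Finset.mem_insert_self _ _)).trans
          (hqcj.mono (Finset.subset_insert _ _)).symm
      by_cases h : s(r, s) = s(p, q)
      · rcases Sym2.eq_iff.1 h with ⟨rfl, rfl⟩ | ⟨rfl, rfl⟩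
        · exact hpq'
        · exact hpq'.symm
      · exact Joined.of_mem (Finset.mem_insert_of_mem (Finset.mem_erase.2 ⟨h, hrs⟩))
    · have h1 := totalLength_insert_le x (E.erase s(p, q)) s(p, c)
      rw [totalLength_erase x hpq, edgeLength_mk, edgeLength_mk] at h1
      linarith [ha p hpP, hb p hpP q hqB hqp hqc]

/-- Swaps can be made one after another because each raises only the degree of its own centre, so
the centres still to come keep degree at most `k`. -/
theorem IsSpanning.exists_le_sub {B : Finset ι} {x : ι → Pt d} {a b : ℝ} {C : Finset ι}
    (hC : ∀ c ∈ C, c ∈ B ∧ ∃ P ⊆ B, k < P.card ∧ c ∉ P ∧ (∀ p ∈ P, dist (x p) (x c) ≤ a) ∧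
      ∀ p ∈ P, ∀ q ∈ B, q ≠ p → q ≠ c → b ≤ dist (x p) (x q))
    {E : Finset (Sym2 ι)} (hE : IsSpanning (k + 1) B E) (hdeg : ∀ c ∈ C, edgeDegree E c ≤ k) :
    ∃ F, IsSpanning (k + 1) B F ∧ totalLength x F ≤ totalLength x E - C.card * (b - a) := by
  induction C using Finset.induction_on generalizing E with
  | empty => exact ⟨E, hE, by simp⟩
  | insert c C hcC ih =>
    obtain ⟨hcB, P, hPB, hcard, hcP, ha, hb⟩ := hC c (Finset.mem_insert_self _ _)
    obtain ⟨F, hF, hFl, hFd⟩ := hE.exists_swap hcB (hdeg c (Finset.mem_insert_self _ _)) hPB hcard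
      hcP ha hb
    obtain ⟨G, hG, hGl⟩ := ih (fun e he => hC e (Finset.mem_insert_of_mem he)) hF fun e he =>
      (hFd e fun h => hcC (h ▸ he)).trans (hdeg e (Finset.mem_insert_of_mem he))
    refine ⟨G, hG, hGl.trans ?_⟩
    rw [Finset.card_insert_of_notMem hcC]
    push_cast
    linarith

theorem spanLength_succ_le_sub (hk : 2 ≤ k) {B : Finset ι} {x : ι → Pt d} {a b : ℝ} {C : Finset ι}
    (hC : ∀ c ∈ C, c ∈ B ∧ ∃ P ⊆ B, k < P.card ∧ c ∉ P ∧ (∀ p ∈ P, dist (x p) (x c) ≤ a) ∧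
      ∀ p ∈ P, ∀ q ∈ B, q ≠ p → q ≠ c → b ≤ dist (x p) (x q)) :
    spanLength (k + 1) x B ≤ spanLength k x B - C.card * (b - a) := by
  obtain ⟨E, hE, hl⟩ := exists_isSpanning_eq hk x B
  obtain ⟨F, hF, hFl⟩ := IsSpanning.exists_le_sub hC
    ⟨⟨hE.mem, hE.ne, fun v => (hE.degree_le v).trans (Nat.le_succ k)⟩, hE.joined⟩
    fun c _ => hE.degree_le c
  rw [← hl]
  exact (hF.spanLength_le x).trans hFl

end Swap

end

/-! ### Gadgets from strict kissing configurations; cells and probabilities -/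

section

variable {d k : ℕ}

/-- A robust local configuration for which a vertex with `K` neighbours saves length: for all
`y l` in the balls of radius `s * ρ` around `z + s • u l`, the point `y 0` is within `s * a` of the
other `y l`, which are at distance at least `s * b` from each other and from all points outside the
ball of radius `s * R` around `z`. -/
structure IsGadget {K : ℕ} (u : Fin (K + 1) → Pt d) (ρ a b R : ℝ) : Prop where
  radius_pos : 0 < ρ
  lt : a < b
  pos : 0 < b
  outer_pos : 0 < R
  mem_outer : ∀ (z : Pt d) (s : ℝ), 0 < s → ∀ l v, dist v (z + s • u l) < s * ρ → dist v z < s * R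
  dist_le : ∀ (z : Pt d) (s : ℝ), 0 < s → ∀ y : Fin (K + 1) → Pt d,
    (∀ l, dist (y l) (z + s • u l) < s * ρ) → ∀ l, dist (y l) (y 0) ≤ s * a
  le_dist : ∀ (z : Pt d) (s : ℝ), 0 < s → ∀ y : Fin (K + 1) → Pt d,
    (∀ l, dist (y l) (z + s • u l) < s * ρ) →
      ∀ l, l ≠ 0 → ∀ l', l' ≠ 0 → l ≠ l' → s * b ≤ dist (y l) (y l')
  le_dist_outer : ∀ (z : Pt d) (s : ℝ), 0 < s → ∀ l v, dist v (z + s • u l) < s * ρ →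
    ∀ w, s * R ≤ dist w z → s * b ≤ dist v w

/-- The sphere centres have norm `2 + ε` and are more than `2 + 2ε` apart. Perturbing every point by
`ε / 8` changes a distance by at most `ε / 4`, which still leaves `a = 2 + ε + ε/4 < b = 2 + 2ε -
ε/4`. The outer radius exceeds `2 + ε + ε/8 + b`, so outside points are at distance at least `b`. -/
theorem HasStrictKissingConfiguration.exists_isGadget {K : ℕ}
    (h : HasStrictKissingConfiguration d K) :
    ∃ (u : Fin (K + 1) → Pt d) (ρ a b R : ℝ), IsGadget u ρ a b R := by
  obtain ⟨ε, hε, c, hc, hdis⟩ := h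
  have hcc : ∀ i j, i ≠ j → 2 + 2 * ε < dist (c i) (c j) := fun i j hij => by
    have := (disjoint_closedBall_closedBall_iff (by linarith) (by linarith)).1 (hdis hij)
    linarith
  have hu : ∀ l, ‖(Fin.cons 0 c : Fin (K + 1) → Pt d) l‖ ≤ 2 + ε := by
    intro l
    refine Fin.cases ?_ (fun i => ?_) l
    · simp only [Fin.cons_zero, norm_zero]
      linarith
    · have := hc i
      rw [dist_zero_right] at this
      simp only [Fin.cons_succ]
      linarith
  have key : ∀ (z : Pt d) (s : ℝ), 0 < s → ∀ l, ∀ v,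
      dist v (z + s • (Fin.cons 0 c : Fin (K + 1) → Pt d) l) < s * (ε / 8) →
      dist v z < s * (2 + ε + ε / 8) := by
    intro z s hs l v hv
    have h1 : dist (z + s • (Fin.cons 0 c : Fin (K + 1) → Pt d) l) z ≤ s * (2 + ε) := by
      rw [dist_eq_norm, add_sub_cancel_left, norm_smul, Real.norm_of_nonneg hs.le]
      exact mul_le_mul_of_nonneg_left (hu l) hs.le
    have h2 := dist_triangle v (z + s • (Fin.cons 0 c : Fin (K + 1) → Pt d) l) z
    linarith
  refine ⟨Fin.cons 0 c, ε / 8, 2 + ε + ε / 4, 2 + 2 * ε - ε / 4, 5 + 4 * ε, by linarith,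
    by linarith, by linarith, by linarith, fun z s hs l v hv =>
      (key z s hs l v hv).trans_le (mul_le_mul_of_nonneg_left (by linarith) hs.le),
    fun z s hs y hy l => ?_, fun z s hs y hy l hl l' hl' hll => ?_, fun z s hs l v hv w hw => ?_⟩
  · have h0 := hy 0
    rw [Fin.cons_zero, smul_zero, add_zero] at h0
    have h1 := key z s hs l (y l) (hy l)
    have h2 := dist_triangle_right (y l) (y 0) z
    have h3 : s * (2 + ε + ε / 4) = s * (2 + ε + ε / 8) + s * (ε / 8) := by ring
    linarith
  · obtain ⟨i, rfl⟩ := Fin.exists_succ_eq.2 hl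
    obtain ⟨j, rfl⟩ := Fin.exists_succ_eq.2 hl'
    have h1 := hy i.succ
    have h2 := hy j.succ
    rw [Fin.cons_succ] at h1 h2
    have h3 : dist (z + s • c i) (z + s • c j) = s * dist (c i) (c j) := by
      rw [dist_add_left, dist_smul₀, Real.norm_of_nonneg hs.le]
    have h4 := mul_lt_mul_of_pos_left (hcc i j fun h => hll (by rw [h])) hs
    have h5 := dist_triangle4_left (y i.succ) (y j.succ) (z + s • c i) (z + s • c j)
    have h6 : s * (2 + 2 * ε - ε / 4) = s * (2 + 2 * ε) - s * (ε / 8) - s * (ε / 8) := by ring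
    linarith
  · have h1 := key z s hs l v hv
    have h2 := dist_triangle_left w z v
    have h3 : s * (5 + 4 * ε) = s * (2 + ε + ε / 8) + s * (2 + 2 * ε - ε / 4) +
      s * (1 + ε * (9 / 8)) := by ring
    have h4 : 0 < s * (1 + ε * (9 / 8)) := by positivity
    linarith

/-- The centre of the subcube of side `1 / m` with index `Q`. -/
def cellCenter {m : ℕ} (Q : Fin d → Fin m) : Pt d :=
  cellMap Q (WithLp.toLp 2 fun _ => 1 / 2)

theorem cellCenter_apply {m : ℕ} (Q : Fin d → Fin m) (l : Fin d) :
    cellCenter Q l = ((Q l : ℝ) + 1 / 2) / m := rfl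

theorem ball_cellCenter_subset {m : ℕ} (Q : Fin d → Fin m) {r : ℝ} (hr : r ≤ 1 / (2 * m)) :
    Metric.ball (cellCenter Q) r ⊆ cube d := by
  intro v hv l
  have hm : (0 : ℝ) < m := by exact_mod_cast (Q l).pos
  have hq : ((Q l : ℕ) : ℝ) + 1 ≤ m := by exact_mod_cast (Q l).2
  have h1 : |v l - cellCenter Q l| ≤ 1 / (2 * m) := by
    rw [Metric.mem_ball, dist_eq_norm] at hv
    exact (PiLp.norm_apply_le (v - cellCenter Q) l).trans (hv.le.trans hr)
  rw [cellCenter_apply, abs_le] at h1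
  have e1 : ((Q l : ℝ) + 1 / 2) / m - 1 / (2 * m) = (Q l : ℝ) / m := by field_simp; ring
  have e2 : ((Q l : ℝ) + 1 / 2) / m + 1 / (2 * m) = ((Q l : ℝ) + 1) / m := by field_simp; ring
  have h2 : (0 : ℝ) ≤ (Q l : ℝ) / m := by positivity
  have h3 : ((Q l : ℝ) + 1) / m ≤ 1 := by rwa [div_le_one hm]
  constructor <;> linarith

theorem le_dist_cellCenter {m : ℕ} {Q Q' : Fin d → Fin m} (h : Q ≠ Q') :
    1 / (m : ℝ) ≤ dist (cellCenter Q) (cellCenter Q') := by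
  obtain ⟨l, hl⟩ := Function.ne_iff.1 h
  have hm : (0 : ℝ) < m := by exact_mod_cast (Q l).pos
  have h1 : |cellCenter Q l - cellCenter Q' l| ≤ dist (cellCenter Q) (cellCenter Q') := by
    rw [dist_eq_norm]
    exact PiLp.norm_apply_le (cellCenter Q - cellCenter Q') l
  refine le_trans ?_ h1
  have e1 : cellCenter Q l - cellCenter Q' l = (((Q l : ℤ) - (Q' l : ℤ) : ℤ) : ℝ) / m := by
    rw [cellCenter_apply, cellCenter_apply]
    push_cast
    ring
  rw [e1, abs_div, abs_of_pos hm, ← Int.cast_abs]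
  refine div_le_div_of_nonneg_right ?_ hm.le
  have h2 : (1 : ℤ) ≤ |(Q l : ℤ) - (Q' l : ℤ)| :=
    Int.one_le_abs (sub_ne_zero.2 fun h => hl (Fin.ext (by exact_mod_cast h)))
  exact_mod_cast h2

theorem uniformCube_real_ball {z : Pt d} {r : ℝ} (hr : 0 < r) (h : Metric.ball z r ⊆ cube d) :
    (uniformCube d).real (Metric.ball z r) =
      r ^ d * (volume : Measure (Pt d)).real (Metric.ball 0 1) := by
  rw [measureReal_def, uniformCube, Measure.restrict_apply Metric.isOpen_ball.measurableSet,
    Set.inter_eq_left.2 h, Measure.addHaar_ball_of_pos _ _ hr, finrank_euclideanSpace_fin,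
    ENNReal.toReal_mul, ENNReal.toReal_ofReal (by positivity), measureReal_def]

/-- The event that the points with indices `J l` lie in `D l` and all others avoid `U`. -/
def exactlyIn {X : Type*} {n K : ℕ} (J : Fin K ↪ Fin n) (D : Fin K → Set X) (U : Set X) :
    Set (Fin n → X) :=
  {x | (∀ l, x (J l) ∈ D l) ∧ ∀ i, i ∉ Set.range J → x i ∉ U}

theorem measurableSet_exactlyIn {X : Type*} [MeasurableSpace X] {n K : ℕ} (J : Fin K ↪ Fin n)
    {D : Fin K → Set X} {U : Set X} (hD : ∀ l, MeasurableSet (D l)) (hU : MeasurableSet U) :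
    MeasurableSet (exactlyIn J D U) := by
  have h : exactlyIn J D U = (⋂ l, (fun x : Fin n → X => x (J l)) ⁻¹' D l) ∩
      ⋂ i, ⋂ (_ : i ∉ Set.range J), (fun x : Fin n → X => x i) ⁻¹' Uᶜ := by
    ext x
    simp [exactlyIn]
  rw [h]
  exact (MeasurableSet.iInter fun l => measurable_pi_apply (J l) (hD l)).inter
    (MeasurableSet.iInter fun i => MeasurableSet.iInter fun _ => measurable_pi_apply i hU.compl)

/-- The event is a product set. The exponent `n` in place of `n - K` only weakens the bound. -/
theorem le_measureReal_exactlyIn {X : Type*} [MeasurableSpace X] (ν : Measure X)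
    [IsProbabilityMeasure ν] {n K : ℕ} (J : Fin K ↪ Fin n) {D : Fin K → Set X} {U : Set X}
    (hU : MeasurableSet U) {w q : ℝ} (hw : 0 ≤ w) (hD : ∀ l, w ≤ ν.real (D l)) (hq0 : 0 ≤ q)
    (hq1 : q ≤ 1) (hq : ν.real U ≤ q) :
    w ^ K * (1 - q) ^ n ≤ (Measure.pi fun _ : Fin n => ν).real (exactlyIn J D U) := by
  classical
  let S : Fin n → Set X := fun i => if h : ∃ l, J l = i then D h.choose else Uᶜ
  have hSJ : ∀ l, S (J l) = D l := by
    intro l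
    have h : ∃ l', J l' = J l := ⟨l, rfl⟩
    simp only [S, dif_pos h]
    rw [J.injective h.choose_spec]
  have hSU : ∀ i, i ∉ Set.range J → S i = Uᶜ := fun i hi => dif_neg hi
  have hset : exactlyIn J D U = Set.univ.pi S := by
    ext x
    simp only [exactlyIn, Set.mem_ofPred_eq, Set.mem_univ_pi]
    constructor
    · rintro ⟨h1, h2⟩ i
      by_cases hi : i ∈ Set.range J
      · obtain ⟨l, rfl⟩ := hi
        rw [hSJ]
        exact h1 l
      · rw [hSU i hi]
        exact h2 i hi
    · intro h
      refine ⟨fun l => hSJ l ▸ h (J l), fun i hi => ?_⟩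
      have := h i
      rwa [hSU i hi] at this
  have h1 : ∏ i, (if i ∈ Finset.univ.map J then w else 1 - q) ≤ ∏ i, ν.real (S i) := by
    refine Finset.prod_le_prod (fun i _ => ?_) fun i _ => ?_
    · split_ifs
      · exact hw
      · linarith
    · split_ifs with hi
      · obtain ⟨l, -, rfl⟩ := Finset.mem_map.1 hi
        rw [hSJ]
        exact hD l
      · rw [hSU i (by simpa using hi), measureReal_compl hU, probReal_univ]
        linarith
  rw [hset, measureReal_def, Measure.pi_pi, ENNReal.toReal_prod]
  refine le_trans ?_ h1
  rw [Finset.prod_ite, Finset.prod_const, Finset.prod_const, Finset.filter_mem_eq_inter,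
    Finset.univ_inter, Finset.card_map, Finset.card_univ, Fintype.card_fin]
  refine mul_le_mul_of_nonneg_left (pow_le_pow_of_le_one (by linarith) (by linarith) ?_)
    (by positivity)
  exact (Finset.card_filter_le _ _).trans (by simp)

end

/-! ### Counting gadgets; strict decrease of the constants -/

section

variable {d k : ℕ}

/-- The indices `J` show an isolated copy of the gadget in the cell `Q`. -/
def gadgetEvent {K n m : ℕ} (u : Fin (K + 1) → Pt d) (ρ R s : ℝ)
    (p : (Fin d → Fin m) × (Fin (K + 1) ↪ Fin n)) : Set (Fin n → Pt d) :=
  exactlyIn p.2 (fun l => Metric.ball (cellCenter p.1 + s • u l) (s * ρ))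
    (Metric.ball (cellCenter p.1) (s * R))

/-- Different events that occur have different centres, so their swaps can be counted separately.
The centre determines the cell since outer balls of different cells are disjoint, and the cell
determines the labelling since no other point lies in its outer ball. -/
theorem IsGadget.injOn {K n m : ℕ} {u : Fin (K + 1) → Pt d} {ρ a b R : ℝ}
    (hg : IsGadget u ρ a b R) {s : ℝ} (hs : 0 < s) (hsR : s * R ≤ 1 / (2 * m)) (x : Fin n → Pt d) :
    Set.InjOn (fun p : (Fin d → Fin m) × (Fin (K + 1) ↪ Fin n) => p.2 0)
      {p | x ∈ gadgetEvent u ρ R s p} := by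
  rintro ⟨Q, J⟩ ⟨hJ, hU⟩ ⟨Q', J'⟩ ⟨hJ', -⟩ h0
  simp only [Metric.mem_ball] at hJ hU hJ' h0
  have hQ : Q = Q' := by
    by_contra hne
    have h1 := le_dist_cellCenter hne
    have h2 := hg.mem_outer _ s hs 0 _ (hJ 0)
    have h3 := hg.mem_outer _ s hs 0 _ (hJ' 0)
    rw [← h0] at h3
    have h4 := dist_triangle_left (cellCenter Q) (cellCenter Q') (x (J 0))
    have h5 : 1 / (m : ℝ) = 1 / (2 * m) + 1 / (2 * m) := by field_simp; norm_num
    linarith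
  subst hQ
  refine Prod.ext rfl (DFunLike.ext _ _ fun l => ?_)
  obtain ⟨l', hl'⟩ : J' l ∈ Set.range J := by
    by_contra h
    exact hU _ h (hg.mem_outer _ s hs l _ (hJ' l))
  by_cases hll : l' = l
  · rw [← hl', hll]
  exfalso
  have hl'0 : l' ≠ 0 := by
    rintro rfl
    rw [h0] at hl'
    exact hll (J'.injective hl')
  have hl0 : l ≠ 0 := by
    rintro rfl
    rw [← h0] at hl'
    exact hll (J.injective hl')
  -- If `J' l = J l'` with `l' ≠ l`, the same point is admissible at both positions, although
  -- admissible points there are at distance at least `s * b > 0`.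
  have h1 := hg.le_dist _ s hs (Function.update (x ∘ J) l (x (J' l))) (fun i => by
    by_cases hi : i = l
    · subst hi
      rw [Function.update_self]
      exact hJ' i
    · rw [Function.update_of_ne hi]
      exact hJ i) l hl0 l' hl'0 (Ne.symm hll)
  rw [Function.update_self, Function.update_of_ne hll, ← hl', Function.comp_apply, dist_self] at h1
  exact absurd h1 (not_le.2 (mul_pos hs hg.pos))

theorem IsGadget.spanLength_succ_add_le (hk : 2 ≤ k) {n m : ℕ} {u : Fin (k + 1 + 1) → Pt d}
    {ρ a b R : ℝ} (hg : IsGadget u ρ a b R) {s : ℝ} (hs : 0 < s) (hsR : s * R ≤ 1 / (2 * m))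
    (x : Fin n → Pt d) :
    spanLength (k + 1) x Finset.univ + ∑ p : (Fin d → Fin m) × (Fin (k + 1 + 1) ↪ Fin n),
      (gadgetEvent u ρ R s p).indicator (fun _ => s * (b - a)) x ≤
        spanLength k x Finset.univ := by
  classical
  let T : Finset ((Fin d → Fin m) × (Fin (k + 1 + 1) ↪ Fin n)) :=
    Finset.univ.filter fun p => x ∈ gadgetEvent u ρ R s p
  have hsum : ∑ p : (Fin d → Fin m) × (Fin (k + 1 + 1) ↪ Fin n),
      (gadgetEvent u ρ R s p).indicator (fun _ => s * (b - a)) x = T.card * (s * b - s * a) := by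
    simp only [Set.indicator_apply]
    rw [← Finset.sum_filter, Finset.sum_const, nsmul_eq_mul, mul_sub]
  have hcard : (T.image fun p => p.2 0).card = T.card :=
    Finset.card_image_of_injOn ((hg.injOn hs hsR x).mono fun p hp => (Finset.mem_filter.1 hp).2)
  have h := spanLength_succ_le_sub hk (B := Finset.univ) (x := x) (a := s * a) (b := s * b)
    (C := T.image fun p => p.2 0) (fun c hc => by
      obtain ⟨⟨Q, J⟩, hp, rfl⟩ := Finset.mem_image.1 hc
      obtain ⟨hJ, hU⟩ := (Finset.mem_filter.1 hp).2
      simp only [Metric.mem_ball] at hJ hU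
      refine ⟨Finset.mem_univ _, (Finset.univ.erase 0).map J, Finset.subset_univ _, ?_, ?_,
        fun p hp => ?_, fun p hp q _ hqp hq0 => ?_⟩
      · rw [Finset.card_map, Finset.card_erase_of_mem (Finset.mem_univ _), Finset.card_univ,
          Fintype.card_fin]
        omega
      · simp
      · obtain ⟨l, -, rfl⟩ := Finset.mem_map.1 hp
        exact hg.dist_le _ s hs (x ∘ J) hJ l
      · obtain ⟨l, hl, rfl⟩ := Finset.mem_map.1 hp
        by_cases hq : q ∈ Set.range J
        · obtain ⟨l', rfl⟩ := hq
          exact hg.le_dist _ s hs (x ∘ J) hJ l (Finset.ne_of_mem_erase hl) l'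
            (fun h => hq0 (by rw [h])) fun h => hqp (by rw [h])
        · exact hg.le_dist_outer _ s hs l _ (hJ l) _ (not_lt.1 (hU q hq)))
  rw [hcard] at h
  rw [hsum]
  linarith

/-- Take `n = m ^ d` points and scale `s = t / m`. An event has probability at least `w ^ (k + 2) /
2` with `w` proportional to `1 / n`, and there are at least `n (n / 2) ^ (k + 2)` events. So at
least a constant times `n` of them are expected to occur, each saving `t (b - a) / m`; and `n / m =
n ^ expo d`. -/
theorem IsGadget.meanLength_succ_add_le (hd : 2 ≤ d) (hk : 2 ≤ k) {m : ℕ} (hm : 1 ≤ m)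
    {u : Fin (k + 1 + 1) → Pt d} {ρ a b R : ℝ} (hg : IsGadget u ρ a b R) {t : ℝ} (ht : 0 < t)
    (htR : t * R ≤ 1 / 2)
    (hV : (t * R) ^ d * (volume : Measure (Pt d)).real (Metric.ball 0 1) ≤ 1 / 2)
    (hn : 2 * (k + 1 + 1) ≤ m ^ d) :
    meanLength d (k + 1) (m ^ d) + t * (b - a) *
      (((t * ρ) ^ d * (volume : Measure (Pt d)).real (Metric.ball 0 1) / 2) ^ (k + 1 + 1) / 2) *
        ((m ^ d : ℕ) : ℝ) ^ expo d ≤ meanLength d k (m ^ d) := by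
  set n := m ^ d with hn_def
  set V := (volume : Measure (Pt d)).real (Metric.ball 0 1) with hV_def
  have hV0 : 0 ≤ V := measureReal_nonneg
  have hm0 : (0 : ℝ) < m := by exact_mod_cast hm
  have hn0 : (0 : ℝ) < n := by exact_mod_cast (by omega : 0 < n)
  have hnm : (n : ℝ) = (m : ℝ) ^ d := by rw [hn_def]; push_cast; rfl
  set s := t / m with hs_def
  have hs : 0 < s := div_pos ht hm0
  have hsR : s * R ≤ 1 / (2 * m) := by
    rw [hs_def, div_mul_eq_mul_div, div_le_div_iff₀ hm0 (by positivity)]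
    nlinarith
  have hR := hg.outer_pos
  have hρ := hg.radius_pos
  have hab := hg.lt
  set w := (t * ρ) ^ d * V / n with hw_def
  set q := (t * R) ^ d * V / n with hq_def
  have hball : ∀ (z : Pt d) (r : ℝ), 0 < r → Metric.ball z (s * r) ⊆ cube d →
      (uniformCube d).real (Metric.ball z (s * r)) = (t * r) ^ d * V / n := by
    intro z r hr hz
    rw [uniformCube_real_ball (mul_pos hs hr) hz, hnm, hs_def, div_mul_eq_mul_div, div_pow,
      div_mul_eq_mul_div]
  have houter : ∀ Q : Fin d → Fin m, Metric.ball (cellCenter Q) (s * R) ⊆ cube d :=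
    fun Q => ball_cellCenter_subset Q hsR
  have hq0 : 0 ≤ q := by positivity
  have hnq : n * q ≤ 1 / 2 := by
    rw [hq_def, mul_div_cancel₀ _ hn0.ne']
    exact hV
  have hq1 : q ≤ 1 := by
    have : (1 : ℝ) ≤ n := by exact_mod_cast (by omega : 1 ≤ n)
    nlinarith
  -- Bernoulli's inequality together with `n * q ≤ 1 / 2`.
  have hpow : 1 / 2 ≤ (1 - q) ^ n := by
    have := one_add_mul_le_pow (a := -q) (by linarith) n
    rw [← sub_eq_add_neg] at this
    linarith
  have hprob : ∀ p : (Fin d → Fin m) × (Fin (k + 1 + 1) ↪ Fin n), w ^ (k + 1 + 1) * (1 / 2) ≤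
      (Measure.pi fun _ : Fin n => uniformCube d).real (gadgetEvent u ρ R s p) := by
    intro p
    refine le_trans (mul_le_mul_of_nonneg_left hpow (by positivity))
      (le_measureReal_exactlyIn _ _ Metric.isOpen_ball.measurableSet (by positivity) (fun l => ?_)
        hq0 hq1 (hball _ R hR (houter p.1)).le)
    exact (hball _ ρ hρ (Set.Subset.trans (fun v hv => hg.mem_outer _ s hs l v hv)
      (houter p.1))).ge
  have hmeas : ∀ p : (Fin d → Fin m) × (Fin (k + 1 + 1) ↪ Fin n),
      MeasurableSet (gadgetEvent u ρ R s p) := fun p =>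
    measurableSet_exactlyIn _ (fun _ => Metric.isOpen_ball.measurableSet)
      Metric.isOpen_ball.measurableSet
  have hint : ∀ p : (Fin d → Fin m) × (Fin (k + 1 + 1) ↪ Fin n),
      Integrable ((gadgetEvent u ρ R s p).indicator fun _ => s * (b - a))
        (Measure.pi fun _ : Fin n => uniformCube d) := fun p =>
    (integrable_const _).indicator (hmeas p)
  have hint' := integrable_finsetSum Finset.univ fun p _ => hint p
  have h1 := integral_mono ((integrable_spanLength hd (by omega : 2 ≤ k + 1) Finset.univ).add hint')
    (integrable_spanLength hd hk Finset.univ)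
    fun x => hg.spanLength_succ_add_le hk hs hsR x
  simp only [Pi.add_apply] at h1
  rw [integral_add (integrable_spanLength hd (by omega) _) hint',
    integral_finsetSum _ fun p _ => hint p] at h1
  simp only [integral_indicator_const _ (hmeas _), smul_eq_mul] at h1
  have hcount : (n : ℝ) * (n / 2) ^ (k + 1 + 1) ≤
      Fintype.card ((Fin d → Fin m) × (Fin (k + 1 + 1) ↪ Fin n)) := by
    rw [Fintype.card_prod, Fintype.card_embedding_eq, Fintype.card_fun, Fintype.card_fin,
      Fintype.card_fin, Fintype.card_fin, Fintype.card_fin, ← hn_def, Nat.cast_mul]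
    refine mul_le_mul_of_nonneg_left ?_ hn0.le
    refine le_trans ?_ (Nat.cast_le.2 (Nat.pow_sub_le_descFactorial n (k + 1 + 1)))
    rw [Nat.cast_pow (n + 1 - (k + 1 + 1))]
    refine pow_le_pow_left₀ (by positivity : (0 : ℝ) ≤ n / 2) ?_ _
    rw [Nat.cast_sub (by omega)]
    have : ((2 * (k + 1 + 1) : ℕ) : ℝ) ≤ n := by exact_mod_cast hn
    push_cast at this ⊢
    linarith
  have h2 : t * (b - a) * (((t * ρ) ^ d * V / 2) ^ (k + 1 + 1) / 2) * (n : ℝ) ^ expo d ≤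
      ∑ p : (Fin d → Fin m) × (Fin (k + 1 + 1) ↪ Fin n),
        (Measure.pi fun _ : Fin n => uniformCube d).real (gadgetEvent u ρ R s p) *
          (s * (b - a)) := by
    have hsab : 0 ≤ s * (b - a) := mul_nonneg hs.le (by linarith)
    calc t * (b - a) * (((t * ρ) ^ d * V / 2) ^ (k + 1 + 1) / 2) * (n : ℝ) ^ expo d
        = (n * (n / 2) ^ (k + 1 + 1)) * (w ^ (k + 1 + 1) * (1 / 2) * (s * (b - a))) := by
          rw [hn_def, pow_rpow_expo hd hm, ← hn_def, hs_def]
          have : (t * ρ) ^ d * V / 2 = n / 2 * w := by rw [hw_def]; field_simp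
          rw [this, mul_pow]
          field_simp
      _ ≤ Fintype.card ((Fin d → Fin m) × (Fin (k + 1 + 1) ↪ Fin n)) *
          (w ^ (k + 1 + 1) * (1 / 2) * (s * (b - a))) :=
        mul_le_mul_of_nonneg_right hcount (mul_nonneg (by positivity) hsab)
      _ ≤ _ := by
        rw [← nsmul_eq_mul, ← Finset.card_univ, ← Finset.sum_const]
        exact Finset.sum_le_sum fun p _ => mul_le_mul_of_nonneg_right (hprob p) hsab
  exact le_trans (add_le_add_right h2 _) h1

/-- Along `n = m ^ d` the normalized means differ by at least a fixed `κ > 0`, and the gap survives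
in the limit. -/
theorem lt_of_tendsto_meanLength (hd : 2 ≤ d) (hk : 2 ≤ k) (hkn : k < strictKissingNumber d)
    {β β' : ℝ} (hβ : Tendsto (fun n : ℕ => meanLength d k n / (n : ℝ) ^ expo d) atTop (𝓝 β))
    (hβ' : Tendsto (fun n : ℕ => meanLength d (k + 1) n / (n : ℝ) ^ expo d) atTop (𝓝 β')) :
    β' < β := by
  have hK : HasStrictKissingConfiguration d (k + 1) := by
    obtain ⟨ε, hε, c, hc, hdis⟩ := (isGreatest_strictKissingNumber d).1
    refine ⟨ε, hε, fun i => c (Fin.castLE hkn i), fun i => hc _,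
      fun i j hij => hdis fun h => hij ?_⟩
    exact Fin.castLE_injective hkn h
  obtain ⟨u, ρ, a, b, R, hg⟩ := hK.exists_isGadget
  have hR := hg.outer_pos
  have hρ := hg.radius_pos
  have hab := hg.lt
  set V := (volume : Measure (Pt d)).real (Metric.ball 0 1) with hV_def
  have hV0 : 0 < V := by
    refine ENNReal.toReal_pos (Metric.measure_ball_pos _ _ one_pos).ne' measure_ball_lt_top.ne
  -- The outer radius in units of the cell side: at most `1 / 2` so that outer balls stay in their
  -- cells, and small enough that an outer ball contains at most half a point on average.
  set r := min (1 / 2) (1 / (2 * V)) with hr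
  have hr0 : 0 < r := by positivity
  have hrV : r ^ d * V ≤ 1 / 2 := by
    have h1 : r ^ d ≤ r := by
      have h2 : r ≤ 1 := (min_le_left _ _).trans (by norm_num)
      simpa using pow_le_pow_of_le_one hr0.le h2 (by omega : 1 ≤ d)
    calc r ^ d * V ≤ 1 / (2 * V) * V :=
          mul_le_mul_of_nonneg_right (h1.trans (min_le_right _ _)) hV0.le
      _ = 1 / 2 := by field_simp
  have ht : 0 < r / R := div_pos hr0 hR
  have htR : r / R * R = r := div_mul_cancel₀ _ hR.ne'
  set κ := r / R * (b - a) * (((r / R * ρ) ^ d * V / 2) ^ (k + 1 + 1) / 2) with hκ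
  have hκ0 : 0 < κ := by
    have : 0 < b - a := by linarith
    positivity
  have hpow : Tendsto (fun m : ℕ => m ^ d) atTop atTop := tendsto_pow_atTop (by omega)
  have h1 := (hβ'.comp hpow).add_const κ
  have h2 := le_of_tendsto_of_tendsto h1 (hβ.comp hpow) (by
    filter_upwards [eventually_ge_atTop 1, hpow.eventually_ge_atTop (2 * (k + 1 + 1))] with m hm hn
    have hmain := hg.meanLength_succ_add_le hd hk hm ht (htR.trans_le (min_le_left _ _))
      (by rw [htR]; exact hrV) hn
    have hn0 : 0 < ((m ^ d : ℕ) : ℝ) ^ expo d :=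
      Real.rpow_pos_of_pos (by exact_mod_cast (by omega : 0 < m ^ d)) _
    simp only [Function.comp_apply]
    rw [div_add' _ _ _ hn0.ne']
    exact div_le_div_of_nonneg_right hmain hn0.le)
  linarith

end

end EuclideanFunctional

end

theorem theorem1p2 (d : ℕ) (hd : 2 ≤ d) :
    ∃ (βTSP βMST : ℝ) (βMSTdeg : ℕ → ℝ),
      IsAsymptoticConstant d tsp βTSP ∧
      IsAsymptoticConstant d mst βMST ∧
      (∀ k, 2 ≤ k → IsAsymptoticConstant d (mstDeg k) (βMSTdeg k)) ∧
      βTSP = βMSTdeg 2 ∧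
      (∀ k, 2 ≤ k → k < strictKissingNumber d → βMSTdeg k > βMSTdeg (k + 1)) ∧
      βMSTdeg (strictKissingNumber d) = βMST ∧
      βMST < βTSP := by
  have hτ := three_le_strictKissingNumber hd
  have h : ∀ k, ∃ β, 2 ≤ k →
      Tendsto (fun n : ℕ => meanLength d k n / (n : ℝ) ^ expo d) atTop (𝓝 β) := fun k => by
    by_cases hk : 2 ≤ k
    · obtain ⟨β, hβ⟩ := exists_tendsto_meanLength hd hk
      exact ⟨β, fun _ => hβ⟩
    -- An arbitrary value: degree bounds below 2 do not enter the statement.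
    · exact ⟨0, fun h => absurd h hk⟩
  choose β hβ using h
  have hdeg : ∀ k, 2 ≤ k → IsAsymptoticConstant d (mstDeg k) (β k) := fun k hk =>
    isAsymptoticConstant_mstDeg hd hk (ae_tendsto_spanLength hd hk (hβ k hk))
  have hlt : ∀ k, 2 ≤ k → k < strictKissingNumber d → β (k + 1) < β k := fun k hk hkn =>
    lt_of_tendsto_meanLength hd hk hkn (hβ k hk) (hβ (k + 1) (by omega))
  have hanti : ∀ k, 3 ≤ k → k ≤ strictKissingNumber d → β k < β 2 := by
    intro k hk
    induction k, hk using Nat.le_induction with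
    | base => exact fun h => hlt 2 le_rfl h
    | succ k hk ih => exact fun h => (hlt k (by omega) h).trans (ih (by omega))
  exact ⟨β 2, β (strictKissingNumber d), β,
    isAsymptoticConstant_tsp hd (ae_tendsto_spanLength hd le_rfl (hβ 2 le_rfl)),
    isAsymptoticConstant_mst hd (hdeg _ (by omega)), hdeg, rfl, hlt, rfl, hanti _ hτ le_rfl⟩
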